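/- Let $k$ be a commutative ring, $A$ and $U$ unital associative $k$-algebras, and $U$ a left bialgebroid over $A$ with source $s$, target $t$, coproduct $\Delta(u)=u_{(1)}\otimes_A u_{(2)}$ and counit $\varepsilon$; write $a\rhd u\lhd b=s(a)t(b)u$ and $a\blacktriangleright u=u\,t(a)$. A left $U$-module $N$ is an $A$-bimodule by $a\rhd n\lhd b=s(a)t(b)n$. Let $N$ be a braided commutative Yetter–Drinfel'd algebra over $U$: a Yetter–Drinfel'd module with coaction $n\mapsto n_{(-1)}\otimes_A n_{(0)}$ that is an $A$-ring, a left $U$-module algebra and a left $U$-comodule algebra, such that $n\cdot n'=(n_{(-1)}n')\cdot n_{(0)}$ for all $n,n'\in N$. Let $$C^p(U,N)=\mathrm{Hom}_{A^{op}}\big((U^{\otimes_{A^{op}}p})_{\lhd},N\big),\qquad C^0(U,N)=N,$$ where $U\otimes_{A^{op}}U$ is formed with the relation $(a\blacktriangleright u)\otimes v=u\otimes (v\lhd a)$. For $\psi\in C^q(U,N)$ put $$D_\psi(u^1,\dots,u^q)=\psi(u^1_{(1)},\dots,u^q_{(1)})_{(-1)}u^1_{(2)}\cdots u^q_{(2)}\otimes_A\psi(u^1_{(1)},\dots,u^q_{(1)})_{(0)}\in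 U\otimes_A N,$$ and write $D_\psi(\cdots)=D_\psi(\cdots)_{(-1)}\otimes_A D_\psi(\cdots)_{(0)}$. For $\varphi\in C^p(U,N)$ and $1\le i\le p$ set $$(\varphi\circ_i\psi)(u^1,\dots,u^{p+q-1})=\varphi\big(u^1_{(1)},\dots,u^{i-1}_{(1)},D_\psi(u^i,\dots,u^{i+q-1})_{(-1)},u^{i+q},\dots,u^{p+q-1}\big)\cdot\big(u^1_{(2)}\cdots u^{i-1}_{(2)}D_\psi(u^i,\dots,u^{i+q-1})_{(0)}\big),$$ and $\varphi\circ_i\psi=0$ for $i>p$. Then: 1. These operations are well defined and, with $\mathbb 1(u)=\varepsilon(u)\rhd 1_N$, $\mu(u,v)=\varepsilon(uv)\rhd 1_N$ and $e=1_N$, make $C^\bullet(U,N)$ a non-$\Sigma$ operad with multiplication in $k$-modules; that is, $\circ_i:C^p\otimes C^q\to C^{p+q-1}$ is $k$-bilinear, for $\varphi,\psi,\chi$ of degrees $p,q,r$ and $i,j\ge 1$ $$(\varphi\circ_i\psi)\circ_j\chi=\begin{cases}(\varphi\circ_j\chi)\circ_{i+r-1}\psi & j<i,\\ \varphi\circ_i(\psi\circ_{j-i+1}\chi)&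 i\le j<q+i,\\ (\varphi\circ_{j-q+1}\chi)\circ_i\psi& j\ge q+i,\end{cases}$$ $\varphi\circ_i\mathbb 1=\varphi$ for $1\le i\le p$, $\mathbb 1\circ_1\varphi=\varphi$, $\mu\circ_1\mu=\mu\circ_2\mu$ and $\mu\circ_1e=\mu\circ_2e=\mathbb 1$. 2. Let $\delta:C^p(U,N)\to C^{p+1}(U,N)$, $$\delta\varphi(u^1,\dots,u^{p+1})=u^1\varphi(u^2,\dots,u^{p+1})+\sum_{i=1}^p(-1)^i\varphi(u^1,\dots,u^iu^{i+1},\dots,u^{p+1})+(-1)^{p+1}\varphi(u^1,\dots,\varepsilon(u^{p+1})\blacktriangleright u^p),$$ with $\delta n(u)=un-n\lhd\varepsilon(u)$ for $p=0$. Then $\delta^2=0$ and $\delta\varphi=\{\mu,\varphi\}$, where, with $|p|=p-1$, $$\{\varphi,\psi\}=\varphi\bar\circ\psi-(-1)^{|p||q|}\psi\bar\circ\varphi,\qquad \varphi\bar\circ\psi=(-1)^{|p||q|}\sum_{i=1}^p(-1)^{|q||i|}\varphi\circ_i\psi .$$ The cup product $\varphi\smallsmile\psi=(\mu\circ_1\varphi)\circ_{p+1}\psi$,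 the bracket $\{\cdot,\cdot\}$ and the unit $e$ induce on the cohomology $H^\bullet(U,N)$ of $(C^\bullet(U,N),\delta)$ the structure of a Gerstenhaber algebra over $k$: $\smallsmile$ is an associative, unital, graded commutative product, $\{\cdot,\cdot\}$ is a bracket of degree $-1$ and a graded Lie bracket for the degrees $|p|$, and $\{\gamma,\alpha\smallsmile\beta\}=\{\gamma,\alpha\}\smallsmile\beta+(-1)^{|p|q}\alpha\smallsmile\{\gamma,\beta\}$ for $\gamma$ of degree $p$ and $\alpha$ of degree $q$. 3. If $U_\lhd$, that is $U$ with the action $u\lhd a=t(a)u$, is a projective $A^{op}$-module, then the canonical maps induced by comparing the bar resolution of the left $U$-module $A$ (with action $ua=\varepsilon(u\,s(a))$) with a projective resolution are $k$-linear isomorphisms $\mathrm{Ext}^n_U(A,N)\cong H^n(U,N)$, and they carry the structure of 2 to a Gerstenhaber algebra structure on $\mathrm{Ext}^\bullet_U(A,N)$. -/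

import Mathlib

open TensorProduct MulOpposite
open scoped DirectSum

universe v w

/-! ### Rings over `A ⊗ Aᵒᵖ` and tensor products over the base algebra -/

/-- A `k`-algebra `U` with a `k`-algebra map `η : A ⊗ Aᵒᵖ → U`, given by its restrictions, the
source `s = η(- ⊗ 1)` and the target `t = η(1 ⊗ -)`, which have commuting images. A left
`U`-module `X` becomes an `A`-bimodule by `a ▹ x ◃ b = s(a) t(b) x`. -/
structure AeRing (k A U : Type*) [CommRing k] [Ring A] [Algebra k A] [Ring U] [Algebra k U] where
  s : A →ₐ[k] U
  t : Aᵐᵒᵖ →ₐ[k] U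
  s_mul_t : ∀ (a : A) (b : Aᵐᵒᵖ), s a * t b = t b * s a

namespace AeRing

section

variable {k A U : Type*} [CommRing k] [Ring A] [Algebra k A] [Ring U] [Algebra k U]
  (E : AeRing k A U)

/-- The target map as a map on `A`; it reverses products. -/
def tgt (a : A) : U := E.t (op a)

section

variable (X : Type*) [AddCommGroup X] [Module k X] [Module U X]

/-- The relations `(u ◃ a) ⊗ x = u ⊗ (a ▹ x)`. -/
def balancedRel : Submodule k (U ⊗[k] X) :=
  Submodule.span k {z | ∃ (a : A) (u : U) (x : X),
    z = (E.tgt a * u) ⊗ₜ[k] x - u ⊗ₜ[k] (E.s a • x)}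

/-- The tensor product `U_◃ ⊗_A ▹X` over the (noncommutative) algebra `A`. -/
abbrev BalTensor : Type _ := (U ⊗[k] X) ⧸ E.balancedRel X

/-- The relations of the threefold tensor product `U ⊗_A U ⊗_A X`. -/
def balancedRel₃ : Submodule k (U ⊗[k] (U ⊗[k] X)) :=
  Submodule.span k ({z | ∃ (a : A) (u v : U) (x : X),
      z = (E.tgt a * u) ⊗ₜ[k] (v ⊗ₜ[k] x) - u ⊗ₜ[k] ((E.s a * v) ⊗ₜ[k] x)} ∪
    {z | ∃ (a : A) (u v : U) (x : X),
      z = u ⊗ₜ[k] ((E.tgt a * v) ⊗ₜ[k] x) - u ⊗ₜ[k] (v ⊗ₜ[k] (E.s a • x))})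

/-- The threefold tensor product `U_◃ ⊗_A ▹U_◃ ⊗_A ▹X`. -/
abbrev BalTensor₃ : Type _ := (U ⊗[k] (U ⊗[k] X)) ⧸ E.balancedRel₃ X

end

section

variable {X : Type*} [AddCommGroup X] [Module k X] [Module U X]

/-- The elementary tensor `u ⊗_A x`. -/
def tmul (u : U) (x : X) : E.BalTensor X := (E.balancedRel X).mkQ (u ⊗ₜ[k] x)

/-- The elementary tensor `u ⊗_A v ⊗_A x`. -/
def tmul₃ (u v : U) (x : X) : E.BalTensor₃ X :=
  (E.balancedRel₃ X).mkQ (u ⊗ₜ[k] (v ⊗ₜ[k] x))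

/-- `z = ∑ l, u l ⊗_A x l`. Sweedler notation `u₍₁₎ ⊗ u₍₂₎` for `Δ u` is expressed by quantifying
over all such presentations of `Δ u`. -/
def IsRep {m : ℕ} (u : Fin m → U) (x : Fin m → X) (z : E.BalTensor X) : Prop :=
  z = ∑ l, E.tmul (u l) (x l)

variable (X) in
/-- Right multiplication on the first factor, `u ⊗_A x ↦ u v ⊗_A x`. -/
def rmul (v : U) : E.BalTensor X →ₗ[k] E.BalTensor X :=
  Submodule.mapQ _ _ ((LinearMap.mulRight k v).rTensor X) (by
    refine Submodule.span_le.2 ?_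
    rintro _ ⟨a, u, x, rfl⟩
    refine Submodule.subset_span ⟨a, u * v, x, ?_⟩
    simp [mul_assoc])

end

end

end AeRing

/-! ### Left bialgebroids -/

/-- A left bialgebroid `U` over `A`. All conditions are in Sweedler notation, for all
presentations of the coproducts that occur; each of the expressions is independent of them. -/
structure LeftBialgebroid (k A U : Type*) [CommRing k] [Ring A] [Algebra k A] [Ring U]
    [Algebra k U] extends AeRing k A U where
  /-- The coproduct `U → U_◃ ⊗_A ▹U`. -/
  comul : U →ₗ[k] toAeRing.BalTensor U
  counit : U →ₗ[k] A
  comul_bilin : ∀ (a b : A) (u : U) (m : ℕ) (x y : Fin m → U), toAeRing.IsRep x y (comul u) →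
    comul (s a * toAeRing.tgt b * u) = ∑ l, toAeRing.tmul (s a * x l) (toAeRing.tgt b * y l)
  counit_bilin : ∀ (a b : A) (u : U), counit (s a * toAeRing.tgt b * u) = a * counit u * b
  counit_comul : ∀ (u : U) (m : ℕ) (x y : Fin m → U), toAeRing.IsRep x y (comul u) →
    ∑ l, s (counit (x l)) * y l = u
  comul_counit : ∀ (u : U) (m : ℕ) (x y : Fin m → U), toAeRing.IsRep x y (comul u) →
    ∑ l, toAeRing.tgt (counit (y l)) * x l = u
  coassoc : ∀ (u : U) (m m' : ℕ) (x y : Fin m → U) (x₁ x₂ y₁ y₂ : Fin m → Fin m' → U),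
    toAeRing.IsRep x y (comul u) →
    (∀ l, toAeRing.IsRep (x₁ l) (x₂ l) (comul (x l))) →
    (∀ l, toAeRing.IsRep (y₁ l) (y₂ l) (comul (y l))) →
    ∑ l, ∑ j, toAeRing.tmul₃ (x₁ l j) (x₂ l j) (y l) =
      ∑ l, ∑ j, toAeRing.tmul₃ (x l) (y₁ l j) (y₂ l j)
  /-- The coproduct takes values in the Sweedler–Takeuchi product. -/
  takeuchi : ∀ (a : A) (u : U) (m : ℕ) (x y : Fin m → U), toAeRing.IsRep x y (comul u) →
    ∑ l, toAeRing.tmul (x l * toAeRing.tgt a) (y l) = ∑ l, toAeRing.tmul (x l) (y l * s a)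
  comul_one : comul 1 = toAeRing.tmul 1 1
  comul_mul : ∀ (u v : U) (m m' : ℕ) (x y : Fin m → U) (x' y' : Fin m' → U),
    toAeRing.IsRep x y (comul u) → toAeRing.IsRep x' y' (comul v) →
    comul (u * v) = ∑ l, ∑ j, toAeRing.tmul (x l * x' j) (y l * y' j)
  counit_one : counit 1 = 1
  counit_mul_s : ∀ u v : U, counit (u * v) = counit (u * s (counit v))
  counit_mul_t : ∀ u v : U, counit (u * v) = counit (u * toAeRing.tgt (counit v))

/-! ### Yetter–Drinfel'd modules and algebras -/

section YetterDrinfeld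

variable {k A U : Type*} [CommRing k] [Ring A] [Algebra k A] [Ring U] [Algebra k U]

/-- A Yetter–Drinfel'd module structure on a left `U`-module `X`: a left `U`-coaction
`x ↦ x₍₋₁₎ ⊗_A x₍₀₎` whose underlying left `A`-action `a x` and induced right `A`-action
`x a = ε(a ▸ x₍₋₁₎) x₍₀₎ = ε(x₍₋₁₎ t(a)) x₍₀₎` are those of the `U`-module, such that
`(u₍₁₎x)₍₋₁₎ u₍₂₎ ⊗ (u₍₁₎x)₍₀₎ = u₍₁₎ x₍₋₁₎ ⊗ u₍₂₎ x₍₀₎`. -/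
structure YetterDrinfeldModule (B : LeftBialgebroid k A U) (X : Type*) [AddCommGroup X]
    [Module k X] [Module U X] [IsScalarTower k U X] where
  coact : X →ₗ[k] B.BalTensor X
  coact_smul : ∀ (a : A) (x : X) (m : ℕ) (c : Fin m → U) (d : Fin m → X),
    B.IsRep c d (coact x) → coact (B.s a • x) = ∑ l, B.tmul (B.s a * c l) (d l)
  counit_coact : ∀ (x : X) (m : ℕ) (c : Fin m → U) (d : Fin m → X),
    B.IsRep c d (coact x) → ∑ l, B.s (B.counit (c l)) • d l = x
  coassoc : ∀ (x : X) (m m' : ℕ) (c : Fin m → U) (d : Fin m → X) (c₁ c₂ : Fin m → Fin m' → U)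
    (d₁ : Fin m → Fin m' → U) (d₂ : Fin m → Fin m' → X),
    B.IsRep c d (coact x) →
    (∀ l, B.IsRep (c₁ l) (c₂ l) (B.comul (c l))) →
    (∀ l, B.IsRep (d₁ l) (d₂ l) (coact (d l))) →
    ∑ l, ∑ j, B.tmul₃ (c₁ l j) (c₂ l j) (d l) = ∑ l, ∑ j, B.tmul₃ (c l) (d₁ l j) (d₂ l j)
  right_action : ∀ (a : A) (x : X) (m : ℕ) (c : Fin m → U) (d : Fin m → X),
    B.IsRep c d (coact x) → B.tgt a • x = ∑ l, B.s (B.counit (c l * B.tgt a)) • d l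
  yetter_drinfeld : ∀ (u : U) (x : X) (m m' m'' : ℕ) (u₁ u₂ : Fin m → U)
    (c : Fin m → Fin m' → U) (d : Fin m → Fin m' → X) (e : Fin m'' → U) (f : Fin m'' → X),
    B.IsRep u₁ u₂ (B.comul u) → (∀ l, B.IsRep (c l) (d l) (coact (u₁ l • x))) →
    B.IsRep e f (coact x) →
    ∑ l, ∑ j, B.tmul (c l j * u₂ l) (d l j) = ∑ l, ∑ j, B.tmul (u₁ l * e j) (u₂ l • f j)

/-- A Yetter–Drinfel'd algebra: a Yetter–Drinfel'd module `N` with an associative unital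
multiplication making it an `A`-ring, a left `U`-module algebra and a left `U`-comodule algebra. -/
structure YetterDrinfeldAlgebra (B : LeftBialgebroid k A U) (N : Type*) [Ring N] [Algebra k N]
    [Module U N] [IsScalarTower k U N] extends YetterDrinfeldModule B N where
  left_mul : ∀ (a : A) (n n' : N), B.s a • (n * n') = (B.s a • n) * n'
  mul_right : ∀ (a : A) (n n' : N), B.tgt a • (n * n') = n * (B.tgt a • n')
  balanced : ∀ (a : A) (n n' : N), n * (B.s a • n') = (B.tgt a • n) * n'
  smul_mul : ∀ (u : U) (n n' : N) (m : ℕ) (x y : Fin m → U), B.IsRep x y (B.comul u) →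
    u • (n * n') = ∑ l, (x l • n) * (y l • n')
  smul_one : ∀ u : U, u • (1 : N) = B.s (B.counit u) • (1 : N)
  coact_one : coact 1 = B.tmul 1 1
  coact_mul : ∀ (n n' : N) (m m' : ℕ) (c : Fin m → U) (d : Fin m → N) (c' : Fin m' → U)
    (d' : Fin m' → N), B.IsRep c d (coact n) → B.IsRep c' d' (coact n') →
    coact (n * n') = ∑ l, ∑ j, B.tmul (c l * c' j) (d l * d' j)

/-- Braided commutativity: `n n' = (n₍₋₁₎ n') n₍₀₎`. -/
def YetterDrinfeldAlgebra.IsBraidedCommutative {B : LeftBialgebroid k A U} {N : Type*} [Ring N]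
    [Algebra k N] [Module U N] [IsScalarTower k U N] (Y : YetterDrinfeldAlgebra B N) : Prop :=
  ∀ (n n' : N) (m : ℕ) (c : Fin m → U) (d : Fin m → N), B.IsRep c d (Y.coact n) →
    n * n' = ∑ l, (c l • n') * d l

end YetterDrinfeld

/-! ### The cochain complex -/

namespace LeftBialgebroid

variable {k A U : Type*} [CommRing k] [Ring A] [Algebra k A] [Ring U] [Algebra k U]
  (B : LeftBialgebroid k A U)

/-- `φ` is (the map `(u¹, …, uᵖ) ↦ φ(u¹ ⊗ ⋯ ⊗ uᵖ)` of) an element of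
`Hom_{Aᵒᵖ}((▸U_◃)^{⊗_{Aᵒᵖ} p}_◃, X)`: it is additive in each variable,
`φ(…, a ▸ uⁱ, uⁱ⁺¹, …) = φ(…, uⁱ, uⁱ⁺¹ ◃ a, …)` where `a ▸ u = u t(a)` and `u ◃ a = t(a) u`, and
`φ(u¹ ◃ a, u², …) = φ(u¹, u², …) ◃ a`. For `p = 0`, where the tensor power is `A` itself,
this is an element of `X`. -/
structure IsCochain {X : Type*} [AddCommGroup X] [Module U X] {p : ℕ}
    (φ : (Fin p → U) → X) : Prop where
  map_add : ∀ (u : Fin p → U) (i : Fin p) (x y : U),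
    φ (Function.update u i (x + y)) = φ (Function.update u i x) + φ (Function.update u i y)
  balanced : ∀ (u : Fin p → U) (i j : Fin p), (i : ℕ) + 1 = j → ∀ a : A,
    φ (Function.update u i (u i * B.tgt a)) = φ (Function.update u j (B.tgt a * u j))
  linear : ∀ (u : Fin p → U) (i : Fin p), (i : ℕ) = 0 → ∀ a : A,
    φ (Function.update u i (B.tgt a * u i)) = B.tgt a • φ u

/-- The last coface `φ ↦ φ(u¹, …, ε(uᵖ⁺¹) ▸ uᵖ)`, which for `p = 0` is `x ↦ x ◃ ε(u¹)`. -/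
def lastFace {X : Type*} [AddCommGroup X] [Module U X] :
    {p : ℕ} → ((Fin p → U) → X) → (Fin (p + 1) → U) → X
  | 0, φ, u => B.tgt (B.counit (u 0)) • φ (Fin.init u)
  | p + 1, φ, u => φ (Function.update (Fin.init u) (Fin.last p)
      (u (Fin.last p).castSucc * B.tgt (B.counit (u (Fin.last (p + 1))))))

/-- The coboundary
`δφ(u¹, …, uᵖ⁺¹) = u¹ φ(u², …, uᵖ⁺¹) + ∑ᵢ (-1)ⁱ φ(u¹, …, uⁱ uⁱ⁺¹, …, uᵖ⁺¹)
  + (-1)ᵖ⁺¹ φ(u¹, …, ε(uᵖ⁺¹) ▸ uᵖ)`. -/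
def coboundary {X : Type*} [AddCommGroup X] [Module U X] {p : ℕ} (φ : (Fin p → U) → X)
    (u : Fin (p + 1) → U) : X :=
  u 0 • φ (Fin.tail u)
    + ∑ i : Fin p, (-1 : ℤ) ^ ((i : ℕ) + 1) • φ (Fin.contractNth i.castSucc (· * ·) u)
    + (-1 : ℤ) ^ (p + 1) • B.lastFace φ u

end LeftBialgebroid

namespace LeftBialgebroid

section

variable {k A U : Type*} [CommRing k] [Ring A] [Algebra k A] [Ring U] [Algebra k U]
  (B : LeftBialgebroid k A U) {X : Type*} [AddCommGroup X] [Module U X] {p : ℕ}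

theorem tgt_mul_tgt (a b : A) : B.tgt a * B.tgt b = B.tgt (b * a) := by
  simp [AeRing.tgt]

theorem tgt_add (a b : A) : B.tgt (a + b) = B.tgt a + B.tgt b := by
  simp [AeRing.tgt]

theorem counit_tgt_mul (a : A) (u : U) : B.counit (B.tgt a * u) = B.counit u * a := by
  simpa using B.counit_bilin 1 a u

theorem contractNth_update_lt (i : Fin p) (u : Fin (p + 1) → U) (j : Fin p) (h : (j : ℕ) < i)
    (v : U) : Fin.contractNth i.castSucc (· * ·) (Function.update u j.castSucc v) =
      Function.update (Fin.contractNth i.castSucc (· * ·) u) j v := by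
  funext l
  simp only [Fin.contractNth, Function.update_apply, Fin.ext_iff, Fin.val_castSucc, Fin.val_succ]
  split_ifs <;> first | rfl | omega

theorem contractNth_update_fst (i : Fin p) (u : Fin (p + 1) → U) (v : U) :
    Fin.contractNth i.castSucc (· * ·) (Function.update u i.castSucc v) =
      Function.update (Fin.contractNth i.castSucc (· * ·) u) i (v * u i.succ) := by
  funext l
  by_cases hl : l = i
  · subst hl
    simp [Fin.contractNth, Fin.ext_iff]
  · simp only [Fin.contractNth, Function.update_apply, Fin.ext_iff, Fin.val_castSucc, Fin.val_succ]
    have : (l : ℕ) ≠ i := fun h => hl (Fin.ext h)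
    split_ifs <;> first | rfl | omega

theorem contractNth_update_snd (i : Fin p) (u : Fin (p + 1) → U) (v : U) :
    Fin.contractNth i.castSucc (· * ·) (Function.update u i.succ v) =
      Function.update (Fin.contractNth i.castSucc (· * ·) u) i (u i.castSucc * v) := by
  funext l
  by_cases hl : l = i
  · subst hl
    simp [Fin.contractNth, Fin.ext_iff]
  · simp only [Fin.contractNth, Function.update_apply, Fin.ext_iff, Fin.val_castSucc, Fin.val_succ]
    have : (l : ℕ) ≠ i := fun h => hl (Fin.ext h)
    split_ifs <;> first | rfl | omega

theorem contractNth_update_gt (i : Fin p) (u : Fin (p + 1) → U) (j : Fin p) (h : (i : ℕ) < j)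
    (v : U) : Fin.contractNth i.castSucc (· * ·) (Function.update u j.succ v) =
      Function.update (Fin.contractNth i.castSucc (· * ·) u) j v := by
  funext l
  simp only [Fin.contractNth, Function.update_apply, Fin.ext_iff, Fin.val_castSucc, Fin.val_succ]
  split_ifs <;> first | rfl | omega

theorem contractNth_lt (i : Fin p) (u : Fin (p + 1) → U) (j : Fin p) (h : (j : ℕ) < i) :
    Fin.contractNth i.castSucc (· * ·) u j = u j.castSucc := by
  simp [Fin.contractNth, h]

theorem contractNth_self (i : Fin p) (u : Fin (p + 1) → U) :
    Fin.contractNth i.castSucc (· * ·) u i = u i.castSucc * u i.succ := by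
  simp [Fin.contractNth]

theorem contractNth_gt (i : Fin p) (u : Fin (p + 1) → U) (j : Fin p) (h : (i : ℕ) < j) :
    Fin.contractNth i.castSucc (· * ·) u j = u j.succ := by
  have h1 : ¬ (j : ℕ) < i := by omega
  have h2 : ¬ (j : ℕ) = i := by omega
  simp [Fin.contractNth, h1, h2]

variable {B}

theorem IsCochain.add {φ ψ : (Fin p → U) → X} (hφ : B.IsCochain φ) (hψ : B.IsCochain ψ) :
    B.IsCochain (φ + ψ) where
  map_add u i x y := by
    simp only [Pi.add_apply, hφ.map_add, hψ.map_add]; abel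
  balanced u i j h a := by simp only [Pi.add_apply, hφ.balanced u i j h, hψ.balanced u i j h]
  linear u i h a := by simp only [Pi.add_apply, hφ.linear u i h, hψ.linear u i h, smul_add]

theorem IsCochain.zero : B.IsCochain (0 : (Fin p → U) → X) where
  map_add u i x y := by simp
  balanced u i j h a := by simp
  linear u i h a := by simp

theorem IsCochain.zsmul {φ : (Fin p → U) → X} (hφ : B.IsCochain φ) (c : ℤ) :
    B.IsCochain (c • φ) where
  map_add u i x y := by simp only [Pi.smul_apply, hφ.map_add, smul_add]
  balanced u i j h a := by simp only [Pi.smul_apply, hφ.balanced u i j h]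
  linear u i h a := by simp only [Pi.smul_apply, hφ.linear u i h, smul_comm (B.tgt a) c]

theorem IsCochain.sum {ι : Type*} (S : Finset ι) {φ : ι → (Fin p → U) → X}
    (h : ∀ i, B.IsCochain (φ i)) : B.IsCochain (∑ i ∈ S, φ i) := by
  classical
  induction S using Finset.induction_on with
  | empty => simpa using IsCochain.zero
  | insert i S hi ih => rw [Finset.sum_insert hi]; exact (h i).add ih

theorem IsCochain.firstFace {φ : (Fin p → U) → X} (hφ : B.IsCochain φ) :
    B.IsCochain (fun u : Fin (p + 1) → U => u 0 • φ (Fin.tail u)) where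
  map_add u i x y := by
    cases i using Fin.cases with
    | zero => simp [add_smul]
    | succ i =>
      simp only [Fin.tail_update_succ, hφ.map_add, smul_add,
        Function.update_of_ne (Fin.succ_ne_zero i).symm]
  balanced u i j h a := by
    cases j using Fin.cases with
    | zero => simp at h
    | succ j =>
      have e : u j.succ = Fin.tail u j := rfl
      cases i using Fin.cases with
      | zero =>
        have hj : (j : ℕ) = 0 := by simpa using h.symm
        simp only [Fin.tail_update_zero, Function.update_self, Fin.tail_update_succ,
          Function.update_of_ne (Fin.succ_ne_zero j).symm, e, hφ.linear _ j hj, mul_smul]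
      | succ i =>
        have e' : u i.succ = Fin.tail u i := rfl
        simp only [Fin.tail_update_succ, Function.update_of_ne (Fin.succ_ne_zero _).symm, e, e']
        rw [hφ.balanced _ i j (by simpa using h)]
  linear u i h a := by
    obtain rfl : i = 0 := Fin.ext h
    simp [mul_smul]

theorem IsCochain.middleFace {φ : (Fin p → U) → X} (hφ : B.IsCochain φ) (i : Fin p) :
    B.IsCochain (fun u : Fin (p + 1) → U => φ (Fin.contractNth i.castSucc (· * ·) u)) where
  map_add u j x y := by
    rcases lt_trichotomy (j : ℕ) i with h | h | h
    · obtain ⟨j, rfl⟩ : ∃ j' : Fin p, j = j'.castSucc := ⟨⟨j, by omega⟩, rfl⟩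
      simp only [contractNth_update_lt i u j h, hφ.map_add]
    · obtain rfl : j = i.castSucc := Fin.ext h
      simp only [contractNth_update_fst, add_mul, hφ.map_add]
    · obtain ⟨j, rfl⟩ : ∃ j' : Fin p, j = j'.succ :=
        ⟨⟨j - 1, by omega⟩, Fin.ext (by simp; omega)⟩
      rcases eq_or_lt_of_le (show (i : ℕ) ≤ j by simpa using Nat.lt_succ_iff.1 h) with h' | h'
      · obtain rfl : i = j := Fin.ext h'
        simp only [contractNth_update_snd, mul_add, hφ.map_add]
      · simp only [contractNth_update_gt i u j h', hφ.map_add]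
  balanced u j j' h a := by
    obtain ⟨j, rfl⟩ : ∃ l : Fin p, j = l.castSucc := ⟨⟨j, by omega⟩, rfl⟩
    obtain rfl : j' = j.succ := Fin.ext (by simpa using h.symm)
    rcases lt_trichotomy (j : ℕ) i with h1 | h1 | h1
    · rcases eq_or_lt_of_le (show (j : ℕ) + 1 ≤ i from h1) with h2 | h2
      · have e : j.succ = i.castSucc := Fin.ext (by simpa using h2)
        have := hφ.balanced (Fin.contractNth i.castSucc (· * ·) u) j i h2 a
        rw [contractNth_lt i u j h1, contractNth_self] at this
        simp only [contractNth_update_lt i u j h1, e, contractNth_update_fst, mul_assoc] at this ⊢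
        exact this
      · have hj2 : (j : ℕ) + 1 < p := by omega
        have e : j.succ = (⟨j + 1, hj2⟩ : Fin p).castSucc := rfl
        have := hφ.balanced (Fin.contractNth i.castSucc (· * ·) u) j ⟨j + 1, hj2⟩ rfl a
        rw [contractNth_lt i u j h1, contractNth_lt i u _ h2] at this
        rw [e, contractNth_update_lt i u j h1, contractNth_update_lt i u ⟨j + 1, hj2⟩ h2]
        exact this
    · obtain rfl : j = i := Fin.ext h1
      simp only [contractNth_update_fst, contractNth_update_snd, mul_assoc]
    · have hj1 : (j : ℕ) - 1 < p := by omega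
      have e : j.castSucc = (⟨j - 1, hj1⟩ : Fin p).succ := Fin.ext (by simp; omega)
      rcases eq_or_lt_of_le (show (i : ℕ) ≤ j - 1 by omega) with h2 | h2
      · obtain hi : i = ⟨j - 1, hj1⟩ := Fin.ext h2
        have := hφ.balanced (Fin.contractNth i.castSucc (· * ·) u) i j (by omega) a
        rw [contractNth_gt i u j h1, contractNth_self] at this
        rw [e, ← hi]
        simp only [contractNth_update_snd, contractNth_update_gt i u j h1, mul_assoc] at this ⊢
        exact this
      · have := hφ.balanced (Fin.contractNth i.castSucc (· * ·) u) ⟨j - 1, hj1⟩ j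
          (by simp; omega) a
        rw [contractNth_gt i u j h1, contractNth_gt i u _ h2] at this
        rw [e]
        rw [contractNth_update_gt i u j h1, contractNth_update_gt i u ⟨j - 1, hj1⟩ h2]
        exact this
  linear u j h a := by
    have hp : 0 < p := i.pos
    obtain rfl : j = (⟨0, hp⟩ : Fin p).castSucc := Fin.ext h
    have := hφ.linear (Fin.contractNth i.castSucc (· * ·) u) ⟨0, hp⟩ rfl a
    rcases Nat.eq_zero_or_pos (i : ℕ) with h0 | h0
    · have e : (⟨0, hp⟩ : Fin p) = i := Fin.ext h0.symm
      rw [e] at this ⊢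
      rw [contractNth_self] at this
      simp only [contractNth_update_fst, mul_assoc] at this ⊢
      exact this
    · rw [contractNth_lt i u ⟨0, hp⟩ h0] at this
      simp only [contractNth_update_lt i u ⟨0, hp⟩ h0] at this ⊢
      exact this

theorem IsCochain.lastFace {φ : (Fin p → U) → X} (hφ : B.IsCochain φ) :
    B.IsCochain (B.lastFace φ) := by
  cases p with
  | zero =>
    have e : ∀ u v : Fin 0 → U, φ u = φ v := fun u v => by rw [Subsingleton.elim u v]
    constructor
    · intro u i x y
      obtain rfl : i = 0 := Fin.ext (by omega)
      simp only [LeftBialgebroid.lastFace, Function.update_self, _root_.map_add, tgt_add, add_smul]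
      rw [e (Fin.init (Function.update u 0 (x + y))) (Fin.init u),
        e (Fin.init (Function.update u 0 x)) (Fin.init u),
        e (Fin.init (Function.update u 0 y)) (Fin.init u)]
    · intro u i j h
      omega
    · intro u i h a
      obtain rfl : i = 0 := Fin.ext (by omega)
      simp only [LeftBialgebroid.lastFace, Function.update_self, counit_tgt_mul, ← tgt_mul_tgt,
        mul_smul]
      rw [e (Fin.init (Function.update u 0 (B.tgt a * u 0))) (Fin.init u)]
  | succ p =>
    set T : (Fin (p + 2) → U) → Fin (p + 1) → U := fun u =>
      Function.update (Fin.init u) (Fin.last p)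
        (u (Fin.last p).castSucc * B.tgt (B.counit (u (Fin.last (p + 1))))) with hT
    have hlast : ∀ u, B.lastFace φ u = φ (T u) := fun u => rfl
    have h1 : ∀ u (j : Fin (p + 1)) (v : U), (j : ℕ) < p →
        T (Function.update u j.castSucc v) = Function.update (T u) j v := by
      intro u j v hj
      funext l
      simp only [hT, Function.update_apply, Fin.init, Fin.ext_iff, Fin.val_castSucc, Fin.val_last]
      split_ifs <;> first | rfl | omega
    have h2 : ∀ u (v : U), T (Function.update u (Fin.last p).castSucc v) =
        Function.update (T u) (Fin.last p) (v * B.tgt (B.counit (u (Fin.last (p + 1))))) := by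
      intro u v
      funext l
      simp only [hT, Function.update_apply, Fin.init, Fin.ext_iff, Fin.val_castSucc, Fin.val_last]
      split_ifs <;> first | rfl | omega
    have h3 : ∀ u (v : U), T (Function.update u (Fin.last (p + 1)) v) =
        Function.update (T u) (Fin.last p)
          (u (Fin.last p).castSucc * B.tgt (B.counit v)) := by
      intro u v
      funext l
      simp only [hT, Function.update_apply, Fin.init, Fin.ext_iff, Fin.val_castSucc, Fin.val_last]
      split_ifs <;> first | rfl | omega
    have t1 : ∀ u (j : Fin (p + 1)), (j : ℕ) < p → T u j = u j.castSucc := by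
      intro u j hj
      have : j ≠ Fin.last p := fun h => by simp [h] at hj
      simp [hT, this, Fin.init]
    have t2 : ∀ u, T u (Fin.last p) =
        u (Fin.last p).castSucc * B.tgt (B.counit (u (Fin.last (p + 1)))) := by
      intro u; simp [hT]
    constructor
    · intro u j x y
      simp only [hlast]
      rcases lt_trichotomy (j : ℕ) p with h | h | h
      · obtain ⟨j, rfl⟩ : ∃ j' : Fin (p + 1), j = j'.castSucc := ⟨⟨j, by omega⟩, rfl⟩
        simp only [h1 u j _ h, hφ.map_add]
      · obtain rfl : j = (Fin.last p).castSucc := Fin.ext h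
        simp only [h2, add_mul, hφ.map_add]
      · obtain rfl : j = Fin.last (p + 1) := Fin.ext (by simp; omega)
        simp only [h3, _root_.map_add, tgt_add, mul_add, hφ.map_add]
    · intro u j j' h a
      simp only [hlast]
      rcases lt_trichotomy ((j : ℕ) + 1) p with h' | h' | h'
      · obtain ⟨j, rfl⟩ : ∃ l : Fin (p + 1), j = l.castSucc := ⟨⟨j, by omega⟩, rfl⟩
        obtain ⟨j', rfl⟩ : ∃ l : Fin (p + 1), j' = l.castSucc := ⟨⟨j', by omega⟩, rfl⟩
        have hj : (j : ℕ) < p := by simp at h'; omega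
        have hj' : (j' : ℕ) < p := by simp at h h'; omega
        have := hφ.balanced (T u) j j' (by simpa using h) a
        rw [t1 u j hj, t1 u j' hj'] at this
        rw [h1 u j _ hj, h1 u j' _ hj', this]
      · obtain ⟨j, rfl⟩ : ∃ l : Fin (p + 1), j = l.castSucc := ⟨⟨j, by omega⟩, rfl⟩
        obtain rfl : j' = (Fin.last p).castSucc :=
          Fin.ext (by simp only [Fin.val_castSucc, Fin.val_last] at h h' ⊢; omega)
        have hj : (j : ℕ) < p := by simp at h'; omega
        have := hφ.balanced (T u) j (Fin.last p) (by simpa using h) a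
        rw [t1 u j hj, t2] at this
        rw [h1 u j _ hj, h2, mul_assoc, this]
      · obtain rfl : j = (Fin.last p).castSucc := Fin.ext (by simp only [Fin.val_castSucc, Fin.val_last]; omega)
        obtain rfl : j' = Fin.last (p + 1) := Fin.ext (by simp only [Fin.val_castSucc, Fin.val_last] at h ⊢; omega)
        rw [h2, h3, counit_tgt_mul, ← tgt_mul_tgt, mul_assoc]
    · intro u j h a
      simp only [hlast]
      obtain rfl : j = (0 : Fin (p + 1)).castSucc := Fin.ext h
      have := hφ.linear (T u) 0 rfl a
      rcases Nat.eq_zero_or_pos p with h0 | h0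
      · subst h0
        have e : (0 : Fin 1) = Fin.last 0 := rfl
        rw [e] at this ⊢
        rw [t2] at this
        rw [h2, mul_assoc, this]
      · rw [t1 u 0 h0] at this
        rw [h1 u 0 _ h0, this]

theorem IsCochain.coboundary {φ : (Fin p → U) → X} (hφ : B.IsCochain φ) :
    B.IsCochain (B.coboundary φ) := by
  have h := (hφ.firstFace.add (IsCochain.sum Finset.univ fun i : Fin p =>
    (hφ.middleFace i).zsmul ((-1 : ℤ) ^ ((i : ℕ) + 1)))).add
      (hφ.lastFace.zsmul ((-1 : ℤ) ^ (p + 1)))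
  convert h using 1
  funext u
  simp [LeftBialgebroid.coboundary]

end

end LeftBialgebroid

namespace LeftBialgebroid

variable {k A U : Type*} [CommRing k] [Ring A] [Algebra k A] [Ring U] [Algebra k U]
  (B : LeftBialgebroid k A U) (N : Type*) [AddCommGroup N] [Module k N] [Module U N]
  [IsScalarTower k U N]

/-- The cochains, as a submodule of the functions `U^p → N`. -/
def cochainSubmodule (p : ℕ) : Submodule k ((Fin p → U) → N) where
  carrier := {φ | B.IsCochain φ}
  add_mem' hφ hψ := hφ.add hψ
  zero_mem' := IsCochain.zero
  smul_mem' c φ hφ :=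
    have : SMulCommClass U k N := IsScalarTower.to_smulCommClass'
    { map_add := fun u i x y => by simp only [Pi.smul_apply, hφ.map_add, smul_add]
      balanced := fun u i j h a => by simp only [Pi.smul_apply, hφ.balanced u i j h]
      linear := fun u i h a => by
        simp only [Pi.smul_apply, hφ.linear u i h, smul_comm (B.tgt a) c] }

/-- The `k`-module `C^p(U, N) = Hom_{Aᵒᵖ}((▸U_◃)^{⊗_{Aᵒᵖ} p}_◃, N)`. -/
def Cochain (p : ℕ) : Type _ := B.cochainSubmodule N p

instance (p : ℕ) : AddCommGroup (B.Cochain N p) :=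
  inferInstanceAs (AddCommGroup (B.cochainSubmodule N p))

instance (p : ℕ) : Module k (B.Cochain N p) :=
  inferInstanceAs (Module k (B.cochainSubmodule N p))

/-- The differential `δ : C^p(U, N) → C^{p+1}(U, N)`. -/
def differential (p : ℕ) : B.Cochain N p →ₗ[k] B.Cochain N (p + 1) where
  toFun φ := ⟨B.coboundary φ.1, IsCochain.coboundary φ.2⟩
  map_add' φ ψ := by
    refine Subtype.ext (funext fun u => ?_)
    change B.coboundary (φ.1 + ψ.1) u = B.coboundary φ.1 u + B.coboundary ψ.1 u
    cases p <;>
    · simp only [coboundary, lastFace, Pi.add_apply, smul_add, Finset.sum_add_distrib]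
      abel
  map_smul' c φ := by
    have : SMulCommClass U k N := IsScalarTower.to_smulCommClass'
    refine Subtype.ext (funext fun u => ?_)
    change B.coboundary (c • φ.1) u = c • B.coboundary φ.1 u
    cases p <;>
    · simp only [coboundary, lastFace, Pi.smul_apply, smul_add, Finset.smul_sum,
        smul_comm (_ : U) c, smul_comm (_ : ℤ) c]

/-- The cocycles of degree `n`. -/
def cocycles (n : ℕ) : Submodule k (B.Cochain N n) := LinearMap.ker (B.differential N n)

/-- The coboundaries of degree `n`. -/
def coboundaries : (n : ℕ) → Submodule k (B.Cochain N n)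
  | 0 => ⊥
  | n + 1 => LinearMap.range (B.differential N n)

/-- The cohomology `H^n(U, N)`, cocycles modulo coboundaries. -/
abbrev Cohomology (n : ℕ) : Type _ :=
  B.cocycles N n ⧸ (B.coboundaries N n).submoduleOf (B.cocycles N n)

variable {N}

/-- The class of a cocycle in `H^n(U, N)`. -/
def toCohomology {n : ℕ} (z : B.cocycles N n) : B.Cohomology N n :=
  ((B.coboundaries N n).submoduleOf (B.cocycles N n)).mkQ z

end LeftBialgebroid

/-! ### The insertion operations -/

namespace YetterDrinfeldAlgebra

variable {k A U : Type*} [CommRing k] [Ring A] [Algebra k A] [Ring U] [Algebra k U]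
  {B : LeftBialgebroid k A U} {N : Type*} [Ring N] [Algebra k N] [Module U N]
  [IsScalarTower k U N] (Y : YetterDrinfeldAlgebra B N)

/-- `D_ψ(v¹, …, v^q) = ψ(v¹₍₁₎, …, v^q₍₁₎)₍₋₁₎ v¹₍₂₎ ⋯ v^q₍₂₎ ⊗_A ψ(v¹₍₁₎, …, v^q₍₁₎)₍₀₎`, for
`Δ(vʲ) = ∑ l, x j l ⊗_A y j l`. -/
def D {q m : ℕ} (ψ : (Fin q → U) → N) (x y : Fin q → Fin m → U) : B.BalTensor N :=
  ∑ f : Fin q → Fin m,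
    B.rmul N (List.ofFn fun j => y j (f j)).prod (Y.coact (ψ fun j => x j (f j)))

/-- `χ = φ ∘ᵢ ψ` (with `1 ≤ i ≤ p`), that is,
`χ(u¹, …, u^{p+q-1}) = φ(u¹₍₁₎, …, u^{i-1}₍₁₎, D_ψ(uⁱ, …, u^{i+q-1})₍₋₁₎, u^{i+q}, …, u^{p+q-1})
  · (u¹₍₂₎ ⋯ u^{i-1}₍₂₎ D_ψ(uⁱ, …, u^{i+q-1})₍₀₎)`,
whichever presentations `∑ l, x j l ⊗_A y j l` of the `Δ(uʲ)` and `∑ l, d l ⊗_A w l` of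
`D_ψ(uⁱ, …, u^{i+q-1})` are used. Positions are counted from `0` in `Fin`. -/
def IsInsertion {p q n i : ℕ} (h : p + q = n + 1) (hi : 1 ≤ i) (hip : i ≤ p)
    (φ : (Fin p → U) → N) (ψ : (Fin q → U) → N) (χ : (Fin n → U) → N) : Prop :=
  ∀ (u : Fin n → U) (m m' : ℕ) (x y : Fin n → Fin m → U) (d : Fin m' → U) (w : Fin m' → N),
    (∀ j, B.IsRep (x j) (y j) (B.comul (u j))) →
    B.IsRep d w (Y.D ψ (fun j : Fin q => x ⟨i - 1 + j, by omega⟩)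
      (fun j : Fin q => y ⟨i - 1 + j, by omega⟩)) →
    χ u = ∑ g : Fin (i - 1) → Fin m, ∑ l,
      φ (fun j : Fin p =>
          if h₁ : (j : ℕ) < i - 1 then x ⟨j, by omega⟩ (g ⟨j, h₁⟩)
          else if h₂ : (j : ℕ) = i - 1 then d l
          else u ⟨j + q - 1, by omega⟩) *
        ((List.ofFn fun j : Fin (i - 1) => y ⟨j, by omega⟩ (g j)).prod • w l)

end YetterDrinfeldAlgebra

/-! ### Operads with multiplication and Gerstenhaber algebras -/

/-- A (non-`Σ`) operad with multiplication in `k`-modules. The operation `comp h i` is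
`∘ᵢ : O(p) ⊗ O(q) → O(p + q - 1)`, for `i ≥ 1`, where `h : p + q = n + 1` says `n = p + q - 1`;
it vanishes unless `1 ≤ i ≤ p` (for `p = q = 0` the target is zero and there is no operation). -/
structure OperadWithMultiplication (k : Type*) [CommRing k] (O : ℕ → Type*)
    [∀ n, AddCommGroup (O n)] [∀ n, Module k (O n)] where
  comp : ∀ {p q n : ℕ}, p + q = n + 1 → ℕ → (O p →ₗ[k] O q →ₗ[k] O n)
  /-- The identity element `𝟙`. -/
  one : O 1
  /-- The multiplication `μ`. -/
  mu : O 2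
  e : O 0
  comp_eq_zero : ∀ {p q n : ℕ} (h : p + q = n + 1) (i : ℕ) (φ : O p) (ψ : O q),
    i = 0 ∨ p < i → comp h i φ ψ = 0
  comp_comp_of_lt : ∀ {p q r m m' n : ℕ} (h₁ : p + q = m + 1) (h₂ : m + r = n + 1)
    (h₃ : p + r = m' + 1) (h₄ : m' + q = n + 1) (i j : ℕ) (φ : O p) (ψ : O q) (χ : O r),
    1 ≤ j → j < i →
    comp h₂ j (comp h₁ i φ ψ) χ = comp h₄ (i + r - 1) (comp h₃ j φ χ) ψ
  comp_comp_of_mem : ∀ {p q r m m' n : ℕ} (h₁ : p + q = m + 1) (h₂ : m + r = n + 1)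
    (h₃ : q + r = m' + 1) (h₄ : p + m' = n + 1) (i j : ℕ) (φ : O p) (ψ : O q) (χ : O r),
    1 ≤ i → i ≤ j → j < q + i →
    comp h₂ j (comp h₁ i φ ψ) χ = comp h₄ i φ (comp h₃ (j - i + 1) ψ χ)
  comp_comp_of_ge : ∀ {p q r m m' n : ℕ} (h₁ : p + q = m + 1) (h₂ : m + r = n + 1)
    (h₃ : p + r = m' + 1) (h₄ : m' + q = n + 1) (i j : ℕ) (φ : O p) (ψ : O q) (χ : O r),
    1 ≤ i → q + i ≤ j →
    comp h₂ j (comp h₁ i φ ψ) χ = comp h₄ i (comp h₃ (j - q + 1) φ χ) ψ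
  comp_one : ∀ {p : ℕ} (h : p + 1 = p + 1) (i : ℕ) (φ : O p), 1 ≤ i → i ≤ p →
    comp h i φ one = φ
  one_comp : ∀ {p : ℕ} (h : 1 + p = p + 1) (φ : O p), comp h 1 one φ = φ
  mu_comp_mu : ∀ h : 2 + 2 = 3 + 1, comp h 1 mu mu = comp h 2 mu mu
  mu_comp_e_left : ∀ h : 2 + 0 = 1 + 1, comp h 1 mu e = one
  mu_comp_e_right : ∀ h : 2 + 0 = 1 + 1, comp h 2 mu e = one

namespace OperadWithMultiplication

variable {k : Type*} [CommRing k] {O : ℕ → Type*} [∀ n, AddCommGroup (O n)]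
  [∀ n, Module k (O n)] (P : OperadWithMultiplication k O)

/-- The cup product `φ ⌣ ψ = (μ ∘₁ φ) ∘_{p+1} ψ`. -/
def cup {p q : ℕ} (φ : O p) (ψ : O q) : O (p + q) :=
  P.comp (show (p + 1) + q = (p + q) + 1 by omega) (p + 1)
    (P.comp (show 2 + p = (p + 1) + 1 by omega) 1 P.mu φ) ψ

/-- `φ ∘̄ ψ = (-1)^{|p||q|} ∑_{i=1}^p (-1)^{|q||i|} φ ∘ᵢ ψ`, where `|n| = n - 1`. -/
def compBar {p q n : ℕ} (h : p + q = n + 1) (φ : O p) (ψ : O q) : O n :=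
  (((p : ℤ) - 1) * ((q : ℤ) - 1)).negOnePow •
    ∑ i ∈ Finset.Icc 1 p, (((q : ℤ) - 1) * ((i : ℤ) - 1)).negOnePow • P.comp h i φ ψ

/-- The bracket `{φ, ψ} = φ ∘̄ ψ - (-1)^{|p||q|} ψ ∘̄ φ`. -/
def bracket {p q n : ℕ} (h : p + q = n + 1) (φ : O p) (ψ : O q) : O n :=
  P.compBar h φ ψ -
    (((p : ℤ) - 1) * ((q : ℤ) - 1)).negOnePow • P.compBar (show q + p = n + 1 by omega) ψ φ

end OperadWithMultiplication

/-- A Gerstenhaber algebra structure on the graded `k`-module `V = ⨁ n, V n`: a graded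
commutative (associative, unital) product and a graded Lie bracket on the desuspension, for which
`{γ, ·}` is a graded derivation of the product. Signs involve `|p| = p - 1`. The two conditions
`bracket_self` and `bracket_bracket_self` are the usual ones for graded Lie algebras over a ring in
which `2` or `3` need not be invertible, and follow from the others if `6` is invertible. -/
structure GerstenhaberAlgebra (k : Type*) [CommRing k] (V : ℕ → Type*)
    [∀ n, AddCommGroup (V n)] [∀ n, Module k (V n)] where
  mul : (⨁ n, V n) →ₗ[k] (⨁ n, V n) →ₗ[k] (⨁ n, V n)
  one : V 0
  bracket : (⨁ n, V n) →ₗ[k] (⨁ n, V n) →ₗ[k] (⨁ n, V n)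
  mul_mem : ∀ (p q : ℕ) (x : V p) (y : V q), ∃ z : V (p + q),
    mul (DirectSum.of V p x) (DirectSum.of V q y) = DirectSum.of V (p + q) z
  mul_assoc : ∀ x y z, mul (mul x y) z = mul x (mul y z)
  one_mul : ∀ x, mul (DirectSum.of V 0 one) x = x
  mul_one : ∀ x, mul x (DirectSum.of V 0 one) = x
  mul_comm : ∀ (p q : ℕ) (x : V p) (y : V q),
    mul (DirectSum.of V p x) (DirectSum.of V q y) =
      ((p : ℤ) * q).negOnePow • mul (DirectSum.of V q y) (DirectSum.of V p x)
  bracket_mem : ∀ (p q n : ℕ), p + q = n + 1 → ∀ (x : V p) (y : V q), ∃ z : V n,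
    bracket (DirectSum.of V p x) (DirectSum.of V q y) = DirectSum.of V n z
  bracket_zero_zero : ∀ x y : V 0, bracket (DirectSum.of V 0 x) (DirectSum.of V 0 y) = 0
  bracket_antisymm : ∀ (p q : ℕ) (x : V p) (y : V q),
    bracket (DirectSum.of V p x) (DirectSum.of V q y) =
      -((((p : ℤ) - 1) * ((q : ℤ) - 1)).negOnePow •
        bracket (DirectSum.of V q y) (DirectSum.of V p x))
  jacobi : ∀ (p q : ℕ) (x : V p) (y : V q) (z : ⨁ n, V n),
    bracket (DirectSum.of V p x) (bracket (DirectSum.of V q y) z) =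
      bracket (bracket (DirectSum.of V p x) (DirectSum.of V q y)) z +
        (((p : ℤ) - 1) * ((q : ℤ) - 1)).negOnePow •
          bracket (DirectSum.of V q y) (bracket (DirectSum.of V p x) z)
  bracket_self : ∀ (p : ℕ), Odd p → ∀ x : V p,
    bracket (DirectSum.of V p x) (DirectSum.of V p x) = 0
  bracket_bracket_self : ∀ (p : ℕ), Even p → ∀ x : V p,
    bracket (DirectSum.of V p x) (bracket (DirectSum.of V p x) (DirectSum.of V p x)) = 0
  leibniz : ∀ (p q : ℕ) (c : V p) (x : V q) (y : ⨁ n, V n),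
    bracket (DirectSum.of V p c) (mul (DirectSum.of V q x) y) =
      mul (bracket (DirectSum.of V p c) (DirectSum.of V q x)) y +
        (((p : ℤ) - 1) * q).negOnePow •
          mul (DirectSum.of V q x) (bracket (DirectSum.of V p c) y)

/-- The degreewise linear isomorphism `e` is an isomorphism of Gerstenhaber algebras. -/
def GerstenhaberAlgebra.IsIso {k : Type*} [CommRing k] {V W : ℕ → Type*}
    [∀ n, AddCommGroup (V n)] [∀ n, Module k (V n)] [∀ n, AddCommGroup (W n)]
    [∀ n, Module k (W n)] (G : GerstenhaberAlgebra k V) (H : GerstenhaberAlgebra k W)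
    (e : ∀ n, V n ≃ₗ[k] W n) : Prop :=
  e 0 G.one = H.one ∧
  ∀ x y : ⨁ n, V n,
    DFinsupp.mapRange.linearEquiv e (G.mul x y) =
      H.mul (DFinsupp.mapRange.linearEquiv e x) (DFinsupp.mapRange.linearEquiv e y) ∧
    DFinsupp.mapRange.linearEquiv e (G.bracket x y) =
      H.bracket (DFinsupp.mapRange.linearEquiv e x) (DFinsupp.mapRange.linearEquiv e y)

/-! ### The groups `Ext_U(A, N)` -/

namespace LeftBialgebroid

open CategoryTheory

section

variable {k A U : Type*} [CommRing k] [Ring A] [Algebra k A] [Ring U] [Algebra k U]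

/-- `U_◃`, that is, `U` with the `Aᵒᵖ`-action `u ◃ a = t(a) u`, is a projective `Aᵒᵖ`-module. -/
def IsProjective (B : LeftBialgebroid k A U) : Prop :=
  letI : Module Aᵐᵒᵖ U := Module.compHom U (B.t : Aᵐᵒᵖ →+* U)
  Module.Projective Aᵐᵒᵖ U

/-- The base algebra `A`, as a left `U`-module. -/
def Base (_B : LeftBialgebroid k A U) : Type _ := A

instance (B : LeftBialgebroid k A U) : AddCommGroup B.Base := inferInstanceAs (AddCommGroup A)

/-- The action `u · a = ε(u s(a))` of `U` on `A`. -/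
instance (B : LeftBialgebroid k A U) : Module U B.Base where
  smul u a := (B.counit (u * B.s a) : A)
  one_smul a := by
    change B.counit (1 * B.s (a : A)) = a
    have := B.counit_bilin (a : A) 1 1
    simp only [AeRing.tgt, B.counit_one, op_one, _root_.map_one, mul_one] at this
    rw [one_mul]
    exact this.trans (mul_one (show A from a))
  mul_smul u v a := by
    change B.counit (u * v * B.s a) = B.counit (u * B.s (B.counit (v * B.s a)))
    rw [mul_assoc, B.counit_mul_s]
  smul_zero u := by
    change B.counit (u * B.s (0 : A)) = (0 : A)
    simp
  smul_add u a b := by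
    change B.counit (u * B.s (show A from a + b)) = B.counit (u * B.s a) + B.counit (u * B.s b)
    rw [← _root_.map_add, ← mul_add]
    congr 2
    exact _root_.map_add B.s (show A from a) (show A from b)
  add_smul u v a := by
    change B.counit ((u + v) * B.s a) = B.counit (u * B.s a) + B.counit (v * B.s a)
    simp [add_mul]
  zero_smul a := by
    change B.counit (0 * B.s a) = (0 : A)
    simp

end

section

variable {k : Type w} {A U : Type v} [CommRing k] [Ring A] [Algebra k A] [Ring U] [Algebra k U]
  (B : LeftBialgebroid k A U)

/-- `Ext^n_U(A, N)`, in the category of left `U`-modules. -/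
def ExtBase (N : Type v) [AddCommGroup N] [Module U N] (n : ℕ) : Type v :=
  Abelian.Ext.{v} (ModuleCat.of U B.Base) (ModuleCat.of U N) n

noncomputable instance (N : Type v) [AddCommGroup N] [Module U N] (n : ℕ) :
    AddCommGroup (B.ExtBase N n) :=
  inferInstanceAs (AddCommGroup (Abelian.Ext (ModuleCat.of U B.Base) (ModuleCat.of U N) n))

/-- The `k`-module structure on `Ext` coming from the `k`-linear structure of the category of
modules over the `k`-algebra `U`. -/
noncomputable instance (N : Type v) [AddCommGroup N] [Module U N] (n : ℕ) :
    Module k (B.ExtBase N n) :=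
  letI : Linear k (ModuleCat.{v} U) := ModuleCat.Algebra.instLinear
  inferInstanceAs (Module k (Abelian.Ext (ModuleCat.of U B.Base) (ModuleCat.of U N) n))

/-- `β` is a comparison map from the bar resolution of `A` to the projective resolution `R`. A
`U`-linear map from the `n`-th term `U ⊗_{Aᵒᵖ} U^{⊗_{Aᵒᵖ} n}` of the bar resolution to `X` is the
same as an element of `C^n(U, X)`, precomposition with the differential being `δ`; so a comparison
map is a sequence `β n ∈ C^n(U, R_n)` with `d ∘ β (n + 1) = δ (β n)`, and `β 0 ∈ R_0` lifts
`1 ∈ A`. -/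
structure IsBarComparison (R : ProjectiveResolution (ModuleCat.of U B.Base))
    (β : ∀ n, (Fin n → U) → R.complex.X n) : Prop where
  isCochain : ∀ n, B.IsCochain (β n)
  augmentation : ∀ u : Fin 0 → U,
    ((R.π.f 0 ≫ (HomologicalComplex.singleObjXSelf (ComplexShape.down ℕ) 0
      (ModuleCat.of U B.Base)).hom).hom (β 0 u) : B.Base) =
      (1 : A)
  d_comp : ∀ (n : ℕ) (u : Fin (n + 1) → U),
    (R.complex.d (n + 1) n).hom (β (n + 1) u) = B.coboundary (β n) u

end

end LeftBialgebroid

/-! The idea is to replace the base algebra $A$ by $N$. Let $W=U\otimes_A N$ be the smash product,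
with $(u\otimes n)(u'\otimes n')=u_{(1)}u'\otimes(u_{(2)}n')n$, let $\iota(u)=u\otimes 1$, let the
target $\tau(n)=1\otimes n$ be an antihomomorphism, and let the source $\sigma$ be the coaction.
Braided commutativity says that $\sigma$ is multiplicative and commutes with $\tau$ (`source_mul`,
`source_mul_target`), so that $W$ is a ring over $N\otimes N^{op}$. It acts on $N$ by
$\iota(u)m=um$, $\tau(n)m=mn$, $\sigma(n)m=nm$. Since $W$ is spanned by the products
$\tau(n)\iota(u)$, every cochain on $U$ with values in $N$ extends uniquely to a cochain on $W$ that
is balanced over $N^{op}$ (`IsSmashCochain.ext`, `exists_extension`). The algebra of coefficients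
has become the base algebra.

On $W$ the expression $D_\psi$ becomes an operator $\hat D_\psi$ from $q$ arguments in $W$ to $W$.
It is linear over $\tau(N)$ on both sides, satisfies $\hat D_\psi\cdot 1_N=\psi$, and
$\varphi\circ_i\psi$ is the plain substitution of $\hat D_\psi$ for an argument of $\varphi$. The
decisive fact is $\hat D_{\varphi\circ_i\psi}=\hat D_\varphi\circ_i\hat D_\psi$ (`Dhat_insertAt`),
which comes down to coassociativity. The operad axioms are then those of substitution of multilinear
functions. As $\hat D_{\mathbb 1}$ is the identity and $\hat D_\mu$ the product of $W$, the axioms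
for $\mu$ are those of a unital associative ring. The Sweedler formula for $\varphi\circ_i\psi$
appears when factors $\tau(n)$ are carried to the left out of the arguments, collecting a leg
$u_{(2)}$ at each one (`isInsertion_operad`).

The second statement is Gerstenhaber's argument for an operad with multiplication. On the direct
sum, the signed sum of all insertions is a graded pre-Lie product (`pre_pre`), so its commutator
$\{\cdot,\cdot\}$ is a graded Lie bracket. From $\mu\circ\mu=0$ the operator $\{\mu,\cdot\}$ squares
to zero, and a comparison of faces identifies it with $\delta$. Up to sign the cup product is the
brace $\mu\{x,y\}$. The pre-Lie product is a homotopy for its commutativity (`brk_muT_pre`), and the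
brace $\gamma\{\alpha,\beta\}$ is one for the Leibniz rule (`brk_scup`).

For the third statement, separating the first argument gives
$C^{n+1}(U,X)=C^n(U,\mathrm{Hom}_{A^{op}}(U_\lhd,X))$. If $U_\lhd$ is projective, cochains therefore
lift along surjections, that is, the modules of the bar complex are projective; the complex is
contractible by the usual homotopy. Cochains are the $U$-linear maps from the bar resolution to $N$,
so $\mathrm{Ext}$ is the cohomology above and the structure is transported. -/

set_option linter.unusedSectionVars false

/-! ### Sweedler calculus -/

namespace AeRing

variable {k A U : Type*} [CommRing k] [Ring A] [Algebra k A] [Ring U] [Algebra k U]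
  (E : AeRing k A U) {X : Type*} [AddCommGroup X] [Module k X] [Module U X]
  {M : Type*} [AddCommGroup M]

/-- Biadditive functions that factor through `U ⊗_A X`. -/
structure IsBalanced (f : U → X → M) : Prop where
  add_left : ∀ u u' x, f (u + u') x = f u x + f u' x
  add_right : ∀ u x x', f u (x + x') = f u x + f u x'
  tgt_mul : ∀ a u x, f (E.tgt a * u) x = f u (E.s a • x)

/-- Triadditive functions that factor through `U ⊗_A U ⊗_A X`. -/
structure IsBalanced₃ (f : U → U → X → M) : Prop where
  add_fst : ∀ u u' v x, f (u + u') v x = f u v x + f u' v x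
  add_snd : ∀ u v v' x, f u (v + v') x = f u v x + f u v' x
  add_trd : ∀ u v x x', f u v (x + x') = f u v x + f u v x'
  tgt_fst : ∀ a u v x, f (E.tgt a * u) v x = f u (E.s a * v) x
  tgt_snd : ∀ a u v x, f u (E.tgt a * v) x = f u v (E.s a • x)

theorem tgt_algebraMap (c : k) : E.tgt (algebraMap k A c) = algebraMap k U c := by
  have : op (algebraMap k A c) = algebraMap k Aᵐᵒᵖ c := rfl
  rw [tgt, this, AlgHom.commutes]

theorem tgt_one : E.tgt 1 = 1 := by simp [tgt]

variable {E}

/-- Scalars need no hypothesis of their own: `s` and `t` are $k$-algebra maps, so balancing over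
$A$, applied to the image of $c$ in $A$, already moves $c$ across. -/
theorem IsBalanced.smul [IsScalarTower k U X] {f : U → X → M} (hf : E.IsBalanced f) (c : k) (u : U)
    (x : X) : f (c • u) x = f u (c • x) := by
  have := hf.tgt_mul (algebraMap k A c) u x
  rwa [tgt_algebraMap, AlgHom.commutes, algebraMap_smul, ← Algebra.smul_def] at this

theorem IsBalanced₃.smul_fst {f : U → U → X → M} (hf : E.IsBalanced₃ f) (c : k)
    (u v : U) (x : X) : f (c • u) v x = f u (c • v) x := by
  have := hf.tgt_fst (algebraMap k A c) u v x
  rwa [tgt_algebraMap, AlgHom.commutes, ← Algebra.smul_def, ← Algebra.smul_def] at this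

/-- The additive map on `U ⊗_k X` induced by a balanced function. -/
noncomputable def IsBalanced.liftAux [IsScalarTower k U X] {f : U → X → M} (hf : E.IsBalanced f) :
    U ⊗[k] X →+ M :=
  TensorProduct.liftAddHom
    (AddMonoidHom.mk' (fun u => AddMonoidHom.mk' (f u) (hf.add_right u))
      fun u u' => AddMonoidHom.ext (hf.add_left u u'))
    fun c u x => by simpa using hf.smul c u x

/-- The additive map on `U ⊗_A X` induced by a balanced function. -/
noncomputable def IsBalanced.lift [IsScalarTower k U X] {f : U → X → M} (hf : E.IsBalanced f) :
    E.BalTensor X →+ M :=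
  QuotientAddGroup.lift (E.balancedRel X).toAddSubgroup hf.liftAux (by
    intro z hz
    -- The relations span a $k$-submodule while the lift is only additive. Proving the vanishing for
    -- all multiples of $z$ at once gets through the scalar step of the span induction.
    have key : ∀ c : k, hf.liftAux (c • z) = 0 := by
      refine Submodule.span_induction ?_ ?_ ?_ ?_ hz
      · rintro _ ⟨a, u, x, rfl⟩ c
        simp only [smul_sub, TensorProduct.smul_tmul', map_sub]
        change f _ _ - f _ _ = 0
        rw [← mul_smul_comm, hf.tgt_mul, sub_self]
      · simp
      · intro y z _ _ hy hz c
        rw [smul_add, map_add, hy, hz, add_zero]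
      · intro d y _ hy c
        rw [smul_smul, hy]
    simpa using key 1)

theorem IsBalanced.lift_tmul [IsScalarTower k U X] {f : U → X → M} (hf : E.IsBalanced f) (u : U)
    (x : X) : hf.lift (E.tmul u x) = f u x := rfl

theorem IsBalanced₃.isBalanced_snd {f : U → U → X → M} (hf : E.IsBalanced₃ f) (u : U) :
    E.IsBalanced (f u) :=
  ⟨hf.add_snd u, hf.add_trd u, fun a => hf.tgt_snd a u⟩

theorem IsBalanced₃.isBalanced_fst {f : U → U → X → M} (hf : E.IsBalanced₃ f) (x : X) :
    E.IsBalanced fun u v => f u v x :=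
  ⟨fun _ _ _ => hf.add_fst _ _ _ _, fun _ _ _ => hf.add_snd _ _ _ _, fun a u v => hf.tgt_fst a u v x⟩

/-- The additive map on `U ⊗_k U ⊗_k X` induced by a balanced function. -/
noncomputable def IsBalanced₃.liftAux [IsScalarTower k U X] {f : U → U → X → M}
    (hf : E.IsBalanced₃ f) : U ⊗[k] (U ⊗[k] X) →+ M :=
  TensorProduct.liftAddHom
    (AddMonoidHom.mk' (fun u => (hf.isBalanced_snd u).liftAux) fun u u' => by
      ext z
      induction z with
      | zero => simp only [map_zero]
      | tmul v x => exact hf.add_fst u u' v x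
      | add x y hx hy => rw [map_add, map_add, hx, hy])
    fun c u z => by
      induction z with
      | zero => rw [smul_zero, map_zero, map_zero]
      | tmul v x => exact hf.smul_fst c u v x
      | add x y hx hy => rw [smul_add, map_add, map_add, hx, hy]

theorem IsBalanced₃.liftAux_tmul [IsScalarTower k U X] {f : U → U → X → M}
    (hf : E.IsBalanced₃ f) (u v : U) (x : X) : hf.liftAux (u ⊗ₜ (v ⊗ₜ x)) = f u v x := rfl

/-- The additive map on `U ⊗_A U ⊗_A X` induced by a balanced function. -/
noncomputable def IsBalanced₃.lift [IsScalarTower k U X] {f : U → U → X → M}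
    (hf : E.IsBalanced₃ f) : E.BalTensor₃ X →+ M :=
  QuotientAddGroup.lift (E.balancedRel₃ X).toAddSubgroup hf.liftAux (by
    intro z hz
    have key : ∀ c : k, hf.liftAux (c • z) = 0 := by
      refine Submodule.span_induction ?_ ?_ ?_ ?_ hz
      · rintro _ (⟨a, u, v, x, rfl⟩ | ⟨a, u, v, x, rfl⟩) c
        · simp only [smul_sub, TensorProduct.smul_tmul', map_sub, ← mul_smul_comm,
            hf.liftAux_tmul, hf.tgt_fst, sub_self]
        · simp only [smul_sub, TensorProduct.smul_tmul', map_sub, hf.liftAux_tmul, hf.tgt_snd,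
            sub_self]
      · simp
      · intro y z _ _ hy hz c
        rw [smul_add, map_add, hy, hz, add_zero]
      · intro d y _ hy c
        rw [smul_smul, hy]
    simpa using key 1)

theorem IsBalanced₃.lift_tmul [IsScalarTower k U X] {f : U → U → X → M} (hf : E.IsBalanced₃ f)
    (u v : U) (x : X) : hf.lift (E.tmul₃ u v x) = f u v x := rfl

variable (E)

theorem tmul_add (u : U) (x x' : X) : E.tmul u (x + x') = E.tmul u x + E.tmul u x' := by
  simp [tmul, TensorProduct.tmul_add]

theorem add_tmul (u u' : U) (x : X) : E.tmul (u + u') x = E.tmul u x + E.tmul u' x := by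
  simp [tmul, TensorProduct.add_tmul]

theorem tgt_mul_tmul (a : A) (u : U) (x : X) : E.tmul (E.tgt a * u) x = E.tmul u (E.s a • x) := by
  rw [← sub_eq_zero, tmul, tmul, ← map_sub]
  exact (Submodule.Quotient.mk_eq_zero _).2 (Submodule.subset_span ⟨a, u, x, rfl⟩)

theorem zero_tmul (x : X) : E.tmul 0 x = 0 := by simp [tmul]

/-- Presentations can be padded by zero terms. All lengths from some bound on are provided, because
the coassociativity and Yetter–Drinfel'd axioms take families of presentations of one common length.
-/
theorem exists_isRep_of_le (z : E.BalTensor X) :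
    ∃ m : ℕ, ∀ m', m ≤ m' → ∃ (x : Fin m' → U) (y : Fin m' → X), E.IsRep x y z := by
  obtain ⟨z, rfl⟩ := Submodule.mkQ_surjective _ z
  induction z with
  | zero => exact ⟨0, fun m' _ => ⟨0, 0, by simp [IsRep, tmul]⟩⟩
  | tmul u x =>
    refine ⟨1, fun m' h => ⟨fun l => if (l : ℕ) = 0 then u else 0, fun _ => x, ?_⟩⟩
    obtain ⟨m, rfl⟩ : ∃ m, m' = m + 1 := ⟨m' - 1, by omega⟩
    simp [IsRep, Fin.sum_univ_succ, zero_tmul]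
    rfl
  | add x y hx hy =>
    obtain ⟨m₁, h₁⟩ := hx
    obtain ⟨m₂, h₂⟩ := hy
    refine ⟨m₁ + m₂, fun m' h => ?_⟩
    obtain ⟨m, rfl⟩ : ∃ m, m' = m₁ + m := ⟨m' - m₁, by omega⟩
    obtain ⟨a, b, hab⟩ := h₁ m₁ le_rfl
    obtain ⟨c, d, hcd⟩ := h₂ m (by omega)
    refine ⟨Fin.append a c, Fin.append b d, ?_⟩
    simp only [IsRep] at hab hcd ⊢
    rw [map_add, hab, hcd, Fin.sum_univ_add]
    simp

theorem exists_isRep (z : E.BalTensor X) :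
    ∃ (m : ℕ) (x : Fin m → U) (y : Fin m → X), E.IsRep x y z := by
  obtain ⟨m, h⟩ := E.exists_isRep_of_le z
  exact ⟨m, h m le_rfl⟩

theorem exists_isRep_family {n : ℕ} (z : Fin n → E.BalTensor X) :
    ∃ m : ℕ, ∀ m', m ≤ m' → ∃ (x : Fin n → Fin m' → U) (y : Fin n → Fin m' → X),
      ∀ l, E.IsRep (x l) (y l) (z l) := by
  choose m h using fun l => E.exists_isRep_of_le (z l)
  refine ⟨∑ l, m l, fun m' hm' => ?_⟩
  choose x y hxy using fun l => h l m' ((Finset.single_le_sum (fun _ _ => Nat.zero_le _)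
    (Finset.mem_univ l)).trans hm')
  exact ⟨x, y, hxy⟩

/-- Induction on elements of `U ⊗_A X`. -/
@[elab_as_elim]
theorem induction {P : E.BalTensor X → Prop} (z : E.BalTensor X) (h0 : P 0)
    (h : ∀ u x, P (E.tmul u x)) (hadd : ∀ y z, P y → P z → P (y + z)) : P z := by
  obtain ⟨z, rfl⟩ := Submodule.mkQ_surjective _ z
  induction z with
  | zero => simpa using h0
  | tmul u x => exact h u x
  | add x y hx hy => rw [map_add]; exact hadd _ _ hx hy

/-- `∑ f(z₍₁₎, z₍₂₎)` for a chosen presentation `∑ z₍₁₎ ⊗_A z₍₂₎` of `z`. -/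
noncomputable def sw (z : E.BalTensor X) (f : U → X → M) : M :=
  ∑ l, f ((E.exists_isRep z).choose_spec.choose l)
    ((E.exists_isRep z).choose_spec.choose_spec.choose l)

theorem map_sw {M' F : Type*} [AddCommGroup M'] [FunLike F M M'] [AddMonoidHomClass F M M'] (g : F)
    (z : E.BalTensor X) (f : U → X → M) : g (E.sw z f) = E.sw z fun u x => g (f u x) := by
  simp [sw, map_sum]

theorem map_sw_of_add {M' : Type*} [AddCommGroup M'] (g : M → M')
    (hg : ∀ x y, g (x + y) = g x + g y) (z : E.BalTensor X) (f : U → X → M) :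
    g (E.sw z f) = E.sw z fun u x => g (f u x) :=
  E.map_sw (AddMonoidHom.mk' g hg) z f

theorem sw_comm {X' : Type*} [AddCommGroup X'] [Module k X'] [Module U X'] (z : E.BalTensor X)
    (z' : E.BalTensor X') (f : U → X → U → X' → M) :
    (E.sw z fun u x => E.sw z' fun u' x' => f u x u' x') =
      E.sw z' fun u' x' => E.sw z fun u x => f u x u' x' := by
  simp only [sw]
  exact Finset.sum_comm

theorem sw_add_fun (z : E.BalTensor X) (f g : U → X → M) :
    (E.sw z fun u x => f u x + g u x) = E.sw z f + E.sw z g := by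
  simp [sw, Finset.sum_add_distrib]

theorem sw_mul {R : Type*} [Ring R] (z : E.BalTensor X) (f : U → X → R) (r : R) :
    E.sw z f * r = E.sw z fun u x => f u x * r :=
  E.map_sw (AddMonoidHom.mulRight r) z f

theorem mul_sw {R : Type*} [Ring R] (z : E.BalTensor X) (f : U → X → R) (r : R) :
    r * E.sw z f = E.sw z fun u x => r * f u x :=
  E.map_sw (AddMonoidHom.mulLeft r) z f

theorem sw_smul {R : Type*} [Ring R] [Module R M] (z : E.BalTensor X) (f : U → X → R) (r : M) :
    E.sw z f • r = E.sw z fun u x => f u x • r := by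
  simp [sw, Finset.sum_smul]

variable {E} [IsScalarTower k U X]

theorem IsBalanced.sum_eq_lift {f : U → X → M} (hf : E.IsBalanced f) {m : ℕ} {x : Fin m → U}
    {y : Fin m → X} {z : E.BalTensor X} (h : E.IsRep x y z) : ∑ l, f (x l) (y l) = hf.lift z := by
  rw [h, map_sum]
  rfl

/-- The choice hidden in `sw` disappears for balanced functions. For this reason the Sweedler
identities below come with proofs that their summands are balanced. -/
theorem IsBalanced.sw_eq_lift {f : U → X → M} (hf : E.IsBalanced f) (z : E.BalTensor X) :
    E.sw z f = hf.lift z :=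
  hf.sum_eq_lift (E.exists_isRep z).choose_spec.choose_spec.choose_spec

theorem IsBalanced.sw_eq_sum {f : U → X → M} (hf : E.IsBalanced f) {m : ℕ} {x : Fin m → U}
    {y : Fin m → X} {z : E.BalTensor X} (h : E.IsRep x y z) :
    E.sw z f = ∑ l, f (x l) (y l) := by
  rw [hf.sw_eq_lift, hf.sum_eq_lift h]

theorem IsBalanced.sw_tmul {f : U → X → M} (hf : E.IsBalanced f) (u : U) (x : X) :
    E.sw (E.tmul u x) f = f u x := by
  rw [hf.sw_eq_lift, hf.lift_tmul]

theorem IsBalanced.sw_add {f : U → X → M} (hf : E.IsBalanced f) (z z' : E.BalTensor X) :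
    E.sw (z + z') f = E.sw z f + E.sw z' f := by
  simp only [hf.sw_eq_lift, map_add]

theorem IsBalanced.sw_zero {f : U → X → M} (hf : E.IsBalanced f) :
    E.sw (0 : E.BalTensor X) f = 0 := by
  simp only [hf.sw_eq_lift, map_zero]

theorem IsBalanced.sw_sum {ι : Type*} {f : U → X → M} (hf : E.IsBalanced f) (S : Finset ι)
    (z : ι → E.BalTensor X) : E.sw (∑ i ∈ S, z i) f = ∑ i ∈ S, E.sw (z i) f := by
  simp only [hf.sw_eq_lift, map_sum]

theorem IsBalanced.sw_sw {X' : Type*} [AddCommGroup X'] [Module k X'] [Module U X']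
    {f : U → X → M} (hf : E.IsBalanced f) (z : E.BalTensor X')
    (g : U → X' → E.BalTensor X) : E.sw (E.sw z g) f = E.sw z fun u x => E.sw (g u x) f := by
  rw [hf.sw_eq_lift, map_sw]
  simp only [hf.sw_eq_lift]

omit [IsScalarTower k U X] in
variable (E) in
theorem sw_tmul_eq (z : E.BalTensor X) : E.sw z E.tmul = z :=
  (E.exists_isRep z).choose_spec.choose_spec.choose_spec.symm

end AeRing

/-! ### Sweedler calculus in bialgebroids and comodules -/

namespace LeftBialgebroid

variable {k A U : Type*} [CommRing k] [Ring A] [Algebra k A] [Ring U] [Algebra k U]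
  (B : LeftBialgebroid k A U) {M : Type*} [AddCommGroup M]

theorem isRep_sw {X : Type*} [AddCommGroup X] [Module k X] [Module U X] (z : B.BalTensor X) :
    B.IsRep (B.exists_isRep z).choose_spec.choose
      (B.exists_isRep z).choose_spec.choose_spec.choose z :=
  (B.exists_isRep z).choose_spec.choose_spec.choose_spec

variable {B}

theorem sw_comul_add {f : U → U → M} (hf : B.IsBalanced f) (u v : U) :
    B.sw (B.comul (u + v)) f = B.sw (B.comul u) f + B.sw (B.comul v) f := by
  rw [map_add, hf.sw_add]

theorem sw_comul_tgt_mul {f : U → U → M} (hf : B.IsBalanced f) (a : A) (u : U) :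
    B.sw (B.comul (B.tgt a * u)) f = B.sw (B.comul u) fun x y => f x (B.tgt a * y) := by
  have h := B.comul_bilin 1 a u _ _ _ (B.isRep_sw (B.comul u))
  simp only [map_one, one_mul] at h
  rw [h, hf.sw_sum]
  simp only [hf.sw_tmul]
  rfl

theorem sw_comul_mul {f : U → U → M} (hf : B.IsBalanced f) (u v : U) :
    B.sw (B.comul (u * v)) f =
      B.sw (B.comul u) fun x y => B.sw (B.comul v) fun x' y' => f (x * x') (y * y') := by
  rw [B.comul_mul u v _ _ _ _ _ _ (B.isRep_sw (B.comul u)) (B.isRep_sw (B.comul v)), hf.sw_sum]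
  simp only [hf.sw_sum, hf.sw_tmul]
  rfl

theorem sw_comul_one {f : U → U → M} (hf : B.IsBalanced f) : B.sw (B.comul 1) f = f 1 1 := by
  rw [B.comul_one, hf.sw_tmul]

theorem sw_comul_tgt {f : U → U → M} (hf : B.IsBalanced f) (a : A) :
    B.sw (B.comul (B.tgt a)) f = f 1 (B.tgt a) := by
  have h := B.comul_bilin 1 a 1 1 (fun _ => 1) (fun _ => 1) (by simp [AeRing.IsRep, B.comul_one])
  simp only [map_one, one_mul, mul_one] at h
  rw [h]
  simp [hf.sw_tmul]

theorem sw_comul_s {f : U → U → M} (hf : B.IsBalanced f) (a : A) :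
    B.sw (B.comul (B.s a)) f = f (B.s a) 1 := by
  have h := B.comul_bilin a 1 1 1 (fun _ => 1) (fun _ => 1) (by simp [AeRing.IsRep, B.comul_one])
  simp only [AeRing.tgt_one, mul_one] at h
  rw [h]
  simp [hf.sw_tmul]

theorem sw_comul_mul_tgt {f : U → U → M} (hf : B.IsBalanced f) (u : U) (a : A) :
    B.sw (B.comul (u * B.tgt a)) f = B.sw (B.comul u) fun x y => f x (y * B.tgt a) := by
  rw [B.comul_mul u (B.tgt a) _ 1 _ _ (fun _ => 1) (fun _ => B.tgt a) (B.isRep_sw (B.comul u)),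
    hf.sw_sum]
  · simp only [hf.sw_sum, hf.sw_tmul]
    simp
    rfl
  · have h := B.comul_bilin 1 a 1 1 (fun _ => 1) (fun _ => 1)
      (by simp [AeRing.IsRep, B.comul_one])
    simpa [AeRing.IsRep] using h

theorem sw_takeuchi {f : U → U → M} (hf : B.IsBalanced f) (a : A) (u : U) :
    (B.sw (B.comul u) fun x y => f (x * B.tgt a) y) =
      B.sw (B.comul u) fun x y => f x (y * B.s a) := by
  have h := congrArg (fun z => B.sw z f) (B.takeuchi a u _ _ _ (B.isRep_sw (B.comul u)))
  simp only [hf.sw_sum, hf.sw_tmul] at h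
  exact h

theorem sw_coassoc {f : U → U → U → M} (hf : B.IsBalanced₃ f) (u : U) :
    (B.sw (B.comul u) fun x y => B.sw (B.comul x) fun x₁ x₂ => f x₁ x₂ y) =
      B.sw (B.comul u) fun x y => B.sw (B.comul y) fun y₁ y₂ => f x y₁ y₂ := by
  obtain ⟨m₁, h₁⟩ := B.exists_isRep_family
    fun l => B.comul ((B.exists_isRep (B.comul u)).choose_spec.choose l)
  obtain ⟨m₂, h₂⟩ := B.exists_isRep_family
    fun l => B.comul ((B.exists_isRep (B.comul u)).choose_spec.choose_spec.choose l)
  -- Both families of inner presentations must have the same length.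
  obtain ⟨x₁, x₂, h₁⟩ := h₁ (max m₁ m₂) (le_max_left _ _)
  obtain ⟨y₁, y₂, h₂⟩ := h₂ (max m₁ m₂) (le_max_right _ _)
  have h := B.coassoc u _ _ _ _ x₁ x₂ y₁ y₂ (B.isRep_sw (B.comul u)) h₁ h₂
  have h' := congrArg hf.lift h
  simp only [map_sum, hf.lift_tmul] at h'
  rw [AeRing.sw, AeRing.sw]
  simp only [fun l => (hf.isBalanced_snd _).sw_eq_sum (h₂ l)]
  rw [← h']
  refine Finset.sum_congr rfl fun l _ => ?_
  exact AeRing.IsBalanced.sw_eq_sum (hf.isBalanced_fst _) (h₁ l)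

theorem sw_counit_left (u : U) : (B.sw (B.comul u) fun x y => B.s (B.counit x) * y) = u :=
  B.counit_comul u _ _ _ (B.isRep_sw _)

theorem sw_counit_right (u : U) : (B.sw (B.comul u) fun x y => B.tgt (B.counit y) * x) = u :=
  B.comul_counit u _ _ _ (B.isRep_sw _)

end LeftBialgebroid

namespace YetterDrinfeldModule

variable {k A U : Type*} [CommRing k] [Ring A] [Algebra k A] [Ring U] [Algebra k U]
  {B : LeftBialgebroid k A U} {X : Type*} [AddCommGroup X] [Module k X] [Module U X]
  [IsScalarTower k U X] (Y : YetterDrinfeldModule B X) {M : Type*} [AddCommGroup M]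

theorem sw_coact_s_smul {f : U → X → M} (hf : B.IsBalanced f) (a : A) (x : X) :
    B.sw (Y.coact (B.s a • x)) f = B.sw (Y.coact x) fun c d => f (B.s a * c) d := by
  rw [Y.coact_smul a x _ _ _ (B.isRep_sw _), hf.sw_sum]
  simp only [hf.sw_tmul]
  rfl

theorem sw_right_action (a : A) (x : X) :
    (B.sw (Y.coact x) fun c d => B.s (B.counit (c * B.tgt a)) • d) = B.tgt a • x :=
  (Y.right_action a x _ _ _ (B.isRep_sw _)).symm

theorem sw_coassoc {f : U → U → X → M} (hf : B.IsBalanced₃ f) (x : X) :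
    (B.sw (Y.coact x) fun c d => B.sw (B.comul c) fun c₁ c₂ => f c₁ c₂ d) =
      B.sw (Y.coact x) fun c d => B.sw (Y.coact d) fun d₁ d₂ => f c d₁ d₂ := by
  obtain ⟨m₁, h₁⟩ := B.exists_isRep_family
    fun l => B.comul ((B.exists_isRep (Y.coact x)).choose_spec.choose l)
  obtain ⟨m₂, h₂⟩ := B.exists_isRep_family
    fun l => Y.coact ((B.exists_isRep (Y.coact x)).choose_spec.choose_spec.choose l)
  obtain ⟨x₁, x₂, h₁⟩ := h₁ (max m₁ m₂) (le_max_left _ _)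
  obtain ⟨y₁, y₂, h₂⟩ := h₂ (max m₁ m₂) (le_max_right _ _)
  have h := Y.coassoc x _ _ _ _ x₁ x₂ y₁ y₂ (B.isRep_sw (Y.coact x)) h₁ h₂
  have h' := congrArg hf.lift h
  simp only [map_sum, hf.lift_tmul] at h'
  rw [AeRing.sw, AeRing.sw]
  simp only [fun l => (hf.isBalanced_snd _).sw_eq_sum (h₂ l)]
  rw [← h']
  refine Finset.sum_congr rfl fun l _ => ?_
  exact AeRing.IsBalanced.sw_eq_sum (hf.isBalanced_fst _) (h₁ l)

theorem sw_yetter_drinfeld {f : U → X → M} (hf : B.IsBalanced f) (u : U) (x : X) :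
    (B.sw (B.comul u) fun u₁ u₂ => B.sw (Y.coact (u₁ • x)) fun c d => f (c * u₂) d) =
      B.sw (B.comul u) fun u₁ u₂ => B.sw (Y.coact x) fun c d => f (u₁ * c) (u₂ • d) := by
  have hf' : ∀ v, B.IsBalanced fun c d => f (c * v) d := fun v =>
    ⟨fun _ _ _ => by rw [add_mul, hf.add_left], fun _ _ _ => hf.add_right _ _ _,
      fun _ _ _ => by rw [mul_assoc, hf.tgt_mul]⟩
  obtain ⟨m, h⟩ := B.exists_isRep_family
    fun l => Y.coact ((B.exists_isRep (B.comul u)).choose_spec.choose l • x)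
  obtain ⟨c, d, h⟩ := h m le_rfl
  have h1 := congrArg (fun z => B.sw z f) (Y.yetter_drinfeld u x _ _ _ _ _ c d _ _
    (B.isRep_sw (B.comul u)) h (B.isRep_sw (Y.coact x)))
  simp only [hf.sw_sum, hf.sw_tmul] at h1
  refine Eq.trans ?_ h1
  rw [AeRing.sw]
  exact Finset.sum_congr rfl fun l _ => (hf' _).sw_eq_sum (h l)

end YetterDrinfeldModule

namespace YetterDrinfeldAlgebra

variable {k A U : Type*} [CommRing k] [Ring A] [Algebra k A] [Ring U] [Algebra k U]
  {B : LeftBialgebroid k A U} {N : Type*} [Ring N] [Algebra k N] [Module U N]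
  [IsScalarTower k U N] (Y : YetterDrinfeldAlgebra B N) {M : Type*} [AddCommGroup M]

theorem smul_mul_eq_sw (Y : YetterDrinfeldAlgebra B N) (u : U) (n n' : N) :
    u • (n * n') = B.sw (B.comul u) fun x y => (x • n) * (y • n') :=
  Y.smul_mul u n n' _ _ _ (B.isRep_sw _)

theorem sw_coact_mul {f : U → N → M} (hf : B.IsBalanced f) (n n' : N) :
    B.sw (Y.coact (n * n')) f = B.sw (Y.coact n) fun c d => B.sw (Y.coact n') fun c' d' =>
      f (c * c') (d * d') := by
  rw [Y.coact_mul n n' _ _ _ _ _ _ (B.isRep_sw _) (B.isRep_sw _), hf.sw_sum]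
  simp only [hf.sw_sum, hf.sw_tmul]
  rfl

variable {Y} in
theorem IsBraidedCommutative.mul_eq_sw (hY : Y.IsBraidedCommutative) (n n' : N) :
    n * n' = B.sw (Y.coact n) fun c d => (c • n') * d :=
  hY n n' _ _ _ (B.isRep_sw _)

end YetterDrinfeldAlgebra

namespace LeftBialgebroid

variable {k A U : Type*} [CommRing k] [Ring A] [Algebra k A] [Ring U] [Algebra k U]
  (B : LeftBialgebroid k A U) {M : Type*} [AddCommGroup M]

theorem s_mul (a b : A) : B.s (a * b) = B.s a * B.s b := map_mul _ _ _

theorem counit_s_mul (a : A) (u : U) : B.counit (B.s a * u) = a * B.counit u := by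
  simpa [AeRing.tgt_one] using B.counit_bilin a 1 u

theorem counit_tgt (a : A) : B.counit (B.tgt a) = a := by
  simpa [B.counit_one] using B.counit_tgt_mul a 1

theorem counit_s (a : A) : B.counit (B.s a) = a := by
  simpa [B.counit_one] using B.counit_s_mul a 1

theorem s_mul_tgt (a b : A) : B.s a * B.tgt b = B.tgt b * B.s a := B.toAeRing.s_mul_t a _

end LeftBialgebroid

namespace AeRing

variable {k A U : Type*} [CommRing k] [Ring A] [Algebra k A] [Ring U] [Algebra k U]
  {E : AeRing k A U} {X : Type*} [AddCommGroup X] [Module k X] [Module U X]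
  {M : Type*} [AddCommGroup M]

end AeRing

namespace YetterDrinfeldModule

variable {k A U : Type*} [CommRing k] [Ring A] [Algebra k A] [Ring U] [Algebra k U]
  {B : LeftBialgebroid k A U} {X : Type*} [AddCommGroup X] [Module k X] [Module U X]
  [IsScalarTower k U X] (Y : YetterDrinfeldModule B X) {M : Type*} [AddCommGroup M]

/-- Apply the coaction to $x\lhd a=\varepsilon(x_{(-1)}t(a))\rhd x_{(0)}$. Coassociativity puts
$\varepsilon(-\,t(a))$ on the first leg of $\Delta(x_{(-1)})$; the Takeuchi condition trades the
right factor $t(a)$ there for a right factor $s(a)$ on the second leg; the counit then removes the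
first leg. -/
theorem sw_coact_tgt_smul {f : U → X → M} (hf : B.IsBalanced f) (a : A) (x : X) :
    B.sw (Y.coact (B.tgt a • x)) f = B.sw (Y.coact x) fun c d => f (c * B.s a) d := by
  have h3 : B.IsBalanced₃ fun u v x => f (B.s (B.counit (u * B.tgt a)) * v) x :=
    ⟨fun _ _ _ _ => by rw [add_mul, map_add, map_add, add_mul, hf.add_left],
      fun _ _ _ _ => by rw [mul_add, hf.add_left],
      fun _ _ _ _ => by rw [hf.add_right],
      fun b u v x => by rw [mul_assoc, B.counit_tgt_mul, B.s_mul, mul_assoc],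
      fun b u v x => by rw [← hf.tgt_mul, ← mul_assoc, B.s_mul_tgt, mul_assoc]⟩
  have hx : ∀ (c : U) (d : X), f (c * B.s a) d =
      B.sw (B.comul c) fun c₁ c₂ => f (B.s (B.counit (c₁ * B.tgt a)) * c₂) d := by
    intro c d
    have hb : B.IsBalanced fun x y => B.s (B.counit x) * y :=
      ⟨fun _ _ _ => by rw [map_add, map_add, add_mul],
        fun _ _ _ => by rw [mul_add],
        fun a u v => by
          rw [smul_eq_mul, B.counit_tgt_mul, B.s_mul, mul_assoc]⟩
    rw [← B.map_sw_of_add (fun u => f u d) (fun _ _ => hf.add_left _ _ _)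
      _ fun c₁ c₂ => B.s (B.counit (c₁ * B.tgt a)) * c₂, LeftBialgebroid.sw_takeuchi hb]
    simp only [← mul_assoc]
    rw [← B.sw_mul, B.sw_counit_left]
  simp only [hx]
  rw [Y.sw_coassoc h3, ← Y.sw_right_action a x, B.map_sw Y.coact, hf.sw_sw]
  simp only [Y.sw_coact_s_smul hf]

end YetterDrinfeldModule

/-! ### The smash product -/

namespace YetterDrinfeldAlgebra

variable {k A U : Type*} [CommRing k] [Ring A] [Algebra k A] [Ring U] [Algebra k U]
  {B : LeftBialgebroid k A U} {N : Type*} [Ring N] [Algebra k N] [Module U N]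
  [IsScalarTower k U N] (Y : YetterDrinfeldAlgebra B N) {M : Type*} [AddCommGroup M]

theorem isBalanced_tmul_mul_smul (v : U) (m : N) :
    B.IsBalanced fun x (y : U) => (B.tmul (x * v) (y • m) : B.BalTensor N) :=
  ⟨fun _ _ _ => by rw [add_mul, B.add_tmul], fun _ _ _ => by rw [add_smul, B.tmul_add],
    fun a x y => by rw [mul_assoc, B.tgt_mul_tmul, smul_eq_mul, mul_smul]⟩

/-- The diagonal action of `U` on `U ⊗_A N`. -/
noncomputable def diag (_Y : YetterDrinfeldAlgebra B N) (u : U) : AddMonoid.End (B.BalTensor N) :=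
  AeRing.IsBalanced.lift (E := B.toAeRing)
    (f := fun v n => B.sw (B.comul u) fun x y => B.tmul (x * v) (y • n))
    ⟨fun v v' n => by simp only [mul_add, B.add_tmul, B.sw_add_fun],
      fun v n n' => by simp only [smul_add, B.tmul_add, B.sw_add_fun],
      fun a v n => by
        simp only [← mul_assoc, smul_smul]
        -- The Takeuchi condition is exactly what makes the diagonal action compatible with the
        -- relations of $U\otimes_A N$.
        refine LeftBialgebroid.sw_takeuchi (f := fun x y => B.tmul (x * v) (y • n)) ?_ a u
        exact isBalanced_tmul_mul_smul v n⟩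

theorem diag_tmul (u v : U) (n : N) :
    Y.diag u (B.tmul v n) = B.sw (B.comul u) fun x y => B.tmul (x * v) (y • n) := rfl

/-- Right multiplication on the second factor of `U ⊗_A N`. -/
noncomputable def rho (Y : YetterDrinfeldAlgebra B N) (n : N) : AddMonoid.End (B.BalTensor N) :=
  AeRing.IsBalanced.lift (E := B.toAeRing) (f := fun v m => B.tmul v (m * n))
    ⟨fun v v' n => B.add_tmul _ _ _, fun v n n' => by rw [add_mul, B.tmul_add],
      fun a v m => by rw [B.tgt_mul_tmul, Y.left_mul]⟩

theorem rho_tmul (n : N) (u : U) (m : N) : Y.rho n (B.tmul u m) = B.tmul u (m * n) := rfl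

theorem end_ext {f g : AddMonoid.End (B.BalTensor N)}
    (h : ∀ u n, f (B.tmul u n) = g (B.tmul u n)) : f = g := by
  refine DFunLike.ext f g fun z => ?_
  induction z using AeRing.induction with
  | h0 => rw [map_zero, map_zero]
  | h u n => exact h u n
  | hadd y z hy hz => rw [map_add, map_add, hy, hz]

/-- The diagonal action as a ring homomorphism. -/
noncomputable def diagHom : U →+* AddMonoid.End (B.BalTensor N) where
  toFun := Y.diag
  map_one' := end_ext fun u n => by
    rw [diag_tmul, LeftBialgebroid.sw_comul_one (isBalanced_tmul_mul_smul u n)]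
    simp
  map_mul' u u' := end_ext fun v n => by
    rw [diag_tmul, LeftBialgebroid.sw_comul_mul (isBalanced_tmul_mul_smul v n)]
    change _ = Y.diag u (Y.diag u' (B.tmul v n))
    rw [diag_tmul, B.map_sw, B.sw_comm]
    simp only [diag_tmul, mul_assoc, mul_smul]
  map_zero' := end_ext fun v n => by
    rw [diag_tmul, map_zero, (isBalanced_tmul_mul_smul v n).sw_zero]
    rfl
  map_add' u u' := end_ext fun v n => by
    rw [diag_tmul, LeftBialgebroid.sw_comul_add (isBalanced_tmul_mul_smul v n)]
    rfl

/-- The map `n ↦ (u ⊗ m ↦ u ⊗ m n)`. -/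
noncomputable def rhoHom : N →+ AddMonoid.End (B.BalTensor N) :=
  AddMonoidHom.mk' Y.rho fun n n' => end_ext fun u m => by
    rw [rho_tmul, mul_add, B.tmul_add]; rfl

/-- A representation of the smash product on a ring: a homomorphism `L` on `U` and an
antihomomorphism `T` on `N` with `L(u) T(n) = T(u₍₂₎ n) L(u₍₁₎)`. -/
structure SmashRep (Y : YetterDrinfeldAlgebra B N) (R : Type*) [Ring R] where
  L : U →+* R
  T : N →+ R
  T_one : T 1 = 1
  T_mul : ∀ n n', T (n * n') = T n' * T n
  T_s_smul : ∀ a n, T (B.s a • n) = T n * L (B.tgt a)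
  L_mul_T : ∀ u n, L u * T n = B.sw (B.comul u) fun x y => T (y • n) * L x

theorem SmashRep.isBalanced {R : Type*} [Ring R] (S : Y.SmashRep R) :
    B.IsBalanced fun u n => S.T n * S.L u :=
  ⟨fun _ _ _ => by rw [map_add, mul_add], fun _ _ _ => by rw [map_add, add_mul],
    fun _ _ _ => by rw [S.T_s_smul, map_mul, mul_assoc]⟩

/-- The regular representation. -/
noncomputable def regularRep : Y.SmashRep (AddMonoid.End (B.BalTensor N)) where
  L := Y.diagHom
  T := Y.rhoHom
  T_one := end_ext fun u n => by
    change B.tmul u (n * 1) = B.tmul u n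
    rw [mul_one]
  T_mul n n' := end_ext fun u m => by
    change B.tmul u (m * (n * n')) = B.tmul u (m * n * n')
    rw [mul_assoc]
  T_s_smul a n := end_ext fun u m => by
    change B.tmul u (m * (B.s a • n)) = Y.rho n (Y.diag (B.tgt a) (B.tmul u m))
    rw [diag_tmul, LeftBialgebroid.sw_comul_tgt (isBalanced_tmul_mul_smul u m), rho_tmul, one_mul,
      Y.balanced]
  L_mul_T u n := end_ext fun v m => by
    have h3 : B.IsBalanced₃ fun x₁ x₂ (y : U) => B.tmul (x₁ * v) ((x₂ • m) * (y • n)) :=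
      ⟨fun _ _ _ _ => by rw [add_mul, B.add_tmul],
        fun _ _ _ _ => by rw [add_smul, add_mul, B.tmul_add],
        fun _ _ _ _ => by rw [add_smul, mul_add, B.tmul_add],
        fun b u v x => by rw [mul_assoc, B.tgt_mul_tmul, Y.left_mul, mul_smul],
        fun b u v x => by rw [mul_smul (B.tgt b), ← Y.balanced, smul_eq_mul, mul_smul]⟩
    have h : ∀ f : U → U → AddMonoid.End (B.BalTensor N),
        (B.sw (B.comul u) f) (B.tmul v m) = B.sw (B.comul u) fun x y => f x y (B.tmul v m) :=
      fun f => B.map_sw (AddMonoidHom.eval (B.tmul v m)) _ f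
    rw [h]
    change Y.diag u (Y.rho n (B.tmul v m)) =
      B.sw (B.comul u) fun x y => Y.rho (y • n) (Y.diag x (B.tmul v m))
    simp only [diag_tmul, rho_tmul, B.map_sw]
    rw [LeftBialgebroid.sw_coassoc h3]
    simp only [Y.smul_mul_eq_sw]
    congr! 2 with x y
    funext y
    exact B.map_sw (AddMonoidHom.mk' (B.tmul (x * v)) fun _ _ => B.tmul_add _ _ _) _ _

/-- The smash product `U ⊗_A N`, with `(u ⊗ n)(u' ⊗ n') = u₍₁₎ u' ⊗ (u₍₂₎ n') n`. -/
def Smash (_Y : YetterDrinfeldAlgebra B N) : Type _ := B.BalTensor N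

namespace Smash

noncomputable instance : AddCommGroup Y.Smash := inferInstanceAs (AddCommGroup (B.BalTensor N))

/-- The tensors as elements of the smash product. -/
def mk : B.BalTensor N ≃+ Y.Smash := AddEquiv.refl _

variable {Y}

/-- The additive map induced by a representation. -/
noncomputable def toAddHom {R : Type*} [Ring R] (S : Y.SmashRep R) : Y.Smash →+ R :=
  S.isBalanced.lift

theorem toAddHom_mk {R : Type*} [Ring R] (S : Y.SmashRep R) (u : U) (n : N) :
    toAddHom S (mk Y (B.tmul u n)) = S.T n * S.L u := rfl

noncomputable instance : Mul Y.Smash := ⟨fun w w' => mk Y (toAddHom Y.regularRep w w')⟩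

@[elab_as_elim]
theorem ind {P : Y.Smash → Prop} (w : Y.Smash) (h0 : P 0)
    (h : ∀ u n, P (mk Y (B.tmul u n))) (hadd : ∀ y z, P y → P z → P (y + z)) : P w :=
  B.induction (P := fun z => P (mk Y z)) ((mk Y).symm w) h0 h hadd

theorem mk_mul_mk (u v : U) (n m : N) :
    mk Y (B.tmul u n) * mk Y (B.tmul v m) =
      mk Y (B.sw (B.comul u) fun x y => B.tmul (x * v) ((y • m) * n)) := by
  change mk Y (Y.rho n (Y.diag u (B.tmul v m))) = _
  simp only [diag_tmul, rho_tmul, B.map_sw (Y.rho n)]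

theorem add_mul' (w w' z : Y.Smash) : (w + w') * z = w * z + w' * z := by
  change mk Y (toAddHom Y.regularRep (w + w') z) = _
  rw [map_add]
  rfl

theorem mul_add' (w z z' : Y.Smash) : w * (z + z') = w * z + w * z' :=
  map_add (toAddHom Y.regularRep w) z z'

theorem zero_mul' (z : Y.Smash) : 0 * z = 0 := by
  change mk Y (toAddHom Y.regularRep 0 z) = _
  rw [map_zero]
  rfl

theorem mul_zero' (z : Y.Smash) : z * 0 = 0 :=
  map_zero (toAddHom Y.regularRep z)

/-- Associativity of the smash product is not yet available and comes out of this. A representation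
is multiplicative on elementary tensors by the exchange rule `L_mul_T`, and for the regular
representation multiplicativity is the associative law. -/
theorem toAddHom_mul {R : Type*} [Ring R] (S : Y.SmashRep R) (w w' : Y.Smash) :
    toAddHom S (w * w') = toAddHom S w * toAddHom S w' := by
  refine ind w ?_ (fun u n => ?_) fun y z hy hz => ?_
  · rw [zero_mul', map_zero, zero_mul]
  · refine ind w' ?_ (fun v m => ?_) fun y z hy hz => ?_
    · rw [mul_zero', map_zero, mul_zero]
    · rw [mk_mul_mk, B.map_sw (mk Y), B.map_sw (toAddHom S)]
      simp only [toAddHom_mk, S.T_mul, map_mul]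
      rw [mul_assoc, ← mul_assoc (S.L u), S.L_mul_T, B.sw_mul, B.mul_sw]
      simp only [mul_assoc]
    · rw [mul_add', map_add, hy, hz, map_add, mul_add]
  · rw [add_mul', map_add, hy, hz, map_add, add_mul]

noncomputable instance : One Y.Smash := ⟨mk Y (B.tmul 1 1)⟩

theorem one_def : (1 : Y.Smash) = mk Y (B.tmul 1 1) := rfl

noncomputable instance : Ring Y.Smash :=
  { (inferInstance : AddCommGroup Y.Smash) with
    mul := (· * ·)
    one := 1
    left_distrib := mul_add'
    right_distrib := add_mul'
    zero_mul := zero_mul'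
    mul_zero := mul_zero'
    mul_assoc := fun w w' z => by
      change mk Y (toAddHom Y.regularRep (w * w') z) = _
      rw [toAddHom_mul]
      rfl
    one_mul := fun w => by
      refine ind w (mul_zero' _) (fun u n => ?_) fun y z hy hz => ?_
      · rw [one_def, mk_mul_mk]
        have : B.IsBalanced fun x (y : U) => B.tmul (x * u) ((y • n) * (1 : N)) := by
          simpa using isBalanced_tmul_mul_smul u n
        rw [LeftBialgebroid.sw_comul_one this]
        simp
      · rw [mul_add', hy, hz]
    mul_one := fun w => by
      refine ind w (zero_mul' _) (fun u n => ?_) fun y z hy hz => ?_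
      · rw [one_def, mk_mul_mk]
        congr 1
        have : ∀ x y : U, (B.tmul (x * 1) ((y • (1 : N)) * n) : B.BalTensor N) =
            B.tmul (B.tgt (B.counit y) * x) n := by
          intro x y
          rw [mul_one, Y.smul_one, ← Y.left_mul, one_mul, B.tgt_mul_tmul]
        simp only [this]
        rw [← B.map_sw_of_add (fun v => (B.tmul v n : B.BalTensor N))
          (fun _ _ => B.add_tmul _ _ _) _ fun x y => B.tgt (B.counit y) * x, B.sw_counit_right]
      · rw [add_mul', hy, hz] }

/-- The ring homomorphism induced by a representation. -/
noncomputable def lift {R : Type*} [Ring R] (S : Y.SmashRep R) : Y.Smash →+* R where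
  toFun := toAddHom S
  map_one' := by rw [one_def, toAddHom_mk, S.T_one, map_one, one_mul]
  map_mul' := toAddHom_mul S
  map_zero' := map_zero _
  map_add' := map_add _

end Smash

end YetterDrinfeldAlgebra

/-! ### Inclusion, source and target of the smash product, and its action on `N`. -/

namespace YetterDrinfeldAlgebra

section

variable {k A U : Type*} [CommRing k] [Ring A] [Algebra k A] [Ring U] [Algebra k U]
  {B : LeftBialgebroid k A U} {N : Type*} [Ring N] [Algebra k N] [Module U N]
  [IsScalarTower k U N] (Y : YetterDrinfeldAlgebra B N) {M : Type*} [AddCommGroup M]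

theorem tgt_smul_one (Y : YetterDrinfeldAlgebra B N) (a : A) :
    B.tgt a • (1 : N) = B.s a • (1 : N) := by
  rw [Y.smul_one, B.counit_tgt]

namespace Smash

/-- The inclusion `u ↦ u ⊗ 1`. -/
noncomputable def incl : U →+* Y.Smash where
  toFun u := mk Y (B.tmul u 1)
  map_one' := rfl
  map_zero' := by rw [B.zero_tmul]; rfl
  map_add' u v := by rw [B.add_tmul]; rfl
  map_mul' u v := by
    have : ∀ x y : U, (B.tmul (x * v) ((y • (1 : N)) * 1) : B.BalTensor N) =
        B.tmul (B.tgt (B.counit y) * x * v) 1 := by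
      intro x y
      rw [mul_one, Y.smul_one, mul_assoc, B.tgt_mul_tmul]
    rw [mk_mul_mk]
    simp only [this]
    rw [← B.map_sw_of_add (fun z => (B.tmul (z * v) (1 : N)))
      (fun _ _ => by rw [add_mul, B.add_tmul]) _ fun x y => B.tgt (B.counit y) * x,
      B.sw_counit_right]

/-- The target map `n ↦ 1 ⊗ n`. -/
noncomputable def target : N →+ Y.Smash :=
  AddMonoidHom.mk' (fun n => mk Y (B.tmul 1 n)) fun n n' => by rw [B.tmul_add]; rfl

/-- The source map, that is, the coaction. -/
noncomputable def source : N →+ Y.Smash :=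
  AddMonoidHom.mk' (fun n => mk Y (Y.coact n)) fun n n' => by rw [map_add]; rfl

local notation "ι" => incl Y
local notation "τ" => target Y
local notation "σ" => source Y

theorem target_mul_mk (n : N) (u : U) (m : N) :
    τ n * mk Y (B.tmul u m) = mk Y (B.tmul u (m * n)) := by
  have : B.IsBalanced fun x (y : U) => B.tmul (x * u) ((y • m) * n) := by
    refine ⟨fun _ _ _ => by rw [add_mul, B.add_tmul], fun _ _ _ => by
      rw [add_smul, add_mul, B.tmul_add], fun a x y => by
      rw [mul_assoc, B.tgt_mul_tmul, smul_eq_mul, mul_smul, Y.left_mul]⟩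
  refine (mk_mul_mk 1 u n m).trans ?_
  rw [LeftBialgebroid.sw_comul_one this, one_mul, one_smul]

theorem mk_tmul (u : U) (n : N) : mk Y (B.tmul u n) = τ n * ι u := by
  refine ((target_mul_mk Y n u 1).trans ?_).symm
  rw [one_mul]

theorem target_one : τ 1 = 1 := rfl

theorem target_mul (n n' : N) : τ (n * n') = τ n' * τ n := (target_mul_mk Y n' 1 n).symm

theorem target_s_smul (a : A) (n : N) : τ (B.s a • n) = τ n * ι (B.tgt a) := by
  rw [← mk_tmul, ← mul_one (B.tgt a), B.tgt_mul_tmul]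
  rfl

/-- The target of the smash product extends that of $U$ along $a\mapsto a\rhd 1_N$. Hence balancing
over $N^{op}$ restricts to balancing over $A^{op}$. -/
theorem target_s_one (a : A) : τ (B.s a • (1 : N)) = ι (B.tgt a) := by
  rw [target_s_smul, target_one, one_mul]

theorem incl_mul_target (u : U) (n : N) :
    ι u * τ n = B.sw (B.comul u) fun x y => τ (y • n) * ι x := by
  refine (mk_mul_mk u 1 1 n).trans ?_
  rw [B.map_sw (mk Y)]
  simp only [mul_one, mk_tmul]

theorem source_one : σ 1 = 1 := by
  change mk Y (Y.coact 1) = _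
  rw [Y.coact_one]
  rfl

theorem isBalanced_target_mul_incl : B.IsBalanced fun c d => τ d * ι c :=
  ⟨fun _ _ _ => by rw [map_add, mul_add], fun _ _ _ => by rw [map_add, add_mul],
    fun _ _ _ => by rw [target_s_smul, map_mul, mul_assoc]⟩

theorem mk_eq_sw (z : B.BalTensor N) : mk Y z = B.sw z fun c d => τ d * ι c := by
  conv_lhs => rw [← B.sw_tmul_eq z, B.map_sw (mk Y)]
  simp only [mk_tmul]

theorem source_eq_sw (n : N) : σ n = B.sw (Y.coact n) fun c d => τ d * ι c := mk_eq_sw Y _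

theorem source_s_smul (a : A) (n : N) : σ (B.s a • n) = ι (B.s a) * σ n := by
  rw [source_eq_sw, Y.sw_coact_s_smul (isBalanced_target_mul_incl Y), source_eq_sw, B.mul_sw]
  have hc : ∀ m : N, ι (B.s a) * τ m = τ m * ι (B.s a) := by
    intro m
    have hb : B.IsBalanced fun x (y : U) => τ (y • m) * ι x :=
      ⟨fun _ _ _ => by rw [map_add, mul_add], fun _ _ _ => by rw [add_smul, map_add, add_mul],
        fun _ _ _ => by rw [smul_eq_mul, mul_smul, target_s_smul, map_mul, mul_assoc]⟩
    rw [incl_mul_target, LeftBialgebroid.sw_comul_s hb, one_smul]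
  simp only [map_mul, ← mul_assoc, hc]

theorem source_s_one (a : A) : σ (B.s a • (1 : N)) = ι (B.s a) := by
  rw [source_s_smul, source_one, mul_one]

theorem source_tgt_smul (a : A) (n : N) : σ (B.tgt a • n) = σ n * ι (B.s a) := by
  rw [source_eq_sw, Y.sw_coact_tgt_smul (isBalanced_target_mul_incl Y), source_eq_sw, B.sw_mul]
  simp only [map_mul, ← mul_assoc]

/-- This is the Yetter–Drinfel'd condition, transported along $u\otimes n\mapsto\tau(n)\iota(u)$. -/
theorem incl_mul_source (u : U) (n : N) :
    ι u * σ n = B.sw (B.comul u) fun x y => σ (x • n) * ι y := by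
  have h := Y.sw_yetter_drinfeld (isBalanced_target_mul_incl Y) u n
  simp only [source_eq_sw, B.sw_mul, B.mul_sw, mul_assoc, ← map_mul]
  rw [h, B.sw_comm]
  congr! 2 with c d
  funext d
  rw [← mul_assoc, incl_mul_target, B.sw_mul]
  simp only [map_mul, mul_assoc]

theorem isBalanced₃_target (m : N) : B.IsBalanced₃ fun x y d => τ ((y • m) * d) * ι x :=
  ⟨fun _ _ _ _ => by rw [map_add, mul_add],
    fun _ _ _ _ => by rw [add_smul, add_mul, map_add, add_mul],
    fun _ _ _ _ => by rw [mul_add, map_add, add_mul],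
    fun a _ _ _ => by rw [mul_smul, ← Y.left_mul, target_s_smul, map_mul (incl Y), mul_assoc],
    fun a _ _ _ => by rw [mul_smul, ← Y.balanced]⟩

section Braided

variable [hY : Fact Y.IsBraidedCommutative]

/-- Moving $\tau(m)$ to the left past $\iota(n_{(-1)})$ and using coassociativity gives the sum of
the $\tau\big((n_{(-1)}m)n_{(0)}\big)\iota(n_{(-2)})$. Braided commutativity contracts the inner
product to $n_{(0)}m$ with the legs renumbered, and $\tau$ reverses it. -/
theorem source_mul_target (n m : N) : σ n * τ m = τ m * σ n := by
  have e : ∀ c (d : N), τ d * ι c * τ m = B.sw (B.comul c) fun x y => τ ((y • m) * d) * ι x := by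
    intro c d
    rw [mul_assoc, incl_mul_target, B.mul_sw]
    simp only [target_mul, mul_assoc]
  rw [source_eq_sw, B.sw_mul, B.mul_sw]
  simp only [e]
  rw [Y.sw_coassoc (isBalanced₃_target Y m)]
  congr! 2 with c d
  funext d
  rw [← mul_assoc, ← target_mul, hY.out.mul_eq_sw d m, B.map_sw, B.sw_mul]

/-- The argument is that of `source_mul_target`, applied to the product of
$\tau(n_{(0)})\iota(n_{(-1)})$ and $\tau(n'_{(0)})\iota(n'_{(-1)})$; the result is the coaction of
$nn'$ because $N$ is a comodule algebra. -/
theorem source_mul (n n' : N) : σ (n * n') = σ n * σ n' := by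
  have e : ∀ c (d : N), τ d * ι c * σ n' = B.sw (B.comul c) fun x y =>
      B.sw (Y.coact n') fun c' d' => τ ((y • d') * d) * ι x * ι c' := by
    intro c d
    rw [source_eq_sw, B.mul_sw, B.sw_comm]
    congr! 2 with c' d'
    funext d'
    rw [mul_assoc, ← mul_assoc (ι c), incl_mul_target, B.sw_mul, B.mul_sw]
    simp only [target_mul, mul_assoc]
  have hb : B.IsBalanced₃ fun x y d =>
      B.sw (Y.coact n') fun c' d' => τ ((y • d') * d) * ι x * ι c' := by
    have := fun m => isBalanced₃_target Y m
    refine ⟨?_, ?_, ?_, ?_, ?_⟩ <;> intros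
    · simp only [(this _).add_fst, add_mul, B.sw_add_fun]
    · simp only [(this _).add_snd, add_mul, B.sw_add_fun]
    · simp only [(this _).add_trd, add_mul, B.sw_add_fun]
    · simp only [(this _).tgt_fst]
    · simp only [(this _).tgt_snd]
  rw [source_eq_sw, Y.sw_coact_mul (isBalanced_target_mul_incl Y), source_eq_sw, B.sw_mul]
  simp only [e]
  rw [Y.sw_coassoc hb]
  congr! 2 with c d
  funext d
  rw [B.sw_comm]
  congr! 2 with c' d'
  funext d'
  rw [hY.out.mul_eq_sw d d', B.map_sw, B.sw_mul, map_mul]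
  simp only [mul_assoc]

end Braided

/-- The representation of the smash product on `N`. -/
noncomputable def rep : Y.SmashRep (AddMonoid.End N) where
  L := Module.toAddMonoidEnd U N
  T := AddMonoidHom.mk' (fun n => (AddMonoidHom.mulRight n : N →+ N)) fun n n' =>
    AddMonoidHom.ext fun m => mul_add m n n'
  T_one := DFunLike.ext (F := N →+ N) _ _ fun m => mul_one m
  T_mul n n' := DFunLike.ext (F := N →+ N) _ _ fun m => (mul_assoc m n n').symm
  T_s_smul a n := DFunLike.ext (F := N →+ N) _ _ fun m => Y.balanced a m n
  L_mul_T u n := by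
    refine DFunLike.ext (F := N →+ N) _ _ fun m => ?_
    have h := B.map_sw_of_add (fun f : AddMonoid.End N => f m) (fun _ _ => rfl) (B.comul u)
      fun x y => @HMul.hMul (AddMonoid.End N) _ _ _ (AddMonoidHom.mulRight (y • n))
        (Module.toAddMonoidEnd U N x)
    exact (Y.smul_mul_eq_sw u m n).trans h.symm

noncomputable instance : Module Y.Smash N := Module.compHom N (lift (rep Y))

theorem incl_smul (u : U) (n : N) : ι u • n = u • n := mul_one (u • n)

theorem target_smul (n m : N) : τ n • m = m * n := by
  change ((1 : U) • m) * n = m * n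
  rw [one_smul]

/-- Braided commutativity again: acting by the coaction of $n$ produces $(n_{(-1)}m)n_{(0)}$. -/
theorem source_smul [hY : Fact Y.IsBraidedCommutative] (n m : N) : σ n • m = n * m := by
  rw [source_eq_sw, B.sw_smul, hY.out.mul_eq_sw]
  simp only [mul_smul, incl_smul, target_smul]

theorem mk_ind {P : Y.Smash → Prop} (w : Y.Smash) (h0 : P 0)
    (h : ∀ u n, P (τ n * ι u)) (hadd : ∀ y z, P y → P z → P (y + z)) : P w :=
  ind w h0 (fun u n => by rw [mk_tmul]; exact h u n) hadd

end Smash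

end

end YetterDrinfeldAlgebra

/-! ### Multiadditive balanced functions of sequences -/

/-- Functions of the first `p` entries of a sequence in a ring that are additive in each of them,
balanced with respect to the elements `t i`, and compatible with an action of these elements. -/
structure IsMulti {I R X : Type*} [Ring R] [AddCommGroup X] (t : I → R) (act : I → X → X) (p : ℕ)
    (F : (ℕ → R) → X) : Prop where
  congr : ∀ w w', (∀ i < p, w i = w' i) → F w = F w'
  add : ∀ w i x y, i < p →
    F (Function.update w i (x + y)) = F (Function.update w i x) + F (Function.update w i y)
  bal : ∀ w i n, i + 1 < p →
    F (Function.update w i (w i * t n)) = F (Function.update w (i + 1) (t n * w (i + 1)))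
  lin : ∀ w n, 0 < p → F (Function.update w 0 (t n * w 0)) = act n (F w)

/-- The sequence with first entry `x` and remaining entries `u`. -/
def seqCons {R : Type*} (x : R) (u : ℕ → R) : ℕ → R
  | 0 => x
  | n + 1 => u n

theorem seqCons_update {R : Type*} (x y : R) (u : ℕ → R) (i : ℕ) :
    seqCons x (Function.update u i y) = Function.update (seqCons x u) (i + 1) y := by
  funext l
  cases l <;> simp [seqCons, Function.update_apply]

theorem update_seqCons_zero {R : Type*} (x y : R) (u : ℕ → R) :
    Function.update (seqCons x u) 0 y = seqCons y u := by
  funext l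
  cases l <;> simp [seqCons]

theorem seqCons_head_tail {R : Type*} (u : ℕ → R) : seqCons (u 0) (fun i => u (i + 1)) = u := by
  funext l
  cases l <;> rfl

namespace IsMulti

variable {I R X : Type*} [Ring R] [AddCommGroup X] {t : I → R} {act : I → X → X} {p : ℕ}
  {F G : (ℕ → R) → X}

theorem zero_slot (hF : IsMulti t act p F) (w : ℕ → R) (i : ℕ) (hi : i < p) :
    F (Function.update w i 0) = 0 := by
  have := hF.add w i 0 0 hi
  simpa using this

theorem sub (hact : ∀ i x y, act i (x - y) = act i x - act i y) (hF : IsMulti t act p F)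
    (hG : IsMulti t act p G) : IsMulti t act p fun w => F w - G w where
  congr w w' h := by rw [hF.congr w w' h, hG.congr w w' h]
  add w i x y hi := by rw [hF.add w i x y hi, hG.add w i x y hi]; abel
  bal w i n hi := by rw [hF.bal w i n hi, hG.bal w i n hi]
  lin w n hp := by rw [hF.lin w n hp, hG.lin w n hp, hact]

theorem add_fun (hact : ∀ i x y, act i (x + y) = act i x + act i y) (hF : IsMulti t act p F)
    (hG : IsMulti t act p G) : IsMulti t act p fun w => F w + G w where
  congr w w' h := by rw [hF.congr w w' h, hG.congr w w' h]
  add w i x y hi := by rw [hF.add w i x y hi, hG.add w i x y hi]; abel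
  bal w i n hi := by rw [hF.bal w i n hi, hG.bal w i n hi]
  lin w n hp := by rw [hF.lin w n hp, hG.lin w n hp, hact]

theorem map {X' : Type*} [AddCommGroup X'] {act' : I → X' → X'} (g : X → X')
    (hg : ∀ x y, g (x + y) = g x + g y)
    (hact : ∀ i x, g (act i x) = act' i (g x)) (hF : IsMulti t act p F) :
    IsMulti t act' p fun w => g (F w) where
  congr w w' h := by rw [hF.congr w w' h]
  add w i x y hi := by rw [hF.add w i x y hi, hg]
  bal w i n hi := by rw [hF.bal w i n hi]
  lin w n hp := by rw [hF.lin w n hp, hact]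

theorem finset_sum {κ : Type*} (hact : ∀ i x y, act i (x + y) = act i x + act i y)
    (S : Finset κ) {H : κ → (ℕ → R) → X} (hH : ∀ l, IsMulti t act p (H l)) :
    IsMulti t act p fun w => ∑ l ∈ S, H l w where
  congr w w' h := Finset.sum_congr rfl fun l _ => (hH l).congr w w' h
  add w i x y hi := by simp only [(hH _).add w i x y hi, Finset.sum_add_distrib]
  bal w i n hi := Finset.sum_congr rfl fun l _ => (hH l).bal w i n hi
  lin w n hp := by
    simp only [(hH _).lin w n hp]
    exact (map_sum (AddMonoidHom.mk' (act n) (hact n)) _ _).symm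

/-- Fixing the last entry. -/
theorem contr (hF : IsMulti t act (p + 1) F) (x : R) :
    IsMulti t act p fun w => F (Function.update w p x) where
  congr w w' h := by
    refine hF.congr _ _ fun i hi => ?_
    rcases Nat.lt_succ_iff_lt_or_eq.1 hi with hi | rfl
    · simp [Function.update_of_ne hi.ne, h i hi]
    · simp
  add w i x y hi := by
    simp only [Function.update_comm hi.ne _ _ w]
    exact hF.add _ _ _ _ (by omega)
  bal w i n hi := by
    have h := hF.bal (Function.update w p x) i n (by omega)
    rwa [Function.update_of_ne (by omega), Function.update_of_ne (by omega),
      Function.update_comm (show p ≠ i by omega),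
      Function.update_comm (show p ≠ i + 1 by omega)] at h
  lin w n hp := by
    have h := hF.lin (Function.update w p x) n (by omega)
    rwa [Function.update_of_ne (by omega), Function.update_comm (by omega)] at h

/-- Right multiplication in the last entry. -/
theorem mulLast (hF : IsMulti t act (p + 1) F) (c : R) :
    IsMulti t act (p + 1) fun w => F (Function.update w p (w p * c)) where
  congr w w' h := by
    refine hF.congr _ _ fun i hi => ?_
    rcases Nat.lt_succ_iff_lt_or_eq.1 hi with hi' | rfl
    · simp [Function.update_of_ne hi'.ne, h i hi]
    · simp [h i hi]
  add w i x y hi := by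
    rcases Nat.lt_succ_iff_lt_or_eq.1 hi with hi' | rfl
    · simp only [Function.update_of_ne hi'.ne', Function.update_comm hi'.ne _ _ w]
      exact hF.add _ _ _ _ hi
    · simp only [Function.update_self, Function.update_idem, add_mul]
      exact hF.add _ _ _ _ hi
  bal w i n hi := by
    rcases Nat.lt_succ_iff_lt_or_eq.1 hi with hi' | hi'
    · have h := hF.bal (Function.update w p (w p * c)) i n hi
      rw [Function.update_of_ne (by omega), Function.update_of_ne (by omega),
        Function.update_comm (show p ≠ i by omega),
      Function.update_comm (show p ≠ i + 1 by omega)] at h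
      rwa [Function.update_of_ne (by omega), Function.update_of_ne (by omega)]
    · subst hi'
      have h := hF.bal (Function.update w (i + 1) (w (i + 1) * c)) i n hi
      rw [Function.update_of_ne (by omega), Function.update_comm (by omega)] at h
      rw [Function.update_of_ne (by omega)]
      simpa [mul_assoc] using h
  lin w n hp := by
    rcases Nat.eq_zero_or_pos p with rfl | h0
    · have h := hF.lin (Function.update w 0 (w 0 * c)) n hp
      simpa [mul_assoc] using h
    · have h := hF.lin (Function.update w p (w p * c)) n (by omega)
      rw [Function.update_of_ne (by omega), Function.update_comm (by omega)] at h
      rwa [Function.update_of_ne (by omega)]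

end IsMulti

/-! ### Restriction of cochains from the smash product to `U`, and their unique extension. -/

namespace YetterDrinfeldAlgebra

open Smash

variable {k : Type w} {A U N : Type v} [CommRing k] [Ring A] [Algebra k A] [Ring U] [Algebra k U]
  {B : LeftBialgebroid k A U} [Ring N] [Algebra k N] [Module U N]
  [IsScalarTower k U N] (Y : YetterDrinfeldAlgebra B N)

local notation "ι" => incl Y
local notation "τ" => target Y
local notation "σ" => source Y

section

variable {X : Type*} [AddCommGroup X] [Module Y.Smash X] {p : ℕ}

/-- Cochains on the smash product. -/
abbrev IsSmashCochain (p : ℕ) (F : (ℕ → Y.Smash) → X) : Prop :=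
  IsMulti τ (fun n x => τ n • x) p F

/-- Cochains on `U` with values in a module over the smash product. -/
abbrev IsBaseCochain (p : ℕ) (F : (ℕ → U) → X) : Prop :=
  IsMulti B.tgt (fun a x => ι (B.tgt a) • x) p F

variable {Y}

theorem IsSmashCochain.restrict {F : (ℕ → Y.Smash) → X} (hF : Y.IsSmashCochain p F) :
    Y.IsBaseCochain p fun u => F fun i => ι (u i) := by
  have e : ∀ (u : ℕ → U) i x, (fun l => ι (Function.update u i x l)) =
      Function.update (fun l => ι (u l)) i (ι x) := fun u i x =>
    Function.comp_update _ _ _ _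
  refine ⟨fun w w' h => hF.congr _ _ fun i hi => by rw [h i hi], fun w i x y hi => ?_,
    fun w i n hi => ?_, fun w n hp => ?_⟩
  · simp only [e, map_add]
    exact hF.add _ _ _ _ hi
  · simp only [e, map_mul, ← target_s_one]
    exact hF.bal (fun l => ι (w l)) i _ hi
  · simp only [e, map_mul, ← target_s_one]
    exact hF.lin (fun l => ι (w l)) _ hp

/-- The smash product is spanned by products $\tau(n)\iota(u)$. A factor $\tau(n)$ passes by
balancing to the preceding argument, as a right factor, and leaves the first argument by linearity.
In the induction `r` counts the leading arguments that are still arbitrary. -/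
theorem IsSmashCochain.eq_zero {F : (ℕ → Y.Smash) → X} (hF : Y.IsSmashCochain p F)
    (h : ∀ u : ℕ → U, F (fun i => ι (u i)) = 0) (w : ℕ → Y.Smash) : F w = 0 := by
  have key : ∀ r, r ≤ p → ∀ w : ℕ → Y.Smash, (∀ i, r ≤ i → ∃ u, w i = ι u) → F w = 0 := by
    intro r
    induction r with
    | zero =>
      intro _ w hw
      choose u hu using fun i => hw i (Nat.zero_le i)
      obtain rfl : w = fun i => ι (u i) := funext hu
      exact h u
    | succ r ih =>
      intro hr w hw
      suffices ∀ v, F (Function.update w r v) = 0 by simpa using this (w r)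
      intro v
      induction v using mk_ind with
      | h0 => exact hF.zero_slot w r hr
      | hadd y z hy hz => rw [hF.add _ _ _ _ hr, hy, hz, add_zero]
      | h u n =>
        have hw' : ∀ i, r ≤ i → ∃ u', Function.update w r (ι u) i = ι u' := by
          intro i hi
          rcases hi.eq_or_lt with rfl | hi
          · exact ⟨u, by simp⟩
          · obtain ⟨u', hu'⟩ := hw i hi
            exact ⟨u', by rw [Function.update_of_ne hi.ne', hu']⟩
        cases r with
        | zero =>
          have := hF.lin (Function.update w 0 (ι u)) n hr
          simp only [Function.update_self, Function.update_idem] at this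
          rw [this, ih (by omega) _ hw', smul_zero]
        | succ r =>
          have := hF.bal (Function.update w (r + 1) (ι u)) r n hr
          simp only [Function.update_self, Function.update_idem] at this
          rw [← this]
          refine ih (by omega) _ fun i hi => ?_
          rw [Function.update_of_ne (by omega)]
          exact hw' i hi
  -- Entries from `p` on have no influence, so they may be put into the image of $\iota$.
  rw [hF.congr w (fun i => if i < p then w i else ι 0) fun i hi => by simp [hi]]
  exact key p le_rfl _ fun i hi => ⟨0, if_neg (by omega)⟩

theorem IsSmashCochain.ext {F G : (ℕ → Y.Smash) → X} (hF : Y.IsSmashCochain p F)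
    (hG : Y.IsSmashCochain p G)
    (h : ∀ u : ℕ → U, F (fun i => ι (u i)) = G (fun i => ι (u i))) : F = G := by
  funext w
  rw [← sub_eq_zero]
  exact IsSmashCochain.eq_zero (hF.sub (fun _ _ _ => smul_sub _ _ _) hG)
    (fun u => sub_eq_zero.2 (h u)) w

variable (Y X) in
/-- The maps `f : U ⊗_A N → X` with `f(τ(n) w) = τ(n) f(w)`. -/
def sharpSubgroup : AddSubgroup (Y.Smash →+ X) where
  carrier := {f | ∀ n w, f (τ n * w) = τ n • f w}
  add_mem' hf hg n w := by simp [hf n w, hg n w]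
  zero_mem' n w := by simp
  neg_mem' hf n w := by simp [hf n w]

variable (Y X) in
/-- The coinduced module of the maps `f : U ⊗_A N → X` with `f(τ(n) w) = τ(n) f(w)`. -/
abbrev Sharp : Type _ := Y.sharpSubgroup X

noncomputable instance : Module Y.Smash (Y.Sharp X) where
  smul w f := ⟨f.1.comp (AddMonoidHom.mulRight w), fun n w' => by
    change f.1 (τ n * w' * w) = τ n • f.1 (w' * w)
    rw [mul_assoc, f.2]⟩
  one_smul f := Subtype.ext (AddMonoidHom.ext fun w => congrArg f.1 (mul_one w))
  mul_smul w w' f := Subtype.ext (AddMonoidHom.ext fun z => congrArg f.1 (mul_assoc z w w').symm)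
  smul_zero w := rfl
  smul_add w f g := rfl
  add_smul w w' f := Subtype.ext (AddMonoidHom.ext fun z =>
    (congrArg f.1 (mul_add z w w')).trans (map_add f.1 _ _))
  zero_smul f := Subtype.ext (AddMonoidHom.ext fun z =>
    (congrArg f.1 (mul_zero z)).trans (map_zero f.1))

theorem Sharp.smul_apply (f : Y.Sharp X) (w z : Y.Smash) : (w • f).1 z = f.1 (z * w) := rfl

theorem Sharp.ext_incl {f g : Y.Sharp X} (h : ∀ u, f.1 (ι u) = g.1 (ι u)) : f = g := by
  refine Subtype.ext (AddMonoidHom.ext fun w => ?_)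
  induction w using mk_ind with
  | h0 => rw [map_zero, map_zero]
  | h u n => rw [f.2, g.2, h]
  | hadd y z hy hz => rw [map_add, map_add, hy, hz]

variable (Y) in
/-- The extension of a map on `U` to the smash product. -/
noncomputable def Sharp.ofBase (f : U →+ X) (hf : ∀ a u, f (B.tgt a * u) = ι (B.tgt a) • f u) :
    Y.Sharp X :=
  have hb : B.IsBalanced fun u n => τ n • f u :=
    ⟨fun _ _ _ => by rw [map_add, smul_add], fun _ _ _ => by rw [map_add, add_smul],
      fun _ _ _ => by rw [hf, target_s_smul, mul_smul]⟩
  ⟨hb.lift.comp (Smash.mk Y).symm.toAddMonoidHom, fun n w => by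
    induction w using Smash.ind with
    | h0 => simp
    | h u m =>
      rw [target_mul_mk]
      change τ (m * n) • f u = τ n • τ m • f u
      rw [target_mul, mul_smul]
    | hadd y z hy hz => rw [mul_add, map_add, map_add, hy, hz, smul_add]⟩

theorem Sharp.ofBase_incl (f : U →+ X) (hf) (u : U) : (Sharp.ofBase Y f hf).1 (ι u) = f u := by
  change τ 1 • f u = f u
  rw [target_one, one_smul]

end

variable {Y}

/-- By Hom–tensor adjunction, separating the first argument makes a $(p+1)$-cochain into a
$p$-cochain with values in the coinduced module `Sharp X`; balancing between the first two arguments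
becomes linearity. The coefficients therefore have to vary in the induction. -/
theorem exists_extension (p : ℕ) {X : Type v} [AddCommGroup X] [Module Y.Smash X]
    (φ : (ℕ → U) → X) (hφ : Y.IsBaseCochain p φ) :
    ∃ F : (ℕ → Y.Smash) → X, Y.IsSmashCochain p F ∧ ∀ u : ℕ → U, F (fun i => ι (u i)) = φ u := by
  induction p generalizing X with
  | zero =>
    exact ⟨fun _ => φ 0, ⟨fun _ _ _ => rfl, fun _ _ _ _ h => (Nat.not_lt_zero _ h).elim,
      fun _ _ _ h => (Nat.not_lt_zero _ h).elim, fun _ _ h => (Nat.not_lt_zero _ h).elim⟩,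
      fun u => hφ.congr _ _ fun _ h => (Nat.not_lt_zero _ h).elim⟩
  | succ p ih =>
    let Φ : (ℕ → U) → Y.Sharp X := fun u => Sharp.ofBase Y
      (AddMonoidHom.mk' (fun x => φ (seqCons x u)) fun x y => by
        simpa only [update_seqCons_zero] using hφ.add (seqCons 0 u) 0 x y (by omega))
      fun a x => by
        have := hφ.lin (seqCons x u) a (by omega)
        rwa [update_seqCons_zero] at this
    have hΦ : ∀ u x, (Φ u).1 (ι x) = φ (seqCons x u) := fun u x => Sharp.ofBase_incl _ _ _
    have hΦ' : Y.IsBaseCochain p Φ := by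
      refine ⟨fun u u' h => Sharp.ext_incl fun x => ?_, fun u i x y hi => Sharp.ext_incl fun z => ?_,
        fun u i a hi => Sharp.ext_incl fun z => ?_, fun u a hp => Sharp.ext_incl fun z => ?_⟩
      · rw [hΦ, hΦ]
        refine hφ.congr _ _ fun i hi => ?_
        cases i with
        | zero => rfl
        | succ i => exact h i (by omega)
      · change _ = (Φ _).1 (ι z) + (Φ _).1 (ι z)
        rw [hΦ, hΦ, hΦ]
        simp only [seqCons_update]
        exact hφ.add _ _ _ _ (by omega)
      · rw [hΦ, hΦ]
        simp only [seqCons_update]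
        exact hφ.bal (seqCons z u) (i + 1) a (by omega)
      · rw [Sharp.smul_apply, ← map_mul, hΦ, hΦ, seqCons_update]
        have := hφ.bal (seqCons z u) 0 a (by omega)
        rw [update_seqCons_zero] at this
        exact this.symm
    obtain ⟨F, hF, hF'⟩ := ih Φ hΦ'
    have t0 : ∀ (w : ℕ → Y.Smash) x, (fun i => Function.update w 0 x (i + 1)) = fun i => w (i + 1) :=
      fun w x => funext fun i => Function.update_of_ne (by omega) _ _
    have t1 : ∀ (w : ℕ → Y.Smash) j x, (fun i => Function.update w (j + 1) x (i + 1)) =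
        Function.update (fun i => w (i + 1)) j x := by
      intro w j x
      funext i
      simp [Function.update_apply]
    have t2 : ∀ (w : ℕ → Y.Smash) j x, Function.update w (j + 1) x 0 = w 0 :=
      fun w j x => Function.update_of_ne (by omega) _ _
    refine ⟨fun w => (F fun i => w (i + 1)).1 (w 0), ⟨fun w w' h => ?_, fun w i x y hi => ?_,
      fun w i n hi => ?_, fun w n hp => ?_⟩, fun u => ?_⟩
    · rw [h 0 (by omega), hF.congr _ (fun i => w' (i + 1)) fun i hi => h (i + 1) (by omega)]
    · cases i with
      | zero => simp only [t0, Function.update_self, map_add]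
      | succ i =>
        simp only [t1, t2]
        rw [hF.add _ _ _ _ (by omega)]
        rfl
    · cases i with
      | zero =>
        simp only [t0, t1, t2, Function.update_self]
        exact (congrArg (fun f => f.1 (w 0)) (hF.lin (fun i => w (i + 1)) n (by omega))).symm
      | succ i =>
        simp only [t1, t2]
        rw [hF.bal (fun i => w (i + 1)) i n (by omega)]
    · simp only [t0, Function.update_self]
      exact (F fun i => w (i + 1)).2 n (w 0)
    · simp only [hF' fun i => u (i + 1), hΦ, seqCons_head_tail]

end YetterDrinfeldAlgebra

/-- The function `F` with the entry `q` of its argument set to `x`. -/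
def fixAt {R X : Type*} (F : (ℕ → R) → X) (q : ℕ) (x : R) : (ℕ → R) → X :=
  fun w => F (Function.update w q x)

/-- The function `F` with the entry `q` of its argument multiplied by `c` from the right. -/
def mulAt {R X : Type*} [Mul R] (F : (ℕ → R) → X) (q : ℕ) (c : R) : (ℕ → R) → X :=
  fun w => F (Function.update w q (w q * c))

theorem fixAt_mulAt {R X : Type*} [Mul R] (F : (ℕ → R) → X) (q : ℕ) (c x : R) :
    fixAt (mulAt F q c) q x = fixAt F q (x * c) := by
  funext w
  simp [fixAt, mulAt]

namespace IsMulti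

variable {I R X : Type*} [Ring R] [AddCommGroup X] {t : I → R} {act : I → X → X} {p : ℕ}
  {F : (ℕ → R) → X}

theorem fixAt (hF : IsMulti t act (p + 1) F) (x : R) : IsMulti t act p (fixAt F p x) := hF.contr x

theorem mulAt (hF : IsMulti t act (p + 1) F) (c : R) : IsMulti t act (p + 1) (mulAt F p c) :=
  hF.mulLast c

theorem fixAt_add (hF : IsMulti t act (p + 1) F) (x y : R) :
    _root_.fixAt F p (x + y) = fun w => _root_.fixAt F p x w + _root_.fixAt F p y w :=
  funext fun w => hF.add w p x y (by omega)

theorem fixAt_fixAt_bal (hF : IsMulti t act (p + 2) F) (n : I) (x y : R) :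
    _root_.fixAt (_root_.fixAt F (p + 1) (t n * x)) p y =
      _root_.fixAt (_root_.fixAt F (p + 1) x) p (y * t n) := by
  funext w
  have h := hF.bal (Function.update (Function.update w p y) (p + 1) x) p n (by omega)
  rw [Function.update_of_ne (by omega), Function.update_self, Function.update_self,
    Function.update_idem, Function.update_comm (by omega), Function.update_idem] at h
  exact h.symm

end IsMulti

/-! ### The operators `D` on `U`. -/

namespace YetterDrinfeldAlgebra

open Smash

variable {k : Type w} {A U N : Type v} [CommRing k] [Ring A] [Algebra k A] [Ring U] [Algebra k U]
  {B : LeftBialgebroid k A U} [Ring N] [Algebra k N] [Module U N]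
  [IsScalarTower k U N] (Y : YetterDrinfeldAlgebra B N)

local notation "ι" => incl Y
local notation "τ" => target Y
local notation "σ" => source Y

/-- The iterated sum of `F(u⁰₍₁₎, …) u⁰₍₂₎ u¹₍₂₎ ⋯` over the coproducts of the first `q` entries. -/
noncomputable def Dfun : ℕ → ((ℕ → U) → Y.Smash) → (ℕ → U) → Y.Smash
  | 0, F, u => F u
  | q + 1, F, u => B.sw (B.comul (u q)) fun x y => Dfun q (fixAt F q x) u * ι y

variable {Y} {q : ℕ}

theorem Dfun_add (F G : (ℕ → U) → Y.Smash) (u : ℕ → U) :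
    Y.Dfun q (fun v => F v + G v) u = Y.Dfun q F u + Y.Dfun q G u := by
  induction q generalizing F G with
  | zero => rfl
  | succ q ih =>
    simp only [Dfun]
    rw [← B.sw_add_fun]
    congr! 2 with x y
    funext y
    rw [← add_mul, ← ih]
    rfl

theorem Dfun_congr {F : (ℕ → U) → Y.Smash}
    (hF : ∀ u u', (∀ i < q, u i = u' i) → F u = F u') {u u' : ℕ → U}
    (h : ∀ i < q, u i = u' i) : Y.Dfun q F u = Y.Dfun q F u' := by
  induction q generalizing F with
  | zero => exact hF _ _ h
  | succ q ih =>
    simp only [Dfun]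
    rw [h q (by omega)]
    congr! 2 with x y
    funext y
    rw [ih _ fun i hi => h i (by omega)]
    intro v v' hv
    refine hF _ _ fun i hi => ?_
    rcases Nat.lt_succ_iff_lt_or_eq.1 hi with hi | rfl
    · simp [Function.update_of_ne hi.ne, hv i hi]
    · simp

section

variable {φ : (ℕ → U) → N}

theorem Dfun_update_of_le (hφ : Y.IsBaseCochain q φ) (u : ℕ → U) (x : U) {i : ℕ} (hi : q ≤ i) :
    Y.Dfun q (fun v => σ (φ v)) (Function.update u i x) = Y.Dfun q (fun v => σ (φ v)) u :=
  Dfun_congr (fun v v' h => by rw [hφ.congr v v' h]) fun j hj =>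
    Function.update_of_ne (by omega) _ _

/-- The hypothesis `h` is the conclusion of `Dfun_fixAt_tgt_mul`. It is kept separate because the
inductive proof of that lemma uses balancedness one degree lower. -/
theorem Dfun_isBalanced_aux (hφ : Y.IsBaseCochain (q + 1) φ) (u : ℕ → U)
    (h : ∀ a x, Y.Dfun q (fun v => σ (fixAt φ q (B.tgt a * x) v)) u =
      Y.Dfun q (fun v => σ (fixAt φ q x v)) u * ι (B.s a)) :
    B.IsBalanced fun x y => Y.Dfun q (fun v => σ (fixAt φ q x v)) u * ι y where
  add_left x x' y := by
    rw [hφ.fixAt_add, ← add_mul, ← Dfun_add]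
    simp only [map_add]
  add_right x y y' := by rw [map_add, mul_add]
  tgt_mul a x y := by rw [h, smul_eq_mul, map_mul, mul_assoc]

/-- Balancing of $\varphi$ turns the factor $t(a)$ into a right factor of the preceding argument,
and the Takeuchi condition moves it to the second leg as $s(a)$, where it stands at the right end of
the product. If there is no preceding argument, the claim is the behaviour of the coaction on $n\lhd
a$. -/
theorem Dfun_fixAt_tgt_mul (hφ : Y.IsBaseCochain (q + 1) φ) (u : ℕ → U) (a : A) (x : U) :
    Y.Dfun q (fun v => σ (fixAt φ q (B.tgt a * x) v)) u =
      Y.Dfun q (fun v => σ (fixAt φ q x v)) u * ι (B.s a) := by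
  induction q generalizing φ x a with
  | zero =>
    have h := hφ.lin (Function.update u 0 x) a (by omega)
    rw [Function.update_self, Function.update_idem] at h
    change σ (φ _) = σ (φ _) * _
    rw [h, incl_smul, source_tgt_smul]
  | succ q ih =>
    have e : ∀ z, (fixAt (fun v => σ (fixAt φ (q + 1) (B.tgt a * x) v)) q z) =
        fun v => σ (fixAt (fixAt φ (q + 1) x) q (z * B.tgt a) v) := fun z => by
      rw [← hφ.fixAt_fixAt_bal]; rfl
    simp only [Dfun, e]
    rw [LeftBialgebroid.sw_takeuchi
      (f := fun z y => Y.Dfun q (fun v => σ (fixAt (fixAt φ (q + 1) x) q z v)) u * ι y)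
      (Dfun_isBalanced_aux (hφ.fixAt x) u fun a z => ih (hφ.fixAt x) a z), B.sw_mul]
    simp only [map_mul, mul_assoc]
    rfl

theorem Dfun_isBalanced (hφ : Y.IsBaseCochain (q + 1) φ) (u : ℕ → U) :
    B.IsBalanced fun x y => Y.Dfun q (fun v => σ (fixAt φ q x v)) u * ι y :=
  Dfun_isBalanced_aux hφ u (Dfun_fixAt_tgt_mul hφ u)

theorem Dfun_succ (hφ : Y.IsBaseCochain (q + 1) φ) (u : ℕ → U) (x : U) :
    Y.Dfun (q + 1) (fun v => σ (φ v)) (Function.update u q x) =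
      B.sw (B.comul x) fun x y => Y.Dfun q (fun v => σ (fixAt φ q x v)) u * ι y := by
  simp only [Dfun, Function.update_self]
  congr! 2 with x y
  funext y
  congr 1
  exact Dfun_update_of_le (hφ.fixAt x) u _ le_rfl

theorem Dfun_mul_tgt (hφ : Y.IsBaseCochain (q + 1) φ) (u : ℕ → U) (a : A) :
    Y.Dfun (q + 1) (fun v => σ (φ v)) (Function.update u q (u q * B.tgt a)) =
      Y.Dfun (q + 1) (fun v => σ (φ v)) u * ι (B.tgt a) := by
  rw [Dfun_succ hφ, LeftBialgebroid.sw_comul_mul_tgt (Dfun_isBalanced hφ u)]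
  simp only [Dfun, B.sw_mul, map_mul, mul_assoc]
  rfl

theorem isBaseCochain_Dfun [hY : Fact Y.IsBraidedCommutative] (hφ : Y.IsBaseCochain q φ) :
    Y.IsBaseCochain q (Y.Dfun q fun v => σ (φ v)) := by
  induction q generalizing φ with
  | zero =>
    exact ⟨fun u u' h => by rw [Dfun, Dfun, hφ.congr u u' h],
      fun _ _ _ _ h => (Nat.not_lt_zero _ h).elim,
      fun _ _ _ h => (Nat.not_lt_zero _ h).elim, fun _ _ h => (Nat.not_lt_zero _ h).elim⟩
  | succ q ih =>
    have ih' := fun x => ih (hφ.fixAt x)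
    have e : ∀ u : ℕ → U, Y.Dfun (q + 1) (fun v => σ (φ v)) u =
      B.sw (B.comul (u q)) fun x y => Y.Dfun q (fun v => σ (fixAt φ q x v)) u * ι y := fun _ => rfl
    refine ⟨fun u u' h => Dfun_congr (fun v v' h => by rw [hφ.congr v v' h]) h,
      fun u i x y hi => ?_, fun u i a hi => ?_, fun u a _ => ?_⟩
    · rcases Nat.lt_succ_iff_lt_or_eq.1 hi with hi | rfl
      · simp only [e, Function.update_of_ne hi.ne', (ih' _).add _ _ _ _ hi, add_mul, B.sw_add_fun]
      · simp only [Dfun_succ hφ, LeftBialgebroid.sw_comul_add (Dfun_isBalanced hφ u)]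
    · rcases Nat.lt_succ_iff_lt_or_eq.1 hi with hi | rfl
      · simp only [e, Function.update_of_ne hi.ne', Function.update_of_ne (show q ≠ i by omega),
          (ih' _).bal _ _ _ hi]
      · rw [Dfun_succ hφ, LeftBialgebroid.sw_comul_tgt_mul (Dfun_isBalanced hφ u), e,
          Function.update_of_ne (by omega)]
        congr! 2 with x y
        funext y
        rw [Dfun_mul_tgt (hφ.fixAt x), map_mul, mul_assoc]
    · rcases Nat.eq_zero_or_pos q with rfl | hq
      · rw [Dfun_succ hφ, LeftBialgebroid.sw_comul_tgt_mul (Dfun_isBalanced hφ u), e, smul_eq_mul,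
          B.mul_sw]
        congr! 2 with x y
        funext y
        simp only [Dfun, map_mul]
        -- With a single argument, left linearity requires $\iota(t(a))=\tau(a\rhd 1_N)$ to pass a
        -- value of $\sigma$; here braided commutativity is used.
        rw [← mul_assoc, ← mul_assoc, ← target_s_one, source_mul_target]
      · simp only [e, Function.update_of_ne hq.ne', (ih' _).lin _ _ hq, smul_eq_mul, B.mul_sw,
          mul_assoc]

end

/-! ### The operators `D_φ` on the smash product -/

variable (Y) in
open Classical in
/-- The extension of `D_φ` to the smash product. -/
noncomputable def Dhat (q : ℕ) (φ : (ℕ → Y.Smash) → N) : (ℕ → Y.Smash) → Y.Smash :=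
  if h : ∃ F : (ℕ → Y.Smash) → Y.Smash, Y.IsSmashCochain q F ∧
      ∀ u : ℕ → U, F (fun i => ι (u i)) = Y.Dfun q (fun v => σ (φ fun i => ι (v i))) u
    then h.choose else 0

variable [hY : Fact Y.IsBraidedCommutative] {φ : (ℕ → Y.Smash) → N}

theorem Dhat_spec (hφ : Y.IsSmashCochain q φ) : Y.IsSmashCochain q (Y.Dhat q φ) ∧
    ∀ u : ℕ → U, Y.Dhat q φ (fun i => ι (u i)) =
      Y.Dfun q (fun v => σ (φ fun i => ι (v i))) u := by
  have h := exists_extension (Y := Y) q _ (isBaseCochain_Dfun hφ.restrict)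
  rw [Dhat, dif_pos h]
  exact h.choose_spec

theorem isSmashCochain_Dhat (hφ : Y.IsSmashCochain q φ) : Y.IsSmashCochain q (Y.Dhat q φ) :=
  (Dhat_spec hφ).1

theorem Dhat_zero (hφ : Y.IsSmashCochain 0 φ) (w : ℕ → Y.Smash) : Y.Dhat 0 φ w = σ (φ w) := by
  rw [(isSmashCochain_Dhat hφ).congr w (fun i => ι ((fun _ => 0 : ℕ → U) i)) (by simp),
    (Dhat_spec hφ).2, Dfun]
  congr 1
  exact hφ.congr _ _ (by simp)

theorem IsSmashCochain.mul_right {F : (ℕ → Y.Smash) → Y.Smash} (hF : Y.IsSmashCochain q F)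
    (c : Y.Smash) : Y.IsSmashCochain q fun w => F w * c :=
  hF.map (· * c) (fun _ _ => add_mul _ _ _) fun _ _ => mul_assoc _ _ _

theorem IsSmashCochain.sw {X M : Type*} [AddCommGroup X] [Module k X] [Module U X]
    [AddCommGroup M] [Module Y.Smash M]
    {F : U → X → (ℕ → Y.Smash) → M} (hF : ∀ x y, Y.IsSmashCochain q (F x y))
    (z : B.BalTensor X) : Y.IsSmashCochain q fun w => B.sw z fun x y => F x y w :=
  IsMulti.finset_sum (fun _ _ _ => smul_add _ _ _) _ fun _ => hF _ _

theorem Dhat_add {ψ : (ℕ → Y.Smash) → N} (hφ : Y.IsSmashCochain q φ) (hψ : Y.IsSmashCochain q ψ) :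
    Y.Dhat q (fun w => φ w + ψ w) = fun w => Y.Dhat q φ w + Y.Dhat q ψ w := by
  have h := hφ.add_fun (fun _ _ _ => smul_add _ _ _) hψ
  refine IsSmashCochain.ext (isSmashCochain_Dhat h)
    ((isSmashCochain_Dhat hφ).add_fun (fun _ _ _ => smul_add _ _ _) (isSmashCochain_Dhat hψ))
    fun u => ?_
  rw [(Dhat_spec h).2, (Dhat_spec hφ).2, (Dhat_spec hψ).2, ← Dfun_add]
  simp only [map_add]

theorem isSmashCochain_zero_fun : Y.IsSmashCochain q (fun _ => (0 : N)) :=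
  ⟨fun _ _ _ => rfl, fun _ _ _ _ _ => (add_zero 0).symm, fun _ _ _ _ => rfl,
    fun _ _ _ => (smul_zero _).symm⟩

theorem Dhat_zero_fun (w : ℕ → Y.Smash) : Y.Dhat q (fun _ => 0) w = 0 := by
  have h := congrFun (Dhat_add (Y := Y) (q := q) isSmashCochain_zero_fun isSmashCochain_zero_fun) w
  simpa using h

theorem Dhat_sum {κ : Type*} (S : Finset κ) {F : κ → (ℕ → Y.Smash) → N}
    (hF : ∀ l, Y.IsSmashCochain q (F l)) (w : ℕ → Y.Smash) :
    Y.Dhat q (fun w => ∑ l ∈ S, F l w) w = ∑ l ∈ S, Y.Dhat q (F l) w := by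
  classical
  induction S using Finset.induction_on with
  | empty => simpa using Dhat_zero_fun w
  | insert l S hl ih =>
    simp only [Finset.sum_insert hl]
    rw [Dhat_add (hF l) (IsMulti.finset_sum (fun _ _ _ => smul_add _ _ _) S hF), ← ih]

theorem Dhat_sw {X : Type*} [AddCommGroup X] [Module k X] [Module U X]
    {F : U → X → (ℕ → Y.Smash) → N} (hF : ∀ x y, Y.IsSmashCochain q (F x y))
    (z : B.BalTensor X) (w : ℕ → Y.Smash) :
    Y.Dhat q (fun w => B.sw z fun x y => F x y w) w = B.sw z fun x y => Y.Dhat q (F x y) w :=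
  Dhat_sum _ (fun _ => hF _ _) w

theorem Dhat_fixAt_add (hφ : Y.IsSmashCochain (q + 1) φ) (x y : Y.Smash) (w : ℕ → Y.Smash) :
    Y.Dhat q (fixAt φ q (x + y)) w = Y.Dhat q (fixAt φ q x) w + Y.Dhat q (fixAt φ q y) w := by
  rw [hφ.fixAt_add, Dhat_add (hφ.fixAt x) (hφ.fixAt y)]

theorem incl_update (u : ℕ → U) (i : ℕ) (x : U) :
    (fun l => ι (Function.update u i x l)) = Function.update (fun l => ι (u l)) i (ι x) :=
  Function.comp_update _ _ _ _

/-- The recursion for `D_φ` in the last entry. -/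
theorem Dhat_succ (hφ : Y.IsSmashCochain (q + 1) φ) (w : ℕ → Y.Smash) (v : U) :
    Y.Dhat (q + 1) φ (Function.update w q (ι v)) =
      B.sw (B.comul v) fun x y => Y.Dhat q (fixAt φ q (ι x)) w * ι y := by
  refine congrFun (IsSmashCochain.ext ((isSmashCochain_Dhat hφ).fixAt (ι v))
    (IsSmashCochain.sw (fun x y => (isSmashCochain_Dhat (hφ.fixAt (ι x))).mul_right (ι y)) _)
    fun u => ?_) w
  rw [fixAt, ← incl_update, (Dhat_spec hφ).2, Dfun_succ hφ.restrict]
  simp only [(Dhat_spec (hφ.fixAt _)).2, fixAt, incl_update]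

theorem Dhat_incl (hφ : Y.IsSmashCochain (q + 1) φ) (u : ℕ → U) :
    Y.Dhat (q + 1) φ (fun i => ι (u i)) = B.sw (B.comul (u q)) fun x y =>
      Y.Dhat q (fixAt φ q (ι x)) (fun i => ι (u i)) * ι y := by
  rw [← Dhat_succ hφ, ← incl_update, Function.update_eq_self]

/-- This is `Dfun_fixAt_tgt_mul` with $N$ in place of $A$. For `q = 0` it is the multiplicativity of
$\sigma$. In the step $\tau(n)$ enters the preceding argument $\iota(x)$ and becomes
$\tau(x_{(2)}n)$, which the induction hypothesis emits as $\sigma(x_{(2)}n)$; coassociativity and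
the rule $\iota(y)\sigma(n)=\sigma(y_{(1)}n)\iota(y_{(2)})$ collect the result. -/
theorem Dhat_fixAt_target_mul (hφ : Y.IsSmashCochain (q + 1) φ) (n : N) (v : Y.Smash)
    (w : ℕ → Y.Smash) :
    Y.Dhat q (fixAt φ q (τ n * v)) w = Y.Dhat q (fixAt φ q v) w * σ n := by
  induction q generalizing φ n v w with
  | zero =>
    have h := hφ.lin (Function.update w 0 v) n (by omega)
    rw [Function.update_self, Function.update_idem] at h
    rw [Dhat_zero (hφ.fixAt _), Dhat_zero (hφ.fixAt _), fixAt, h, target_smul, source_mul]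
    rfl
  | succ q ih =>
    refine congrFun (IsSmashCochain.ext (isSmashCochain_Dhat (hφ.fixAt (τ n * v)))
      ((isSmashCochain_Dhat (hφ.fixAt v)).mul_right (σ n)) fun u => ?_) w
    obtain ⟨w, hw⟩ : ∃ w : ℕ → Y.Smash, w = fun i => ι (u i) := ⟨_, rfl⟩
    have hv := hφ.fixAt v
    have h1 : ∀ (a : A) (x : U), Y.Dhat q (fixAt (fixAt φ (q + 1) v) q (ι (B.tgt a * x))) w =
        Y.Dhat q (fixAt (fixAt φ (q + 1) v) q (ι x)) w * ι (B.s a) := fun a x => by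
      rw [map_mul, ← target_s_one, ih hv, source_s_one]
    have h3 : B.IsBalanced₃ fun x₁ x₂ y =>
        Y.Dhat q (fixAt (fixAt φ (q + 1) v) q (ι x₁)) w * σ (x₂ • n) * ι y :=
      ⟨fun _ _ _ _ => by rw [map_add, Dhat_fixAt_add hv, add_mul, add_mul],
        fun _ _ _ _ => by rw [add_smul, map_add, mul_add, add_mul],
        fun _ _ _ _ => by rw [map_add, mul_add],
        fun _ _ _ _ => by rw [h1, mul_smul, source_s_smul, mul_assoc _ (ι _)],
        fun _ _ _ _ => by
          rw [mul_smul, source_tgt_smul, smul_eq_mul, map_mul, ← mul_assoc, ← mul_assoc]⟩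
    rw [Dhat_incl (hφ.fixAt _), Dhat_incl hv, B.sw_mul, ← hw]
    have e : ∀ x y : U, Y.Dhat q (fixAt (fixAt φ (q + 1) (τ n * v)) q (ι x)) w * ι y =
        B.sw (B.comul x) fun x₁ x₂ =>
          Y.Dhat q (fixAt (fixAt φ (q + 1) v) q (ι x₁)) w * σ (x₂ • n) * ι y := by
      intro x y
      rw [hφ.fixAt_fixAt_bal, incl_mul_target,
        B.map_sw_of_add (fun z => Y.Dhat q (fixAt (fixAt φ (q + 1) v) q z) w)
          (fun _ _ => Dhat_fixAt_add hv _ _ _), B.sw_mul]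
      simp only [ih hv]
    simp only [e]
    rw [LeftBialgebroid.sw_coassoc h3]
    simp only [mul_assoc, incl_mul_source, B.mul_sw]

theorem Dhat_fixAt_tgt_mul (hφ : Y.IsSmashCochain (q + 1) φ) (a : A) (v : Y.Smash)
    (w : ℕ → Y.Smash) :
    Y.Dhat q (fixAt φ q (ι (B.tgt a) * v)) w = Y.Dhat q (fixAt φ q v) w * ι (B.s a) := by
  rw [← target_s_one, Dhat_fixAt_target_mul hφ, source_s_one]

theorem incl_s_mul_target (a : A) (n : N) : ι (B.s a) * τ n = τ n * ι (B.s a) := by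
  rw [← source_s_one, source_mul_target]

theorem isBalanced_Dhat (hφ : Y.IsSmashCochain (q + 1) φ) (m : N) (w : ℕ → Y.Smash) :
    B.IsBalanced fun x y => Y.Dhat q (fixAt φ q (ι x)) w * τ m * ι y :=
  ⟨fun _ _ _ => by rw [map_add, Dhat_fixAt_add hφ, add_mul, add_mul],
    fun _ _ _ => by rw [map_add, mul_add],
    fun _ _ _ => by
      rw [map_mul, Dhat_fixAt_tgt_mul hφ, mul_assoc _ (ι _), incl_s_mul_target, smul_eq_mul,
        map_mul, ← mul_assoc, ← mul_assoc]⟩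

theorem isBalanced_Dhat' (hφ : Y.IsSmashCochain (q + 1) φ) (w : ℕ → Y.Smash) :
    B.IsBalanced fun x y => Y.Dhat q (fixAt φ q (ι x)) w * ι y := by
  simpa [target_one] using isBalanced_Dhat hφ 1 w

/-- Right linearity in the last argument follows from the formula `h` for a last argument
$\tau(n)\iota(x)$, and that formula in turn needs right linearity one degree lower. The conditional
form allows both to be obtained in one induction. -/
theorem Dhat_mul_target_of (hφ : Y.IsSmashCochain (q + 1) φ)
    (h : ∀ (w : ℕ → Y.Smash) n x, Y.Dhat (q + 1) φ (Function.update w q (τ n * ι x)) =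
      B.sw (B.comul x) fun x₁ x₂ => Y.Dhat q (fixAt φ q (ι x₁)) w * τ n * ι x₂)
    (w : ℕ → Y.Smash) (n : N) :
    Y.Dhat (q + 1) φ (Function.update w q (w q * τ n)) = Y.Dhat (q + 1) φ w * τ n := by
  refine congrFun (IsSmashCochain.ext ((isSmashCochain_Dhat hφ).mulAt (τ n))
    ((isSmashCochain_Dhat hφ).mul_right (τ n)) fun u => ?_) w
  have h3 : B.IsBalanced₃ fun x₁ x₂ (y : U) =>
      Y.Dhat q (fixAt φ q (ι x₁)) (fun i => ι (u i)) * τ (y • n) * ι x₂ := by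
    have hb := fun m => isBalanced_Dhat hφ m (fun i => ι (u i))
    refine ⟨fun _ _ _ _ => (hb _).add_left _ _ _, fun _ _ _ _ => (hb _).add_right _ _ _,
      fun _ _ _ _ => by rw [add_smul, map_add, mul_add, add_mul],
      fun _ _ _ _ => (hb _).tgt_mul _ _ _, fun _ _ _ _ => ?_⟩
    rw [map_mul, smul_eq_mul, mul_smul, target_s_smul]
    simp only [mul_assoc]
  rw [Dhat_incl hφ, B.sw_mul, mulAt, incl_mul_target,
    B.map_sw_of_add (fun z => Y.Dhat (q + 1) φ (Function.update _ q z))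
      (fun _ _ => (isSmashCochain_Dhat hφ).add _ _ _ _ (by omega))]
  simp only [h]
  rw [LeftBialgebroid.sw_coassoc h3]
  simp only [mul_assoc, incl_mul_target, B.mul_sw]

/-- Balancing hands $\tau(n)$ to the preceding argument as a right factor, from which right
linearity in lower degree releases it. With one argument only, it comes out on the left instead and
commutes with $\sigma$. -/
theorem Dhat_target_mul_incl (hφ : Y.IsSmashCochain (q + 1) φ) (w : ℕ → Y.Smash) (n : N) (x : U) :
    Y.Dhat (q + 1) φ (Function.update w q (τ n * ι x)) =
      B.sw (B.comul x) fun x₁ x₂ => Y.Dhat q (fixAt φ q (ι x₁)) w * τ n * ι x₂ := by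
  induction q generalizing φ w n x with
  | zero =>
    have h := (isSmashCochain_Dhat hφ).lin (Function.update w 0 (ι x)) n (by omega)
    rw [Function.update_self, Function.update_idem] at h
    rw [h, Dhat_succ hφ, smul_eq_mul, B.mul_sw]
    simp only [Dhat_zero (hφ.fixAt _), source_mul_target, mul_assoc]
  | succ q ih =>
    have h := (isSmashCochain_Dhat hφ).bal (Function.update w (q + 1) (ι x)) q n (by omega)
    rw [Function.update_self, Function.update_idem, Function.update_of_ne (by omega),
      Function.update_comm (by omega)] at h
    rw [← h, Dhat_succ hφ]
    congr! 2 with x₁ x₂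
    funext x₂
    rw [Dhat_mul_target_of (hφ.fixAt _) fun w n x => ih (hφ.fixAt _) w n x]

theorem Dhat_mul_target (hφ : Y.IsSmashCochain (q + 1) φ) (w : ℕ → Y.Smash) (n : N) :
    Y.Dhat (q + 1) φ (Function.update w q (w q * τ n)) = Y.Dhat (q + 1) φ w * τ n :=
  Dhat_mul_target_of hφ (fun w n x => Dhat_target_mul_incl hφ w n x) w n

/-- This replaces right linearity when there is no argument: the operator is then an element of the
source. It is needed for the insertion of elements of $N$. -/
theorem Dhat_zero_mul_target (hφ : Y.IsSmashCochain 0 φ) (w : ℕ → Y.Smash) (n : N) :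
    Y.Dhat 0 φ w * τ n = τ n * Y.Dhat 0 φ w := by
  rw [Dhat_zero hφ, source_mul_target]

theorem Dhat_update_add (hφ : Y.IsSmashCochain (q + 1) φ) (w : ℕ → Y.Smash) (a b : Y.Smash) :
    Y.Dhat (q + 1) φ (Function.update w q (a + b)) =
      Y.Dhat (q + 1) φ (Function.update w q a) + Y.Dhat (q + 1) φ (Function.update w q b) :=
  (isSmashCochain_Dhat hφ).add _ _ _ _ (by omega)

/-- By the Takeuchi condition a right factor $t(a)$ on the first leg of the last argument becomes a
right factor $s(a)$ on the second, which stands outside $\varphi$. -/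
theorem mulAt_tgt_mul (hφ : Y.IsSmashCochain (q + 1) φ) (a : A) (w : ℕ → Y.Smash) :
    Y.Dhat (q + 1) (mulAt φ q (ι (B.tgt a))) w = Y.Dhat (q + 1) φ w * ι (B.s a) := by
  refine congrFun (IsSmashCochain.ext (isSmashCochain_Dhat (hφ.mulAt _))
    ((isSmashCochain_Dhat hφ).mul_right _) fun u => ?_) w
  rw [Dhat_incl (hφ.mulAt _), Dhat_incl hφ, B.sw_mul]
  simp only [fixAt_mulAt, ← map_mul]
  rw [LeftBialgebroid.sw_takeuchi
    (f := fun x y => Y.Dhat q (fixAt φ q (ι x)) (fun i => ι (u i)) * ι y) (isBalanced_Dhat' hφ _)]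
  simp only [map_mul, mul_assoc]

theorem mulAt_mulAt {R X : Type*} [Semigroup R] (F : (ℕ → R) → X) (q : ℕ) (c d : R) :
    mulAt (mulAt F q c) q d = mulAt F q (d * c) := by
  funext w
  simp [mulAt, mul_assoc]

theorem mulAt_add (hφ : Y.IsSmashCochain (q + 1) φ) (c d : Y.Smash) :
    mulAt φ q (c + d) = fun w => mulAt φ q c w + mulAt φ q d w := by
  funext w
  simp only [mulAt, mul_add]
  exact hφ.add _ _ _ _ (by omega)

theorem isBalanced_Dhat_mulAt (hφ : Y.IsSmashCochain (q + 1) φ) (w : ℕ → Y.Smash) :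
    B.IsBalanced fun x y => Y.Dhat (q + 1) (mulAt φ q (ι x)) w * ι y :=
  ⟨fun _ _ _ => by
      rw [map_add, mulAt_add hφ, Dhat_add (hφ.mulAt _) (hφ.mulAt _), add_mul],
    fun _ _ _ => by rw [map_add, mul_add],
    fun _ _ _ => by
      rw [map_mul, ← mulAt_mulAt, mulAt_tgt_mul (hφ.mulAt _), smul_eq_mul, map_mul, mul_assoc]⟩

/-- `D_φ(…, a b)` for `b` in `U`. -/
theorem Dhat_mul_incl (hφ : Y.IsSmashCochain (q + 1) φ) (w : ℕ → Y.Smash) (a : Y.Smash) (b : U) :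
    Y.Dhat (q + 1) φ (Function.update w q (a * ι b)) = B.sw (B.comul b) fun x y =>
      Y.Dhat (q + 1) (mulAt φ q (ι x)) (Function.update w q a) * ι y := by
  induction a using mk_ind with
  | h0 =>
    rw [zero_mul, (isSmashCochain_Dhat hφ).zero_slot _ _ (by omega)]
    simp only [(isSmashCochain_Dhat (hφ.mulAt _)).zero_slot w _ (Nat.lt_succ_self q), zero_mul]
    exact (B.map_sw_of_add (fun _ : Y.Smash => (0 : Y.Smash)) (fun _ _ => (add_zero 0).symm) _
      fun _ _ => 0)
  | hadd a a' ha ha' =>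
    rw [add_mul, Dhat_update_add hφ, ha, ha', ← B.sw_add_fun]
    simp only [Dhat_update_add (hφ.mulAt _), add_mul]
  | h u n =>
    rw [mul_assoc, ← map_mul, Dhat_target_mul_incl hφ,
      LeftBialgebroid.sw_comul_mul (isBalanced_Dhat hφ n w), B.sw_comm]
    congr! 2 with x y
    funext y
    rw [Dhat_target_mul_incl (hφ.mulAt _), B.sw_mul]
    simp only [fixAt_mulAt, map_mul, mul_assoc]

end YetterDrinfeldAlgebra

/-! ### Substitution into multilinear balanced functions. -/

/-- The insertion of `G` at the entry `i` of `F`. -/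
def insertAt {R X : Type*} (i q : ℕ) (F : (ℕ → R) → X) (G : (ℕ → R) → R) (w : ℕ → R) : X :=
  F fun j => if j < i then w j else if j = i then G fun l => w (i + l) else w (j + q - 1)

namespace IsMulti

variable {I R X : Type*} [Ring R] [AddCommGroup X] {t : I → R} {act : I → X → X} {p q i : ℕ}
  {F : (ℕ → R) → X} {G : (ℕ → R) → R}

/-- Balancing is critical only at the two ends of the inserted block: at the left end it is left
linearity of `G`, at the right end it is `hr`. For `q = 0` the ends coincide and a factor has to
cross the constant `G`, which is `h0`. -/
theorem insertAt (hi : i < p) (hF : IsMulti t act p F)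
    (hG : IsMulti t (fun n x => t n * x) q G)
    (hr : ∀ q', q = q' + 1 → ∀ w n, G (Function.update w q' (w q' * t n)) = G w * t n)
    (h0 : q = 0 → ∀ w n, G w * t n = t n * G w) :
    IsMulti t act (p + q - 1) (insertAt i q F G) := by
  -- `S w` lists the arguments received by `F`. The facts `s1`, `s2`, `s3` tell which of them
  -- changes when an entry of `w` before, inside or after the block changes; after the block the
  -- position shifts from `i + q + s` to `i + s + 1`.
  set S : (ℕ → R) → ℕ → R := fun w j =>
    if j < i then w j else if j = i then G fun l => w (i + l) else w (j + q - 1) with hS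
  have e : ∀ w, _root_.insertAt i q F G w = F (S w) := fun w => rfl
  have s1 : ∀ w s x, s < i → S (Function.update w s x) = Function.update (S w) s x := by
    intro w s x hs
    have hG' : (fun l => Function.update w s x (i + l)) = fun l => w (i + l) :=
      funext fun l => Function.update_of_ne (by omega) _ _
    funext j
    simp only [hS, hG']
    simp only [Function.update_apply]
    split_ifs <;> first | rfl | omega
  have s2 : ∀ w s x, s < q → S (Function.update w (i + s) x) =
      Function.update (S w) i (G (Function.update (fun l => w (i + l)) s x)) := by
    intro w s x hs
    have hG' : (fun l => Function.update w (i + s) x (i + l)) =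
        Function.update (fun l => w (i + l)) s x := by
      funext l
      simp [Function.update_apply]
    funext j
    simp only [hS, hG']
    simp only [Function.update_apply]
    split_ifs <;> first | rfl | omega
  have s3 : ∀ w s x, S (Function.update w (i + q + s) x) =
      Function.update (S w) (i + s + 1) x := by
    intro w s x
    have hG' : (G fun l => Function.update w (i + q + s) x (i + l)) = G fun l => w (i + l) :=
      hG.congr _ _ fun l hl => Function.update_of_ne (by omega) _ _
    funext j
    simp only [hS, hG']
    simp only [Function.update_apply]
    split_ifs <;> first | rfl | omega
  have v1 : ∀ w s, s < i → S w s = w s := fun w s hs => by simp [hS, hs]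
  have v2 : ∀ w, S w i = G fun l => w (i + l) := fun w => by simp [hS]
  have v3 : ∀ w s, S w (i + s + 1) = w (i + q + s) := fun w s => by
    simp only [hS, show ¬ i + s + 1 < i by omega, show ¬ i + s + 1 = i by omega, if_false]
    congr 1
    omega
  refine ⟨fun w w' h => ?_, fun w s x y hs => ?_, fun w s n hs => ?_, fun w n hp => ?_⟩
  · refine hF.congr _ _ fun j hj => ?_
    split_ifs
    · exact h j (by omega)
    · exact hG.congr _ _ fun l hl => h _ (by omega)
    · exact h _ (by omega)
  · simp only [e]
    rcases lt_or_ge s i with h | h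
    · simp only [s1 _ _ _ h]
      exact hF.add _ _ _ _ (by omega)
    obtain ⟨s, rfl⟩ := Nat.exists_eq_add_of_le h
    rcases lt_or_ge s q with h' | h'
    · simp only [s2 _ _ _ h', hG.add _ _ _ _ h']
      exact hF.add _ _ _ _ hi
    · obtain ⟨s, rfl⟩ := Nat.exists_eq_add_of_le h'
      simp only [← add_assoc, s3]
      exact hF.add _ _ _ _ (by omega)
  · simp only [e]
    rcases lt_trichotomy (s + 1) i with h | h | h
    · have := hF.bal (S w) s n (by omega)
      rwa [v1 _ _ h, v1 _ _ (by omega), ← s1 _ _ _ h, ← s1 _ _ _ (by omega)] at this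
    · have h1 := hF.bal (S w) s n (by omega)
      rw [v1 _ _ (by omega), ← s1 _ _ _ (by omega), h, v2] at h1
      rw [h, h1]
      rcases Nat.eq_zero_or_pos q with hq | hq
      -- The block is empty, so the right neighbour of entry `s` lies beyond the constant. Balancing
      -- is applied on both sides of the constant, with `h0` in between.
      · have h2 := hF.bal (S w) i n (by omega)
        have h3 := s3 w 0 (t n * w i)
        have h4 := v3 w 0
        rw [hq, add_zero, add_zero] at h3 h4
        rw [v2, h0 hq, h4, ← h3] at h2
        exact h2
      · have h2 := s2 w 0 (t n * w i) hq
        have h3 := hG.lin (fun l => w (i + l)) n hq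
        simp only [add_zero] at h2 h3
        rw [h2, h3]
    · obtain ⟨s, rfl⟩ := Nat.exists_eq_add_of_le (show i ≤ s by omega)
      rcases lt_trichotomy (s + 1) q with h' | h' | h'
      · rw [s2 _ _ _ (by omega), add_assoc, s2 _ _ _ h']
        congr 2
        exact hG.bal (fun l => w (i + l)) s n h'
      · have h1 := hr s h'.symm (fun l => w (i + l)) n
        have h2 := hF.bal (S w) i n (by omega)
        have h3 := s3 w 0 (t n * w (i + q))
        have h4 := v3 w 0
        simp only [add_zero] at h3 h4
        rw [v2, ← h1, ← s2 _ _ _ (by omega), h4, ← h3] at h2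
        rw [h2]
        congr 3
        · omega
        · congr 2; omega
      · obtain ⟨s, rfl⟩ := Nat.exists_eq_add_of_le (show q ≤ s by omega)
        have h2 := hF.bal (S w) (i + s + 1) n (by omega)
        have h3 := s3 w (s + 1) (t n * w (i + q + s + 1))
        have h4 := v3 w (s + 1)
        simp only [← add_assoc] at h3 h4 ⊢
        rw [v3, ← s3, h4, ← h3] at h2
        exact h2
  · simp only [e]
    rcases Nat.eq_zero_or_pos i with rfl | hi'
    · rcases Nat.eq_zero_or_pos q with hq | hq
      · have h2 := hF.bal (S w) 0 n (by omega)
        have h3 := s3 w 0 (t n * w 0)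
        have h4 := v3 w 0
        simp only [hq, add_zero, zero_add] at h3 h4 h2
        rw [v2, h0 hq, h4, ← h3, ← v2, hF.lin _ _ hi] at h2
        exact h2.symm
      · have h2 := s2 w 0 (t n * w 0) hq
        have h3 := hG.lin (fun l => w (0 + l)) n hq
        simp only [zero_add] at h2 h3
        rw [h2, h3, ← hF.lin _ _ hi, v2]
        simp only [zero_add]
    · rw [s1 _ _ _ hi', ← v1 w 0 hi', hF.lin _ _ (by omega)]

theorem insertAt_last {r : ℕ} (hF : IsMulti t act (r + 1) F) (w : ℕ → R) :
    _root_.insertAt r q F G w = F (Function.update w r (G fun l => w (r + l))) := by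
  refine hF.congr _ _ fun j hj => ?_
  rcases Nat.lt_succ_iff_lt_or_eq.1 hj with hj | rfl
  · simp [hj, hj.ne]
  · simp

end IsMulti

/-! ### Compatibility of the operators `D` with insertion. -/

namespace YetterDrinfeldAlgebra

open Smash

variable {k : Type w} {A U N : Type v} [CommRing k] [Ring A] [Algebra k A] [Ring U] [Algebra k U]
  {B : LeftBialgebroid k A U} [Ring N] [Algebra k N] [Module U N]
  [IsScalarTower k U N] {Y : YetterDrinfeldAlgebra B N}

local notation "ι" => incl Y
local notation "τ" => target Y
local notation "σ" => source Y

variable {q : ℕ} [hY : Fact Y.IsBraidedCommutative] {φ ψ : (ℕ → Y.Smash) → N}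

theorem isSmashCochain_insertAt {X : Type*} [AddCommGroup X] [Module Y.Smash X] {p i : ℕ}
    (hi : i < p) {F : (ℕ → Y.Smash) → X} (hF : Y.IsSmashCochain p F)
    (hφ : Y.IsSmashCochain q φ) : Y.IsSmashCochain (p + q - 1) (insertAt i q F (Y.Dhat q φ)) := by
  refine IsMulti.insertAt hi hF (isSmashCochain_Dhat hφ) ?_ ?_
  · rintro q rfl w n
    exact Dhat_mul_target hφ w n
  · rintro rfl w n
    exact Dhat_zero_mul_target hφ w n

theorem isSmashCochain_insertAt_last {X : Type*} [AddCommGroup X] [Module Y.Smash X] {r : ℕ}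
    {F : (ℕ → Y.Smash) → X} (hF : Y.IsSmashCochain (r + 1) F) (hφ : Y.IsSmashCochain q φ) :
    Y.IsSmashCochain (r + q) fun w =>
      F (Function.update w r (Y.Dhat q φ fun l => w (r + l))) := by
  have h := isSmashCochain_insertAt (Nat.lt_succ_self r) hF hφ
  rw [show r + 1 + q - 1 = r + q by omega] at h
  convert h using 1
  exact funext fun w => (hF.insertAt_last w).symm

/-- Write $\sigma(m)=\tau(m_{(0)})\iota(m_{(-1)})$. The left side becomes $\hat
D_{\varphi(\dots,m_{(-1)})}\,\sigma(m_{(0)})$, the right side $\hat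
D_{\varphi(\dots,m_{(-2)})}\,\tau(m_{(0)})\iota(m_{(-1)})$, and these agree by coassociativity of
the coaction. -/
theorem Dhat_insertAt_last_zero {r : ℕ} (hφ : Y.IsSmashCochain (r + 1) φ) (m : N)
    (w : ℕ → Y.Smash) :
    Y.Dhat r (fixAt φ r (σ m)) w = Y.Dhat (r + 1) φ (Function.update w r (σ m)) := by
  have h3 : B.IsBalanced₃ fun c₁ c₂ d => Y.Dhat r (fixAt φ r (ι c₁)) w * τ d * ι c₂ := by
    have hb := fun m => isBalanced_Dhat hφ m w
    refine ⟨fun _ _ _ _ => (hb _).add_left _ _ _, fun _ _ _ _ => (hb _).add_right _ _ _,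
      fun _ _ _ _ => by rw [map_add, mul_add, add_mul],
      fun _ _ _ _ => (hb _).tgt_mul _ _ _, fun _ _ _ _ => ?_⟩
    rw [map_mul, target_s_smul]
    simp only [mul_assoc]
  rw [source_eq_sw, B.map_sw_of_add (fun z => Y.Dhat (r + 1) φ (Function.update w r z))
    (fun _ _ => Dhat_update_add hφ _ _ _), B.map_sw_of_add (fun z => Y.Dhat r (fixAt φ r z) w)
    (fun _ _ => Dhat_fixAt_add hφ _ _ _)]
  simp only [Dhat_target_mul_incl hφ, Dhat_fixAt_target_mul hφ]
  rw [Y.sw_coassoc h3]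
  simp only [source_eq_sw, B.mul_sw, mul_assoc]

/-- Induction on the arity of $\psi$. If $u$ is the last argument, both sides are the sum of
$H(u_{(1)},u_{(2)})\,\iota(u_{(3)})$, where $H(x,y)$ feeds $\hat D_{\psi(\dots,x)}$ into the
operator of $\varphi(\dots,-\cdot y)$. The left side arrives there by splitting the first leg of
$\Delta(u)$, the right side by splitting the second. -/
theorem Dhat_insertAt_last {r : ℕ} (hφ : Y.IsSmashCochain (r + 1) φ)
    (hψ : Y.IsSmashCochain q ψ) :
    (Y.Dhat (r + q) fun w => φ (Function.update w r (Y.Dhat q ψ fun l => w (r + l)))) =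
      fun w => Y.Dhat (r + 1) φ (Function.update w r (Y.Dhat q ψ fun l => w (r + l))) := by
  induction q generalizing φ ψ with
  | zero =>
    have e : ∀ w, Y.Dhat 0 ψ w = σ (ψ 0) := fun w => by
      rw [Dhat_zero hψ, hψ.congr w 0 (by simp)]
    funext w
    simp only [e, add_zero]
    exact Dhat_insertAt_last_zero hφ _ w
  | succ q ih =>
    refine IsSmashCochain.ext (isSmashCochain_Dhat (isSmashCochain_insertAt_last hφ hψ))
      (isSmashCochain_insertAt_last (isSmashCochain_Dhat hφ) hψ) fun u => ?_
    have hs : ∀ (w : ℕ → Y.Smash) x, (fun l => Function.update w (r + q) x (r + l)) =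
        Function.update (fun l => w (r + l)) q x := by
      intro w x
      funext l
      simp [Function.update_apply]
    rw [← add_assoc, Dhat_incl (by exact isSmashCochain_insertAt_last hφ hψ)]
    obtain ⟨w, hw⟩ : ∃ w : ℕ → Y.Smash, w = fun i => ι (u i) := ⟨_, rfl⟩
    set H : U → U → Y.Smash := fun x₁ x₂ => Y.Dhat (r + 1) (mulAt φ r (ι x₂))
      (Function.update w r (Y.Dhat q (fixAt ψ q (ι x₁)) fun l => w (r + l))) with hH
    have e1 : ∀ x : U, (fixAt (fun w => φ (Function.update w r (Y.Dhat (q + 1) ψ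
        fun l => w (r + l)))) (r + q) (ι x)) = fun w' => B.sw (B.comul x) fun x₁ x₂ =>
          mulAt φ r (ι x₂) (Function.update w' r (Y.Dhat q (fixAt ψ q (ι x₁))
            fun l => w' (r + l))) := by
      intro x
      funext w'
      simp only [fixAt, mulAt, hs, Function.update_self, Function.update_idem]
      rw [← B.map_sw_of_add (fun z => φ (Function.update w' r z))
        (fun _ _ => hφ.add _ _ _ _ (by omega)), hφ.congr _ (Function.update w' r
          (Y.Dhat (q + 1) ψ (Function.update (fun l => w' (r + l)) q (ι x)))), Dhat_succ hψ]
      intro j hj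
      simp only [Function.update_apply]
      split_ifs <;> first | rfl | omega
    have e2 : ∀ x, Y.Dhat (r + q) (fixAt (fun w => φ (Function.update w r (Y.Dhat (q + 1) ψ
        fun l => w (r + l)))) (r + q) (ι x)) w = B.sw (B.comul x) H := by
      intro x
      rw [e1, Dhat_sw fun x₁ x₂ => isSmashCochain_insertAt_last (hφ.mulAt _) (hψ.fixAt _)]
      congr! 2 with x₁ x₂
      funext x₂
      exact congrFun (ih (hφ.mulAt (ι x₂)) (hψ.fixAt (ι x₁))) w
    have hb := fun x₁ => isBalanced_Dhat_mulAt hφ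
      (Function.update w r (Y.Dhat q (fixAt ψ q (ι x₁)) fun l => w (r + l)))
    have h3 : B.IsBalanced₃ fun x₁ x₂ y => H x₁ x₂ * ι y := by
      refine ⟨fun x x' z y => ?_, fun _ _ _ _ => (hb _).add_left _ _ _,
        fun _ _ _ _ => (hb _).add_right _ _ _, fun a x z y => ?_,
        fun _ _ _ _ => (hb _).tgt_mul _ _ _⟩
      · simp only [hH]
        rw [map_add, Dhat_fixAt_add hψ, Dhat_update_add (hφ.mulAt _), add_mul]
      · simp only [hH]
        -- Since $\Delta(s(a))=s(a)\otimes 1$, a right factor $s(a)$ of the last argument is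
        -- absorbed entirely by the multiplication inside $\varphi$.
        rw [map_mul, Dhat_fixAt_tgt_mul hψ, Dhat_mul_incl (hφ.mulAt _), LeftBialgebroid.sw_comul_s
          (isBalanced_Dhat_mulAt (hφ.mulAt _) _), mulAt_mulAt, map_one, mul_one, ← map_mul]
    rw [← hw]
    simp only [e2]
    have e3 : (fun l => w (r + l)) = Function.update (fun l => w (r + l)) q (ι (u (r + q))) := by
      rw [hw]
      simp
    conv_rhs => rw [e3]
    rw [Dhat_succ hψ, B.map_sw_of_add (fun z => Y.Dhat (r + 1) φ (Function.update w r z))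
      (fun _ _ => Dhat_update_add hφ _ _ _)]
    simp only [Dhat_mul_incl hφ, B.sw_mul]
    exact LeftBialgebroid.sw_coassoc h3 _

/-- Insertion of cochains corresponds to insertion of the operators `D`. -/
theorem Dhat_insertAt {p i q : ℕ} (hi : i < p) (hφ : Y.IsSmashCochain p φ)
    (hψ : Y.IsSmashCochain q ψ) :
    Y.Dhat (p + q - 1) (insertAt i q φ (Y.Dhat q ψ)) =
      insertAt i q (Y.Dhat p φ) (Y.Dhat q ψ) := by
  obtain ⟨s, rfl⟩ := Nat.exists_eq_add_of_lt hi
  -- `s` is the number of arguments of `φ` behind the insertion slot. The base case is insertion in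
  -- the last slot; otherwise the last argument is untouched by the insertion and is split off on
  -- both sides by the recursion for $\hat D$.
  induction s generalizing φ with
  | zero =>
    have h := Dhat_insertAt_last hφ hψ
    rw [show i + 0 + 1 + q - 1 = i + q by omega]
    convert h using 1
    · congr 1
      exact funext fun w => hφ.insertAt_last w
    · exact funext fun w => (isSmashCochain_Dhat hφ).insertAt_last w
  | succ s ih =>
    set p := i + s + 1 with hp
    change Y.IsSmashCochain (p + 1) φ at hφ
    change Y.Dhat (p + 1 + q - 1) _ = insertAt i q (Y.Dhat (p + 1) φ) _
    have hc {X : Type v} (F : (ℕ → Y.Smash) → X) (w : ℕ → Y.Smash) x :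
        insertAt i q F (Y.Dhat q ψ) (Function.update w (p + q - 1) x) =
          insertAt i q (fixAt F p x) (Y.Dhat q ψ) w := by
      have hG : (Y.Dhat q ψ fun l => Function.update w (p + q - 1) x (i + l)) =
          Y.Dhat q ψ fun l => w (i + l) :=
        (isSmashCochain_Dhat hψ).congr _ _ fun l hl => Function.update_of_ne (by omega) _ _
      simp only [insertAt, fixAt, hG]
      congr 1
      funext j
      simp only [Function.update_apply]
      split_ifs <;> first | rfl | omega
    have hd : p + 1 + q - 1 = p + q - 1 + 1 := by omega
    have h1 := isSmashCochain_insertAt (show i < p + 1 by omega) hφ hψ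
    have h2 := isSmashCochain_insertAt (show i < p + 1 by omega) (isSmashCochain_Dhat hφ) hψ
    rw [hd] at h1 h2 ⊢
    refine IsSmashCochain.ext (isSmashCochain_Dhat h1) h2 fun u => ?_
    rw [Dhat_incl h1]
    obtain ⟨w, hw⟩ : ∃ w : ℕ → Y.Smash, w = fun i => ι (u i) := ⟨_, rfl⟩
    have e1 : ∀ x, fixAt (insertAt i q φ (Y.Dhat q ψ)) (p + q - 1) x =
        insertAt i q (fixAt φ p x) (Y.Dhat q ψ) := fun x => funext fun w => hc φ w x
    rw [← hw]
    conv_rhs => rw [show w = Function.update w (p + q - 1) (ι (u (p + q - 1))) by rw [hw]; simp, hc]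
    simp only [e1, ih (by omega) (hφ.fixAt _), insertAt, fixAt]
    rw [Dhat_succ hφ]
end YetterDrinfeldAlgebra

/-! ### Transfer of cochains to the smash product; scalars, unit and multiplication. -/

/-- A finite sequence, extended by zero. -/
def padSeq {R : Type*} [Zero R] {p : ℕ} (u : Fin p → R) (i : ℕ) : R :=
  if h : i < p then u ⟨i, h⟩ else 0

theorem padSeq_val {R : Type*} [Zero R] {p : ℕ} (u : Fin p → R) : (fun i : Fin p => padSeq u i) = u :=
  funext fun i => by simp [padSeq]

theorem padSeq_update {R : Type*} [Zero R] {p : ℕ} (u : Fin p → R) (i : Fin p) (x : R) :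
    padSeq (Function.update u i x) = Function.update (padSeq u) i x := by
  funext l
  simp only [padSeq, Function.update_apply, Fin.ext_iff]
  have := i.2
  split_ifs <;> first | rfl | omega

theorem padSeq_apply {R : Type*} [Zero R] {p : ℕ} (u : Fin p → R) (i : Fin p) :
    padSeq u i = u i := by simp [padSeq]

namespace YetterDrinfeldAlgebra

open Smash

variable {k : Type w} {A U N : Type v} [CommRing k] [Ring A] [Algebra k A] [Ring U] [Algebra k U]
  {B : LeftBialgebroid k A U} [Ring N] [Algebra k N] [Module U N]
  [IsScalarTower k U N] {Y : YetterDrinfeldAlgebra B N}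

local notation "ι" => incl Y
local notation "τ" => target Y
local notation "σ" => source Y

section Cochains

theorem isBaseCochain_of_isCochain {p : ℕ} {φ : (Fin p → U) → N} (hφ : B.IsCochain φ) :
    Y.IsBaseCochain p fun u => φ fun i => u i := by
  have e : ∀ (w : ℕ → U) i (hi : i < p) x, (fun l : Fin p => Function.update w i x l) =
      Function.update (fun l : Fin p => w l) ⟨i, hi⟩ x := by
    intro w i hi x
    funext l
    simp [Function.update_apply, Fin.ext_iff]
  refine ⟨fun w w' h => congrArg φ (funext fun i => h i i.2), fun w i x y hi => ?_,
    fun w i a hi => ?_, fun w a hp => ?_⟩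
  · simp only [e _ _ hi]
    exact hφ.map_add _ _ _ _
  · simp only [e _ _ hi, e _ _ (show i < p by omega)]
    exact hφ.balanced (fun l : Fin p => w l) ⟨i, by omega⟩ ⟨i + 1, hi⟩ rfl a
  · simp only [e _ _ hp, incl_smul]
    exact hφ.linear (fun l : Fin p => w l) ⟨0, hp⟩ rfl a

theorem IsBaseCochain.isCochain {p : ℕ} {F : (ℕ → U) → N} (hF : Y.IsBaseCochain p F) :
    B.IsCochain fun u : Fin p → U => F (padSeq u) := by
  refine ⟨fun u i x y => ?_, fun u i j h a => ?_, fun u i h a => ?_⟩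
  · simp only [padSeq_update]
    exact hF.add _ _ _ _ i.2
  · simp only [padSeq_update, ← padSeq_apply u]
    rw [← h]
    exact hF.bal (padSeq u) i a (by omega)
  · have := hF.lin (padSeq u) a (by omega)
    rw [padSeq_update, ← padSeq_apply u, h, this, incl_smul]

variable (Y) in
/-- The extension of a cochain to the smash product. -/
noncomputable def hat {p : ℕ} (φ : B.Cochain N p) : (ℕ → Y.Smash) → N :=
  (exists_extension p _ (isBaseCochain_of_isCochain (Y := Y) φ.2)).choose

theorem isSmashCochain_hat {p : ℕ} (φ : B.Cochain N p) : Y.IsSmashCochain p (Y.hat φ) :=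
  (exists_extension p _ (isBaseCochain_of_isCochain (Y := Y) φ.2)).choose_spec.1

theorem hat_incl {p : ℕ} (φ : B.Cochain N p) (u : ℕ → U) :
    Y.hat φ (fun i => ι (u i)) = φ.1 fun i => u i :=
  (exists_extension p _ (isBaseCochain_of_isCochain (Y := Y) φ.2)).choose_spec.2 u

theorem hat_incl_padSeq {p : ℕ} (φ : B.Cochain N p) (u : Fin p → U) :
    Y.hat φ (fun i => ι (padSeq u i)) = φ.1 u := by
  rw [hat_incl, padSeq_val]

/-- The restriction of a cochain on the smash product. -/
noncomputable def ofSmash {p : ℕ} (F : (ℕ → Y.Smash) → N) (hF : Y.IsSmashCochain p F) : B.Cochain N p :=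
  ⟨fun u => F fun i => ι (padSeq u i), IsBaseCochain.isCochain hF.restrict⟩

theorem hat_injective {p : ℕ} {φ ψ : B.Cochain N p} (h : Y.hat φ = Y.hat ψ) : φ = ψ :=
  Subtype.ext (funext fun u => by rw [← hat_incl_padSeq (Y := Y), h, hat_incl_padSeq])

theorem hat_eq {p : ℕ} {φ : B.Cochain N p} {F : (ℕ → Y.Smash) → N} (hF : Y.IsSmashCochain p F)
    (h : ∀ u : ℕ → U, φ.1 (fun i => u i) = F fun i => ι (u i)) : Y.hat φ = F :=
  IsSmashCochain.ext (isSmashCochain_hat φ) hF fun u => by rw [hat_incl, h]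

theorem hat_ofSmash {p : ℕ} {F : (ℕ → Y.Smash) → N} (hF : Y.IsSmashCochain p F) :
    Y.hat (ofSmash F hF) = F :=
  hat_eq hF fun _ => hF.congr _ _ fun i hi => by simp [padSeq, hi]

theorem hat_add {p : ℕ} (φ ψ : B.Cochain N p) (w : ℕ → Y.Smash) :
    Y.hat (φ + ψ) w = Y.hat φ w + Y.hat ψ w :=
  congrFun (hat_eq ((isSmashCochain_hat φ).add_fun (fun _ _ _ => smul_add _ _ _)
    (isSmashCochain_hat ψ)) fun u => by rw [hat_incl, hat_incl]; rfl) w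

theorem smul_comm_smash (c : k) (w : Y.Smash) (n : N) : w • c • n = c • w • n := by
  have : SMulCommClass U k N := IsScalarTower.to_smulCommClass'
  induction w using mk_ind with
  | h0 => simp
  | h u m =>
    simp only [mul_smul, incl_smul, target_smul, smul_comm u c, smul_mul_assoc]
  | hadd y z hy hz => rw [add_smul, hy, hz, add_smul, smul_add]

theorem IsSmashCochain.const_smul {p : ℕ} {F : (ℕ → Y.Smash) → N} (hF : Y.IsSmashCochain p F)
    (c : k) : Y.IsSmashCochain p fun w => c • F w :=
  hF.map (c • ·) (fun _ _ => smul_add _ _ _) fun _ _ => (smul_comm_smash _ _ _).symm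

theorem hat_smul {p : ℕ} (c : k) (φ : B.Cochain N p) (w : ℕ → Y.Smash) :
    Y.hat (c • φ) w = c • Y.hat φ w :=
  congrFun (hat_eq ((isSmashCochain_hat φ).const_smul c) fun u => by rw [hat_incl]; rfl) w

theorem hat_zero {p : ℕ} (w : ℕ → Y.Smash) : Y.hat (0 : B.Cochain N p) w = 0 := by
  have := hat_smul (Y := Y) (0 : k) (0 : B.Cochain N p) w
  simpa using this

end Cochains

section Central

theorem algebraMap_smul_eq (c : k) (n : N) : B.s (algebraMap k A c) • n = c • n := by
  rw [AlgHom.commutes, algebraMap_smul]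

theorem target_smul_algebraMap (c : k) : τ (c • (1 : N)) = ι (algebraMap k U c) := by
  rw [← algebraMap_smul_eq (B := B), target_s_one, B.tgt_algebraMap]

theorem central_mul (c : k) (w : Y.Smash) :
    ι (algebraMap k U c) * w = w * ι (algebraMap k U c) := by
  induction w using mk_ind with
  | h0 => simp
  | h u m =>
    rw [mul_assoc, ← map_mul, ← Algebra.commutes, map_mul, ← mul_assoc, ← mul_assoc,
      ← target_smul_algebraMap, ← target_mul, ← target_mul, mul_smul_comm, mul_one, smul_mul_assoc,
      one_mul]
  | hadd y z hy hz => rw [mul_add, hy, hz, add_mul]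

theorem central_smul (c : k) (n : N) : ι (algebraMap k U c) • n = c • n := by
  rw [incl_smul, algebraMap_smul]

/-- As $\iota(c)=\tau(c\,1_N)$ is central, it can be handed from each argument to the preceding one
until linearity releases it from the first. This yields $k$-linearity of $\varphi\circ_i\psi$ in
$\psi$. -/
theorem IsSmashCochain.central {p : ℕ} {X : Type*} [AddCommGroup X] [Module Y.Smash X]
    {F : (ℕ → Y.Smash) → X} (hF : Y.IsSmashCochain p F) (c : k) (w : ℕ → Y.Smash) {i : ℕ}
    (hi : i < p) : F (Function.update w i (ι (algebraMap k U c) * w i)) =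
      ι (algebraMap k U c) • F w := by
  induction i with
  | zero =>
    rw [← target_smul_algebraMap]
    exact hF.lin w _ hi
  | succ i ih =>
    rw [← ih (by omega), central_mul c (w i), ← target_smul_algebraMap]
    exact (hF.bal w i _ hi).symm

variable [hY : Fact Y.IsBraidedCommutative] {q : ℕ} {φ : (ℕ → Y.Smash) → N}

theorem Dhat_const_smul (hφ : Y.IsSmashCochain q φ) (c : k) (w : ℕ → Y.Smash) :
    Y.Dhat q (fun w => c • φ w) w = ι (algebraMap k U c) * Y.Dhat q φ w := by
  refine congrFun (IsSmashCochain.ext (isSmashCochain_Dhat (hφ.const_smul c))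
    ((isSmashCochain_Dhat hφ).map (ι (algebraMap k U c) * ·) (fun _ _ => mul_add _ _ _)
      fun n x => ?_) fun u => ?_) w
  · simp only [smul_eq_mul, ← mul_assoc, central_mul c (τ n)]
  · induction q generalizing φ u with
    | zero =>
      rw [Dhat_zero (hφ.const_smul c), Dhat_zero hφ, ← algebraMap_smul_eq (B := B), source_s_smul,
        AlgHom.commutes]
    | succ q ih =>
      rw [Dhat_incl (hφ.const_smul c), Dhat_incl hφ, B.mul_sw]
      congr! 2 with x y
      funext y
      rw [← mul_assoc, ← ih (hφ.fixAt _)]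
      rfl

/-- Acting on $1_N$ turns the leg $u_{(2)}$ of the last argument into $\varepsilon(u_{(2)})$, which
can be written as $t(\varepsilon(u_{(2)}))$ and taken back into the argument; there the counit law
restores $u$. -/
theorem Dhat_smul_one (hφ : Y.IsSmashCochain q φ) (w : ℕ → Y.Smash) :
    Y.Dhat q φ w • (1 : N) = φ w := by
  refine congrFun (IsSmashCochain.ext ((isSmashCochain_Dhat hφ).map (· • (1 : N))
    (fun _ _ => add_smul _ _ _) fun n x => mul_smul _ _ _) hφ fun u => ?_) w
  induction q generalizing φ u with
  | zero => rw [Dhat_zero hφ, source_smul, mul_one]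
  | succ q ih =>
    have e : ∀ x y : U, (Y.Dhat q (fixAt φ q (ι x)) (fun i => ι (u i)) * ι y) • (1 : N) =
        fixAt φ q (ι (B.tgt (B.counit y) * x)) fun i => ι (u i) := by
      intro x y
      rw [← ih (hφ.fixAt _), map_mul, Dhat_fixAt_tgt_mul hφ, mul_smul, mul_smul, incl_smul,
        Y.smul_one, incl_smul]
    rw [Dhat_incl hφ, B.sw_smul]
    simp only [e]
    rw [← B.map_sw_of_add (fun z => fixAt φ q (ι z) fun i => ι (u i)) (fun x y => by
      rw [map_add, hφ.fixAt_add]) _ fun x y => B.tgt (B.counit y) * x, B.sw_counit_right, fixAt,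
      ← incl_update, Function.update_eq_self]

theorem isSmashCochain_smul_one : Y.IsSmashCochain 1 fun w => w 0 • (1 : N) := by
  refine ⟨fun w w' h => by rw [h 0 (by omega)], fun w i x y hi => ?_, fun w i n hi => by omega,
    fun w n _ => ?_⟩
  · obtain rfl : i = 0 := by omega
    simp [add_smul]
  · simp [mul_smul]

theorem isSmashCochain_mul_smul_one : Y.IsSmashCochain 2 fun w => (w 0 * w 1) • (1 : N) := by
  refine ⟨fun w w' h => by rw [h 0 (by omega), h 1 (by omega)], fun w i x y hi => ?_,
    fun w i n hi => ?_, fun w n _ => ?_⟩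
  · obtain rfl | rfl : i = 0 ∨ i = 1 := by omega
    · simp [add_smul, add_mul]
    · simp [add_smul, mul_add]
  · obtain rfl : i = 0 := by omega
    simp [mul_assoc]
  · simp [mul_smul]

theorem isSmashCochain_const (n : N) : Y.IsSmashCochain 0 fun _ => n :=
  ⟨fun _ _ _ => rfl, fun _ _ _ _ h => (Nat.not_lt_zero _ h).elim,
    fun _ _ _ h => (Nat.not_lt_zero _ h).elim, fun _ _ h => (Nat.not_lt_zero _ h).elim⟩

/-- The other counit law: on $\iota(u)$ the value is
$\iota\big(s(\varepsilon(u_{(1)}))u_{(2)}\big)$. -/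
theorem Dhat_unit : Y.Dhat 1 (fun w => w 0 • (1 : N)) = fun w => w 0 := by
  have h := isSmashCochain_smul_one (Y := Y)
  refine IsSmashCochain.ext (isSmashCochain_Dhat h) ⟨fun w w' h => h 0 (by omega),
    fun w i x y hi => ?_, fun w i n hi => by omega, fun w n _ => ?_⟩ fun u => ?_
  · obtain rfl : i = 0 := by omega
    simp
  · simp
  · have e : ∀ x y : U, Y.Dhat 0 (fixAt (fun w => w 0 • (1 : N)) 0 (ι x)) (fun i => ι (u i)) * ι y =
        ι (B.s (B.counit x) * y) := by
      intro x y
      rw [Dhat_zero (h.fixAt _), fixAt, Function.update_self, incl_smul, Y.smul_one, source_s_one,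
        map_mul]
    rw [Dhat_incl h]
    simp only [e]
    rw [← B.map_sw (ι), B.sw_counit_left]

/-- Since $\mu(u,v)=\mathbb 1(uv)$, the formula `Dhat_mul_incl` for the cochain $\mathbb 1$ reduces
this to `Dhat_unit`. As a consequence $\mu\circ_1\mu=\mu\circ_2\mu$ is associativity of the smash
product. -/
theorem Dhat_mul : Y.Dhat 2 (fun w => (w 0 * w 1) • (1 : N)) = fun w => w 0 * w 1 := by
  have h := isSmashCochain_mul_smul_one (Y := Y)
  refine IsSmashCochain.ext (isSmashCochain_Dhat h) ⟨fun w w' h => by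
    rw [h 0 (by omega), h 1 (by omega)], fun w i x y hi => ?_, fun w i n hi => ?_, fun w n _ => ?_⟩
    fun u => ?_
  · obtain rfl | rfl : i = 0 ∨ i = 1 := by omega
    · simp [add_mul]
    · simp [mul_add]
  · obtain rfl : i = 0 := by omega
    simp [mul_assoc]
  · simp [mul_assoc]
  · have h2 := Dhat_mul_incl (isSmashCochain_smul_one (Y := Y)) (fun i => ι (u i)) (ι (u 0)) (u 1)
    rw [Dhat_unit] at h2
    simp only [Function.update_self] at h2
    rw [Dhat_incl h, h2]
    congr! 2 with x y
    funext y
    congr 2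
    funext w
    simp

theorem Dhat_one_const (w : ℕ → Y.Smash) : Y.Dhat 0 (fun _ => (1 : N)) w = 1 := by
  rw [Dhat_zero (isSmashCochain_const 1), source_one]

end Central

end YetterDrinfeldAlgebra

/-! ### Parallel and nested substitutions. -/

section Insertions

variable {R X : Type*} {p q r i j : ℕ} {F : (ℕ → R) → X} {G H : (ℕ → R) → R}

theorem insertAt_insertAt_of_lt (hG : ∀ w w' : ℕ → R, (∀ i < q, w i = w' i) → G w = G w')
    (hH : ∀ w w' : ℕ → R, (∀ i < r, w i = w' i) → H w = H w') (hji : j < i) :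
    insertAt j r (insertAt i q F G) H = insertAt (i + r - 1) q (insertAt j r F H) G := by
  funext w
  simp only [insertAt]
  congr 1
  funext l
  rcases lt_trichotomy l j with h | rfl | h
  · simp [h, h.trans hji, show l < i + r - 1 by omega]
  · simp only [hji, lt_irrefl, if_true, if_false]
    exact hH _ _ fun s hs => by simp [show l + s < i + r - 1 by omega]
  rcases lt_trichotomy l i with h' | rfl | h'
  · simp only [h', if_true, show ¬ l < j by omega, show l ≠ j by omega, if_false,
      show l + r - 1 < i + r - 1 by omega]
  · simp only [lt_irrefl, if_true, if_false, show ¬ l < j by omega, show l ≠ j by omega]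
    refine hG _ _ fun s hs => ?_
    simp only [show ¬ l + s < j by omega, show l + s ≠ j by omega, if_false]
    congr 1; omega
  · simp only [show ¬ l < i by omega, show l ≠ i by omega, show ¬ l < j by omega,
      show l ≠ j by omega, show ¬ l + q - 1 < j by omega, show l + q - 1 ≠ j by omega,
      show ¬ l + r - 1 < i + r - 1 by omega, show l + r - 1 ≠ i + r - 1 by omega, if_false]
    congr 1; omega

theorem insertAt_insertAt_of_mem (hG : ∀ w w' : ℕ → R, (∀ i < q, w i = w' i) → G w = G w')
    (hij : i ≤ j) (hj : j < i + q) :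
    insertAt j r (insertAt i q F G) H = insertAt i (q + r - 1) F (insertAt (j - i) r G H) := by
  funext w
  simp only [insertAt]
  congr 1
  funext l
  rcases lt_trichotomy l i with h | rfl | h
  · simp [h, show l < j by omega]
  · simp only [lt_irrefl, if_true, if_false]
    refine hG _ _ fun s hs => ?_
    rcases lt_trichotomy (l + s) j with h | h | h
    · simp only [h, show s < j - l by omega, if_true]
    · subst h
      simp only [lt_irrefl, if_true, if_false, Nat.add_sub_cancel_left, add_assoc]
    · simp only [show ¬ l + s < j by omega, show l + s ≠ j by omega, show ¬ s < j - l by omega,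
        show s ≠ j - l by omega, if_false]
      congr 1; omega
  · simp only [show ¬ l < i by omega, show l ≠ i by omega, show ¬ l + q - 1 < j by omega,
      show l + q - 1 ≠ j by omega, if_false]
    congr 1; omega

end Insertions

/-! ### The operad of cochains. -/

namespace YetterDrinfeldAlgebra

open Smash

variable {k : Type w} {A U N : Type v} [CommRing k] [Ring A] [Algebra k A] [Ring U] [Algebra k U]
  {B : LeftBialgebroid k A U} [Ring N] [Algebra k N] [Module U N]
  [IsScalarTower k U N] {Y : YetterDrinfeldAlgebra B N}

local notation "ι" => incl Y
local notation "τ" => target Y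
local notation "σ" => source Y

variable [hY : Fact Y.IsBraidedCommutative]

section

variable {p q n : ℕ}

theorem isSmashCochain_insertion (h : p + q = n + 1) {i : ℕ} (hi : 1 ≤ i ∧ i ≤ p)
    (φ : B.Cochain N p) (ψ : B.Cochain N q) :
    Y.IsSmashCochain n (insertAt (i - 1) q (Y.hat φ) (Y.Dhat q (Y.hat ψ))) := by
  obtain rfl : n = p + q - 1 := by omega
  exact isSmashCochain_insertAt (by omega) (isSmashCochain_hat φ) (isSmashCochain_hat ψ)

variable (Y) in
/-- The insertion `φ ∘ᵢ ψ`. -/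
noncomputable def insertion (h : p + q = n + 1) (i : ℕ) (φ : B.Cochain N p) (ψ : B.Cochain N q) :
    B.Cochain N n :=
  if hi : 1 ≤ i ∧ i ≤ p then ofSmash _ (isSmashCochain_insertion (Y := Y) h hi φ ψ) else 0

theorem insertion_eq_zero (h : p + q = n + 1) {i : ℕ} (hi : i = 0 ∨ p < i) (φ : B.Cochain N p)
    (ψ : B.Cochain N q) : Y.insertion h i φ ψ = 0 := dif_neg (by omega)

theorem hat_insertion (h : p + q = n + 1) {i : ℕ} (hi : 1 ≤ i ∧ i ≤ p) (φ : B.Cochain N p)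
    (ψ : B.Cochain N q) : Y.hat (Y.insertion h i φ ψ) =
      insertAt (i - 1) q (Y.hat φ) (Y.Dhat q (Y.hat ψ)) := by
  rw [insertion, dif_pos hi, hat_ofSmash]

theorem Dhat_hat_insertion (h : p + q = n + 1) {i : ℕ} (hi : 1 ≤ i ∧ i ≤ p) (φ : B.Cochain N p)
    (ψ : B.Cochain N q) : Y.Dhat n (Y.hat (Y.insertion h i φ ψ)) =
      insertAt (i - 1) q (Y.Dhat p (Y.hat φ)) (Y.Dhat q (Y.hat ψ)) := by
  rw [hat_insertion h hi, ← Dhat_insertAt (by omega) (isSmashCochain_hat φ) (isSmashCochain_hat ψ),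
    show n = p + q - 1 by omega]

theorem insertAt_add {R X : Type*} [Ring R] [AddCommGroup X] {F : (ℕ → R) → X}
    {G G' : (ℕ → R) → R} {i : ℕ}
    (hF : ∀ w x y, F (Function.update w i (x + y)) =
      F (Function.update w i x) + F (Function.update w i y)) (w : ℕ → R) :
    insertAt i q F (fun w => G w + G' w) w = insertAt i q F G w + insertAt i q F G' w := by
  have e : ∀ G : (ℕ → R) → R, insertAt i q F G w = F (Function.update
      (fun j => if j < i then w j else w (j + q - 1)) i (G fun l => w (i + l))) := by
    intro G
    simp only [insertAt]
    congr 1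
    funext j
    simp only [Function.update_apply]
    split_ifs <;> first | rfl | omega
  rw [e, e, e, hF]

theorem insertAt_central {F : (ℕ → Y.Smash) → N} (hF : Y.IsSmashCochain p F)
    (G : (ℕ → Y.Smash) → Y.Smash) {i : ℕ} (hi : i < p) (c : k) (w : ℕ → Y.Smash) :
    insertAt i q F (fun w => ι (algebraMap k U c) * G w) w = c • insertAt i q F G w := by
  rw [← central_smul (Y := Y), insertAt, insertAt, ← hF.central c _ hi]
  congr 1
  funext j
  simp only [Function.update_apply, lt_irrefl, if_false, if_true]
  split_ifs <;> first | rfl | omega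

theorem insertion_add_left (h : p + q = n + 1) (i : ℕ) (φ φ' : B.Cochain N p) (ψ : B.Cochain N q) :
    Y.insertion h i (φ + φ') ψ = Y.insertion h i φ ψ + Y.insertion h i φ' ψ := by
  by_cases hi : 1 ≤ i ∧ i ≤ p
  · refine hat_injective (Y := Y) (funext fun w => ?_)
    rw [hat_add, hat_insertion h hi, hat_insertion h hi, hat_insertion h hi]
    exact hat_add _ _ _
  · simp only [insertion_eq_zero h (show i = 0 ∨ p < i by omega), add_zero]

theorem insertion_smul_left (h : p + q = n + 1) (i : ℕ) (c : k) (φ : B.Cochain N p)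
    (ψ : B.Cochain N q) : Y.insertion h i (c • φ) ψ = c • Y.insertion h i φ ψ := by
  by_cases hi : 1 ≤ i ∧ i ≤ p
  · refine hat_injective (Y := Y) (funext fun w => ?_)
    rw [hat_smul, hat_insertion h hi, hat_insertion h hi]
    exact hat_smul _ _ _
  · simp only [insertion_eq_zero h (show i = 0 ∨ p < i by omega), smul_zero]

theorem insertion_add_right (h : p + q = n + 1) (i : ℕ) (φ : B.Cochain N p) (ψ ψ' : B.Cochain N q) :
    Y.insertion h i φ (ψ + ψ') = Y.insertion h i φ ψ + Y.insertion h i φ ψ' := by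
  by_cases hi : 1 ≤ i ∧ i ≤ p
  · refine hat_injective (Y := Y) (funext fun w => ?_)
    rw [hat_add, hat_insertion h hi, hat_insertion h hi, hat_insertion h hi,
      ← insertAt_add fun w x y => (isSmashCochain_hat φ).add _ _ _ _ (by omega),
      ← Dhat_add (isSmashCochain_hat ψ) (isSmashCochain_hat ψ')]
    congr 2
    funext w
    exact hat_add _ _ _
  · simp only [insertion_eq_zero h (show i = 0 ∨ p < i by omega), add_zero]

theorem insertion_smul_right (h : p + q = n + 1) (i : ℕ) (c : k) (φ : B.Cochain N p)
    (ψ : B.Cochain N q) : Y.insertion h i φ (c • ψ) = c • Y.insertion h i φ ψ := by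
  by_cases hi : 1 ≤ i ∧ i ≤ p
  · refine hat_injective (Y := Y) (funext fun w => ?_)
    rw [hat_smul, hat_insertion h hi, hat_insertion h hi,
      ← insertAt_central (isSmashCochain_hat φ) _ (by omega)]
    congr 1
    funext w
    rw [← Dhat_const_smul (isSmashCochain_hat ψ)]
    congr 1
    funext w
    exact hat_smul _ _ _
  · simp only [insertion_eq_zero h (show i = 0 ∨ p < i by omega), smul_zero]

end

theorem insertion_insertion_of_lt {p q r m m' n : ℕ} (h₁ : p + q = m + 1) (h₂ : m + r = n + 1)
    (h₃ : p + r = m' + 1) (h₄ : m' + q = n + 1) (i j : ℕ) (φ : B.Cochain N p) (ψ : B.Cochain N q)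
    (χ : B.Cochain N r) (hj : 1 ≤ j) (hji : j < i) :
    Y.insertion h₂ j (Y.insertion h₁ i φ ψ) χ =
      Y.insertion h₄ (i + r - 1) (Y.insertion h₃ j φ χ) ψ := by
  refine hat_injective (Y := Y) ?_
  by_cases hi : i ≤ p
  · rw [hat_insertion h₂ (by omega), hat_insertion h₁ (by omega), hat_insertion h₄ (by omega),
      hat_insertion h₃ (by omega), insertAt_insertAt_of_lt
        (isSmashCochain_Dhat (isSmashCochain_hat ψ)).congr
        (isSmashCochain_Dhat (isSmashCochain_hat χ)).congr (by omega)]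
    congr 1
    omega
  · funext w
    rw [insertion_eq_zero h₄ (by omega), hat_zero]
    by_cases hj' : j ≤ m
    · rw [hat_insertion h₂ ⟨hj, hj'⟩, insertion_eq_zero h₁ (by omega), insertAt, hat_zero]
    · rw [insertion_eq_zero h₂ (by omega), hat_zero]

theorem insertion_insertion_of_mem {p q r m m' n : ℕ} (h₁ : p + q = m + 1) (h₂ : m + r = n + 1)
    (h₃ : q + r = m' + 1) (h₄ : p + m' = n + 1) (i j : ℕ) (φ : B.Cochain N p) (ψ : B.Cochain N q)
    (χ : B.Cochain N r) (hi : 1 ≤ i) (hij : i ≤ j) (hj : j < q + i) :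
    Y.insertion h₂ j (Y.insertion h₁ i φ ψ) χ =
      Y.insertion h₄ i φ (Y.insertion h₃ (j - i + 1) ψ χ) := by
  refine hat_injective (Y := Y) ?_
  by_cases hip : i ≤ p
  · rw [hat_insertion h₂ (by omega), hat_insertion h₁ (by omega), hat_insertion h₄ (by omega),
      Dhat_hat_insertion h₃ (by omega), insertAt_insertAt_of_mem
        (isSmashCochain_Dhat (isSmashCochain_hat ψ)).congr (by omega) (by omega),
      show q + r - 1 = m' by omega, show j - 1 - (i - 1) = j - i + 1 - 1 by omega]
  · funext w
    rw [insertion_eq_zero h₄ (by omega), hat_zero]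
    by_cases hj' : j ≤ m
    · rw [hat_insertion h₂ (by omega), insertion_eq_zero h₁ (by omega), insertAt, hat_zero]
    · rw [insertion_eq_zero h₂ (by omega), hat_zero]

/-- This is the case `j < i` read from right to left, with $\psi$ and $\chi$ exchanged; beyond the
arity both sides vanish by convention. -/
theorem insertion_insertion_of_ge {p q r m m' n : ℕ} (h₁ : p + q = m + 1) (h₂ : m + r = n + 1)
    (h₃ : p + r = m' + 1) (h₄ : m' + q = n + 1) (i j : ℕ) (φ : B.Cochain N p) (ψ : B.Cochain N q)
    (χ : B.Cochain N r) (hi : 1 ≤ i) (hij : q + i ≤ j) :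
    Y.insertion h₂ j (Y.insertion h₁ i φ ψ) χ =
      Y.insertion h₄ i (Y.insertion h₃ (j - q + 1) φ χ) ψ := by
  by_cases hj : j ≤ m
  · rw [insertion_insertion_of_lt h₃ h₄ h₁ h₂ _ _ _ _ _ hi (by omega),
      show j - q + 1 + q - 1 = j by omega]
  · refine hat_injective (Y := Y) (funext fun w => ?_)
    rw [insertion_eq_zero h₂ (by omega), hat_zero, insertion_eq_zero h₃ (by omega)]
    by_cases hi' : i ≤ m'
    · rw [hat_insertion h₄ (by omega), insertAt, hat_zero]
    · rw [insertion_eq_zero h₄ (by omega), hat_zero]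

variable (Y) in
/-- The operad with multiplication formed by the cochains. -/
noncomputable def operad : OperadWithMultiplication k (fun p => B.Cochain N p) where
  comp h i := LinearMap.mk₂ k (Y.insertion h i) (insertion_add_left h i) (insertion_smul_left h i)
    (insertion_add_right h i) (insertion_smul_right h i)
  one := ofSmash (Y := Y) _ isSmashCochain_smul_one
  mu := ofSmash (Y := Y) _ isSmashCochain_mul_smul_one
  e := ofSmash (Y := Y) _ (isSmashCochain_const 1)
  comp_eq_zero h i φ ψ hi := insertion_eq_zero h hi φ ψ
  comp_comp_of_lt := insertion_insertion_of_lt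
  comp_comp_of_mem := insertion_insertion_of_mem
  comp_comp_of_ge := insertion_insertion_of_ge
  comp_one {p} h i φ hi hip := by
    refine hat_injective (Y := Y) (funext fun w => ?_)
    rw [LinearMap.mk₂_apply, hat_insertion h ⟨hi, hip⟩, hat_ofSmash, Dhat_unit, insertAt]
    congr 1
    funext j
    split_ifs with h1 h2
    · rfl
    · simp [h2]
    · rfl
  one_comp {p} h φ := by
    refine hat_injective (Y := Y) (funext fun w => ?_)
    rw [LinearMap.mk₂_apply, hat_insertion h (by omega), hat_ofSmash, insertAt]
    simp [Dhat_smul_one (isSmashCochain_hat φ)]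
  mu_comp_mu h := by
    refine hat_injective (Y := Y) (funext fun w => ?_)
    rw [LinearMap.mk₂_apply, LinearMap.mk₂_apply, hat_insertion h (by omega),
      hat_insertion h (by omega), hat_ofSmash, Dhat_mul, insertAt, insertAt]
    simp [mul_assoc]
  mu_comp_e_left h := by
    refine hat_injective (Y := Y) (funext fun w => ?_)
    rw [LinearMap.mk₂_apply, hat_insertion h (by omega), hat_ofSmash, hat_ofSmash, hat_ofSmash,
      insertAt]
    simp [Dhat_one_const]
  mu_comp_e_right h := by
    refine hat_injective (Y := Y) (funext fun w => ?_)
    rw [LinearMap.mk₂_apply, hat_insertion h (by omega), hat_ofSmash, hat_ofSmash, hat_ofSmash,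
      insertAt]
    simp [Dhat_one_const]

variable (Y) in
theorem operad_mu_apply (u : Fin 2 → U) :
    Y.operad.mu.1 u = B.s (B.counit (u 0 * u 1)) • (1 : N) := by
  have : Y.operad.mu.1 u = (ι (padSeq u 0) * ι (padSeq u 1)) • (1 : N) := rfl
  rw [this, ← map_mul, incl_smul, Y.smul_one, ← padSeq_apply u, ← padSeq_apply u]
  rfl

variable (Y) in
theorem operad_one_apply (u : Fin 1 → U) :
    Y.operad.one.1 u = B.s (B.counit (u 0)) • (1 : N) := by
  have : Y.operad.one.1 u = ι (padSeq u 0) • (1 : N) := rfl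
  rw [this, incl_smul, Y.smul_one, ← padSeq_apply u]
  rfl

variable (Y) in
theorem operad_e_apply (u : Fin 0 → U) : Y.operad.e.1 u = 1 := rfl

end YetterDrinfeldAlgebra

/-- As $|\mu|=1$, the general signs of the bracket collapse to those of a coboundary:
$\mu\circ_2\varphi$ is to be the first face, $\varphi\circ_i\mu$ the $i$-th inner face and
$\mu\circ_1\varphi$ the last one. -/
theorem OperadWithMultiplication.bracket_mu {k : Type*} [CommRing k] {O : ℕ → Type*}
    [∀ n, AddCommGroup (O n)] [∀ n, Module k (O n)] (P : OperadWithMultiplication k O) {p : ℕ}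
    (φ : O p) (h : 2 + p = p + 1 + 1) (h' : p + 2 = p + 1 + 1) :
    P.bracket h P.mu φ = P.comp h 2 P.mu φ +
      ∑ i : Fin p, (-1 : ℤ) ^ ((i : ℕ) + 1) • P.comp h' (i + 1) φ P.mu +
      (-1 : ℤ) ^ (p + 1) • P.comp h 1 P.mu φ := by
  have e3 : ((((p : ℤ) - 1).negOnePow : ℤˣ) : ℤ) = (-1) ^ (p + 1) := by
    rw [show (p : ℤ) - 1 = ((p + 1 : ℕ) : ℤ) - 2 by push_cast; ring, Int.negOnePow_sub,
      Int.negOnePow_even 2 even_two, mul_one, Int.negOnePow_def, zpow_natCast]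
    simp
  have h1 : P.compBar h P.mu φ = P.comp h 2 P.mu φ + (-1 : ℤ) ^ (p + 1) • P.comp h 1 P.mu φ := by
    rw [compBar, show Finset.Icc 1 2 = {1, 2} from rfl, Finset.sum_pair (by decide), smul_add,
      smul_smul, smul_smul, ← e3]
    norm_num [Int.units_mul_self, Units.smul_def]
    exact add_comm _ _
  have h2 : (((2 : ℕ) - 1 : ℤ) * ((p : ℤ) - 1)).negOnePow • P.compBar h' φ P.mu =
      ∑ i : Fin p, (-1 : ℤ) ^ (i : ℕ) • P.comp h' (i + 1) φ P.mu := by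
    rw [compBar, smul_smul, mul_comm ((p : ℤ) - 1), Int.units_mul_self, one_smul,
      show Finset.Icc 1 p = Finset.Ico 1 (p + 1) by ext; simp,
      Finset.sum_Ico_eq_sum_range, Nat.add_sub_cancel, ← Fin.sum_univ_eq_sum_range fun i =>
        ((((2 : ℕ) : ℤ) - 1) * (((1 + i : ℕ) : ℤ) - 1)).negOnePow • P.comp h' (1 + i) φ P.mu]
    refine Finset.sum_congr rfl fun i _ => ?_
    rw [show (((2 : ℕ) : ℤ) - 1) * (((1 + i : ℕ) : ℤ) - 1) = ((i : ℕ) : ℤ) by push_cast; ring,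
      Units.smul_def, Int.negOnePow_def, zpow_natCast, add_comm 1]
    simp
  rw [bracket, h1, h2]
  simp only [pow_succ, mul_neg_one, neg_smul, Finset.sum_neg_distrib]
  abel

/-! ### The Sweedler formula for the insertions. -/

namespace YetterDrinfeldAlgebra

open Smash

variable {k : Type w} {A U N : Type v} [CommRing k] [Ring A] [Algebra k A] [Ring U] [Algebra k U]
  {B : LeftBialgebroid k A U} [Ring N] [Algebra k N] [Module U N]
  [IsScalarTower k U N] {Y : YetterDrinfeldAlgebra B N}

local notation "ι" => incl Y
local notation "τ" => target Y
local notation "σ" => source Y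

theorem mk_rmul (v : U) (z : B.BalTensor N) : Smash.mk Y (B.rmul N v z) = Smash.mk Y z * ι v := by
  induction z using B.induction with
  | h0 => simp
  | h u x =>
    change Smash.mk Y (B.tmul (u * v) x) = _
    rw [mk_tmul, mk_tmul, map_mul, mul_assoc]
  | hadd y z hy hz => rw [map_add, map_add, map_add, hy, hz, add_mul]

/-- The sequence `w` with first entries replaced by `ι (x j (f j))`. -/
noncomputable def select (Y : YetterDrinfeldAlgebra B N) {r m : ℕ} (x : Fin r → Fin m → U)
    (w : ℕ → Y.Smash) (f : Fin r → Fin m) (j : ℕ) : Y.Smash :=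
  if h : j < r then incl Y (x ⟨j, h⟩ (f ⟨j, h⟩)) else w j

theorem select_snoc {r m : ℕ} (x : Fin (r + 1) → Fin m → U) (w : ℕ → Y.Smash) (f : Fin r → Fin m)
    (l : Fin m) : select Y x w (Fin.snoc (α := fun _ => Fin m) f l) =
      Function.update (select Y (fun j => x j.castSucc) w f) r (ι (x (Fin.last r) l)) := by
  funext j
  rcases lt_trichotomy j r with h | rfl | h
  · simp [select, h, Nat.lt_succ_of_lt h, h.ne, Fin.snoc]
  · have : (⟨j, Nat.lt_succ_self j⟩ : Fin (j + 1)) = Fin.last j := rfl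
    simp [select, this]
  · simp [select, h.ne', show ¬ j < r + 1 by omega, show ¬ j < r by omega]

theorem update_select {r m : ℕ} (x : Fin r → Fin m → U) (w : ℕ → Y.Smash) (f : Fin r → Fin m)
    {s : ℕ} (hs : r ≤ s) (z : Y.Smash) :
    select Y x (Function.update w s z) f = Function.update (select Y x w f) s z := by
  funext j
  simp only [select, Function.update_apply]
  split_ifs <;> first | rfl | omega

theorem sum_snoc {M : Type*} [AddCommMonoid M] {r m : ℕ} (F : (Fin (r + 1) → Fin m) → M) :
    ∑ f, F f = ∑ l : Fin m, ∑ f : Fin r → Fin m, F (Fin.snoc (α := fun _ => Fin m) f l) := by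
  rw [← Fintype.sum_prod_type']
  exact (Equiv.sum_comp (Fin.snocEquiv fun _ => Fin m) F).symm

theorem prod_ofFn_snoc {r m : ℕ} (y : Fin (r + 1) → Fin m → U) (f : Fin r → Fin m) (l : Fin m) :
    (List.ofFn fun j => y j (Fin.snoc (α := fun _ => Fin m) f l j)).prod =
      (List.ofFn fun j => y j.castSucc (f j)).prod * y (Fin.last r) l := by
  rw [List.ofFn_succ', List.concat_eq_append, List.prod_append]
  simp

/-- This is the origin of the factor $u^1_{(2)}\cdots u^{i-1}_{(2)}n$. Balancing carries $\tau(n)$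
into the preceding argument, where $\iota(u)\tau(n)=\tau(u_{(2)}n)\iota(u_{(1)})$, and so on down to
the first argument, which releases it by linearity. -/
theorem IsSmashCochain.target_mul_eq_sum {p r m : ℕ} {X : Type*} [AddCommGroup X]
    [Module Y.Smash X] {F : (ℕ → Y.Smash) → X}
    (hF : Y.IsSmashCochain p F) (hr : r < p) (n : N) (w : ℕ → Y.Smash) (u : Fin r → U)
    (x y : Fin r → Fin m → U) (h : ∀ j, B.IsRep (x j) (y j) (B.comul (u j)))
    (hw : ∀ j : Fin r, w j = ι (u j)) (z : Y.Smash) :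
    F (Function.update w r (τ n * z)) = ∑ f : Fin r → Fin m,
      τ ((List.ofFn fun j => y j (f j)).prod • n) • F (Function.update (select Y x w f) r z) := by
  induction r generalizing n w z with
  | zero =>
    have e := hF.lin (Function.update w 0 z) n hr
    simp only [Function.update_self, Function.update_idem] at e
    have : ∀ f, select Y x w f = w := fun f => funext fun j => by simp [select]
    simp [e, this]
  | succ r ih =>
    have e := hF.bal (Function.update w (r + 1) z) r n hr
    simp only [Function.update_self, Function.update_idem, Function.update_of_ne
      (show r ≠ r + 1 by omega)] at e
    have hb : B.IsBalanced fun a b : U => τ (b • n) * ι a :=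
      ⟨fun _ _ _ => by rw [map_add, mul_add], fun _ _ _ => by rw [add_smul, map_add, add_mul],
        fun _ _ _ => by rw [smul_eq_mul, mul_smul, target_s_smul, map_mul, mul_assoc]⟩
    have hsum : ∀ (S : Finset (Fin m)) (g : Fin m → Y.Smash) (w : ℕ → Y.Smash),
        F (Function.update w r (∑ l ∈ S, g l)) = ∑ l ∈ S, F (Function.update w r (g l)) :=
      fun S g w => map_sum (AddMonoidHom.mk' (fun z => F (Function.update w r z))
        fun a b => hF.add _ _ _ _ (by omega)) g S
    have hw' : w r = ι (u (Fin.last r)) := hw (Fin.last r)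
    rw [← e, hw', incl_mul_target, hb.sw_eq_sum (h (Fin.last r)), hsum, sum_snoc]
    refine Finset.sum_congr rfl fun l _ => ?_
    rw [ih (by omega) _ _ (fun j => u j.castSucc) (fun j => x j.castSucc) (fun j => y j.castSucc)
      (fun j => h _) fun j => by
        have := hw j.castSucc
        rw [Function.update_of_ne (by omega)]
        exact this]
    refine Finset.sum_congr rfl fun f _ => ?_
    rw [prod_ofFn_snoc, mul_smul, select_snoc, update_select _ _ _ (by omega),
      Function.update_comm (by omega)]

variable [hY : Fact Y.IsBraidedCommutative]

theorem Dhat_eq_sum {q m : ℕ} {φ : (ℕ → Y.Smash) → N} (hφ : Y.IsSmashCochain q φ)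
    (w : ℕ → Y.Smash) (u : Fin q → U) (x y : Fin q → Fin m → U)
    (h : ∀ j, B.IsRep (x j) (y j) (B.comul (u j))) (hw : ∀ j : Fin q, w j = ι (u j)) :
    Y.Dhat q φ w = ∑ f : Fin q → Fin m,
      σ (φ (select Y x w f)) * ι (List.ofFn fun j => y j (f j)).prod := by
  induction q generalizing φ with
  | zero =>
    have : ∀ f, select Y x w f = w := fun f => funext fun j => by simp [select]
    simp [Dhat_zero hφ, this]
  | succ q ih =>
    have hw' : w q = ι (u (Fin.last q)) := hw (Fin.last q)
    rw [← Function.update_eq_self q w, hw', Dhat_succ hφ,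
      (isBalanced_Dhat' hφ w).sw_eq_sum (h (Fin.last q)), sum_snoc]
    refine Finset.sum_congr rfl fun l _ => ?_
    rw [ih (hφ.fixAt _) (fun j => u j.castSucc) (fun j => x j.castSucc) (fun j => y j.castSucc)
      (fun j => h _) fun j => hw j.castSucc, Finset.sum_mul]
    refine Finset.sum_congr rfl fun f _ => ?_
    rw [prod_ofFn_snoc, select_snoc, update_select _ _ _ le_rfl, Function.update_idem, map_mul,
      mul_assoc, fixAt]

theorem Dhat_hat_eq_mk_D {q m : ℕ} (ψ : B.Cochain N q) (w : ℕ → Y.Smash) (u : Fin q → U)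
    (x y : Fin q → Fin m → U) (h : ∀ j, B.IsRep (x j) (y j) (B.comul (u j)))
    (hw : ∀ j : Fin q, w j = ι (u j)) : Y.Dhat q (Y.hat ψ) w = Smash.mk Y (Y.D ψ.1 x y) := by
  rw [Dhat_eq_sum (isSmashCochain_hat ψ) w u x y h hw, D, map_sum]
  refine Finset.sum_congr rfl fun f _ => ?_
  rw [mk_rmul]
  congr 1
  change σ _ = σ _
  congr 1
  rw [← hat_incl_padSeq (Y := Y)]
  exact (isSmashCochain_hat ψ).congr _ _ fun j hj => by simp [select, padSeq, hj]

/-- The inserted operator is expanded as a sum of $\tau(w_l)\iota(d_l)$, and each $\tau(w_l)$ is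
carried to the front by `target_mul_eq_sum`. It ends as a right factor because $\tau$ acts on $N$ by
right multiplication. -/
theorem isInsertion_operad {p q n i : ℕ} (h : p + q = n + 1) (hi : 1 ≤ i) (hip : i ≤ p)
    (φ : B.Cochain N p) (ψ : B.Cochain N q) :
    Y.IsInsertion h hi hip φ.1 ψ.1 (Y.operad.comp h i φ ψ).1 := by
  intro u m m' x y d w hxy hdw
  change (Y.insertion h i φ ψ).1 u = _
  obtain ⟨v, hv⟩ : ∃ v : ℕ → Y.Smash, v = fun j => ι (padSeq u j) := ⟨_, rfl⟩
  have hv' : ∀ (j : ℕ) (hj : j < n), v j = ι (u ⟨j, hj⟩) := fun j hj => by simp [hv, padSeq, hj]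
  have hD : Y.Dhat q (Y.hat ψ) (fun l => v (i - 1 + l)) = ∑ l, τ (w l) * ι (d l) := by
    rw [Dhat_hat_eq_mk_D ψ _ (fun j : Fin q => u ⟨i - 1 + j, by omega⟩)
      (fun j : Fin q => x ⟨i - 1 + j, by omega⟩) (fun j : Fin q => y ⟨i - 1 + j, by omega⟩)
      (fun j => hxy _) fun j => hv' _ _, hdw, map_sum]
    simp only [mk_tmul]
  set v' : ℕ → Y.Smash := fun j => if j < i - 1 then v j else v (j + q - 1) with hv''
  have hupd : ∀ z, (fun j => if j < i - 1 then v j else if j = i - 1 then z else v (j + q - 1)) =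
      Function.update v' (i - 1) z := by
    intro z
    funext j
    simp only [hv'', Function.update_apply]
    split_ifs <;> first | rfl | omega
  have hF := isSmashCochain_hat (Y := Y) φ
  have hsum : ∀ (g : Fin m' → Y.Smash) (w : ℕ → Y.Smash), Y.hat φ (Function.update w (i - 1)
      (∑ l, g l)) = ∑ l, Y.hat φ (Function.update w (i - 1) (g l)) :=
    fun g w => map_sum (AddMonoidHom.mk' (fun z => Y.hat φ (Function.update w (i - 1) z))
      fun a b => hF.add _ _ _ _ (by omega)) g _
  rw [← hat_incl_padSeq (Y := Y), hat_insertion h ⟨hi, hip⟩, ← hv, insertAt, hupd, hD, hsum,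
    Finset.sum_comm]
  refine Finset.sum_congr rfl fun l _ => ?_
  rw [hF.target_mul_eq_sum (by omega) (w l) v' (fun j => u ⟨j, by omega⟩)
    (fun j => x ⟨j, by omega⟩) (fun j => y ⟨j, by omega⟩) (fun j => hxy _) fun j => by
      rw [← hv' j (by omega)]
      simp [hv'']]
  refine Finset.sum_congr rfl fun f _ => ?_
  rw [target_smul]
  congr 1
  rw [← hat_incl_padSeq (Y := Y)]
  refine hF.congr _ _ fun j hj => ?_
  simp only [padSeq, hj, dif_pos, Function.update_apply, select]
  by_cases h1 : j = i - 1
  · simp [h1]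
  by_cases h2 : j < i - 1
  · simp [h1, h2]
  · simp only [hv'', h1, h2, if_false, dif_neg, not_false_eq_true]
    exact hv' _ _

/-! ### The differential -/

theorem hat_mu : Y.hat Y.operad.mu = fun w => (w 0 * w 1) • (1 : N) := hat_ofSmash isSmashCochain_mul_smul_one

theorem incl_smul_one (u : U) : ι u • (1 : N) = ι (B.tgt (B.counit u)) • (1 : N) := by
  rw [incl_smul, incl_smul, Y.smul_one, Y.tgt_smul_one]

/-- The insertion is $\hat D_\varphi(u^1,\dots,u^p)\cdot(u^{p+1}1_N)$. Since
$u1_N=1_N\lhd\varepsilon(u)$, right linearity of $\hat D_\varphi$ pushes $t(\varepsilon(u^{p+1}))$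
into the last argument. For $p=0$ there is no such argument, and the source acts by left
multiplication. -/
theorem mu_comp_fst {p : ℕ} (φ : B.Cochain N p) (h : 2 + p = p + 1 + 1) (u : Fin (p + 1) → U) :
    (Y.operad.comp h 1 Y.operad.mu φ).1 u = B.lastFace φ.1 u := by
  change (Y.insertion h 1 Y.operad.mu φ).1 u = _
  obtain ⟨v, hv⟩ : ∃ v : ℕ → Y.Smash, v = fun j => ι (padSeq u j) := ⟨_, rfl⟩
  have hF := isSmashCochain_hat (Y := Y) φ
  have e : insertAt 0 p (Y.hat Y.operad.mu) (Y.Dhat p (Y.hat φ)) v =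
      Y.Dhat p (Y.hat φ) v • v p • (1 : N) := by
    rw [hat_mu, insertAt]
    simp [mul_smul]
  rw [← hat_incl_padSeq (Y := Y), hat_insertion h (by omega), ← hv, Nat.sub_self, e]
  have hp : v p • (1 : N) = ι (B.tgt (B.counit (u (Fin.last p)))) • (1 : N) := by
    rw [← incl_smul_one, hv, ← padSeq_apply u]
    rfl
  rw [hp]
  cases p with
  | zero =>
    rw [Dhat_zero hF, source_smul, incl_smul, ← Y.mul_right, mul_one, LeftBialgebroid.lastFace,
      ← hat_incl_padSeq (Y := Y)]
    congr 1
    exact hF.congr _ _ (by simp)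
  | succ p =>
    rw [← target_s_one, ← mul_smul, ← Dhat_mul_target hF, Dhat_smul_one hF, target_s_one, LeftBialgebroid.lastFace,
      ← hat_incl_padSeq (Y := Y)]
    refine hF.congr _ _ fun j hj => ?_
    rw [padSeq_update]
    have hv2 : ∀ (j : ℕ) (hj : j < p + 1), v j = ι (padSeq (Fin.init u) j) := fun j hj => by
      simp only [hv, padSeq, hj, Fin.init, show j < p + 1 + 1 by omega, dif_pos]
      rfl
    by_cases hjp : j = p
    · subst hjp
      simp only [Function.update_self, Fin.val_last]
      rw [map_mul, hv2 _ hj]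
      congr 2
      simp [padSeq, Fin.init, Fin.last]
    · rw [Function.update_of_ne hjp, Function.update_of_ne (by simpa using hjp), hv2 _ hj]

theorem mu_comp_snd {p : ℕ} (φ : B.Cochain N p) (h : 2 + p = p + 1 + 1) (u : Fin (p + 1) → U) :
    (Y.operad.comp h 2 Y.operad.mu φ).1 u = u 0 • φ.1 (Fin.tail u) := by
  change (Y.insertion h 2 Y.operad.mu φ).1 u = _
  rw [← hat_incl_padSeq (Y := Y), hat_insertion h (by omega), hat_mu, insertAt]
  have hF := isSmashCochain_hat (Y := Y) φ
  simp only [mul_smul, Nat.add_one_sub_one, zero_lt_one, lt_irrefl, if_true, if_false,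
    Dhat_smul_one hF, incl_smul]
  congr 1
  rw [← hat_incl_padSeq (Y := Y)]
  refine hF.congr _ _ fun j hj => ?_
  simp [padSeq, hj, Fin.tail, show 1 + j < p + 1 by omega]
  congr 2
  ext
  simp [add_comm]

theorem comp_mu {p : ℕ} (φ : B.Cochain N p) (h : p + 2 = p + 1 + 1) (i : Fin p)
    (u : Fin (p + 1) → U) : (Y.operad.comp h (i + 1) φ Y.operad.mu).1 u =
      φ.1 (Fin.contractNth i.castSucc (· * ·) u) := by
  change (Y.insertion h (i + 1) φ Y.operad.mu).1 u = _
  rw [← hat_incl_padSeq (Y := Y), hat_insertion h (by omega), hat_mu, Dhat_mul, insertAt,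
    ← hat_incl_padSeq (Y := Y)]
  refine (isSmashCochain_hat φ).congr _ _ fun j hj => ?_
  have hi := i.2
  simp only [padSeq, hj, dif_pos, Fin.contractNth, Nat.add_one_sub_one, Fin.val_castSucc]
  rcases lt_trichotomy j i with h1 | rfl | h1
  · simp [h1, show j < p + 1 by omega]
  · simp only [lt_irrefl, if_true, if_false, add_zero, dif_pos, show (i : ℕ) < p + 1 by omega,
      show (i : ℕ) + 1 < p + 1 by omega, map_mul]
    rfl
  · simp only [show ¬ j < i by omega, h1.ne', if_false, Nat.add_lt_add_iff_right,
      hj, dif_pos]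
    rfl

theorem differential_eq {p : ℕ} (φ : B.Cochain N p) (h : 2 + p = p + 1 + 1)
    (h' : p + 2 = p + 1 + 1) : B.differential N p φ = Y.operad.comp h 2 Y.operad.mu φ +
      ∑ i : Fin p, (-1 : ℤ) ^ ((i : ℕ) + 1) • Y.operad.comp h' (i + 1) φ Y.operad.mu +
      (-1 : ℤ) ^ (p + 1) • Y.operad.comp h 1 Y.operad.mu φ := by
  refine Subtype.ext (funext fun u => ?_)
  obtain ⟨ev, hev⟩ : ∃ ev : B.Cochain N (p + 1) →+ N, ∀ φ, ev φ = φ.1 u :=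
    ⟨AddMonoidHom.mk' (fun φ => φ.1 u) fun _ _ => rfl, fun _ => rfl⟩
  rw [← hev, ← hev, map_add, map_add, map_sum, map_zsmul]
  simp only [hev]
  change B.coboundary φ.1 u = (Y.operad.comp h 2 Y.operad.mu φ).1 u + ∑ i : Fin p,
    (-1 : ℤ) ^ ((i : ℕ) + 1) • (Y.operad.comp h' (i + 1) φ Y.operad.mu).1 u +
      (-1 : ℤ) ^ (p + 1) • (Y.operad.comp h 1 Y.operad.mu φ).1 u
  simp only [mu_comp_fst, mu_comp_snd, comp_mu, LeftBialgebroid.coboundary]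

theorem differential_eq_bracket {p : ℕ} (φ : B.Cochain N p) (h : 2 + p = p + 1 + 1) :
    B.differential N p φ = Y.operad.bracket h Y.operad.mu φ := by
  rw [Y.operad.bracket_mu φ h (by omega), differential_eq (Y := Y) φ h (by omega)]

end YetterDrinfeldAlgebra

/-! ### The total space of an operad -/

/-- The sign `(-1)ⁿ`. -/
def sg (k : Type*) [CommRing k] (n : ℤ) : k := ((n.negOnePow : ℤ) : k)

section Sign

variable {k : Type*} [CommRing k]

theorem sg_add (m n : ℤ) : sg k (m + n) = sg k m * sg k n := by
  simp [sg, Int.negOnePow_add]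

theorem sg_even {n : ℤ} (h : Even n) : sg k n = 1 := by
  simp [sg, Int.negOnePow_even n h]

theorem sg_zero : sg k 0 = 1 := sg_even (by simp)

theorem sg_one : sg k 1 = -1 := by simp [sg]

theorem sg_mul_self (n : ℤ) : sg k n * sg k n = 1 := by
  rw [← sg_add]
  exact sg_even ⟨n, rfl⟩

theorem sg_congr {m n : ℤ} (h : Even (m - n)) : sg k m = sg k n := by
  rw [show m = (m - n) + n by ring, sg_add, sg_even h, one_mul]

theorem sg_neg (n : ℤ) : sg k (-n) = sg k n := sg_congr ⟨-n, by ring⟩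

theorem sg_smul {M : Type*} [AddCommGroup M] [Module k M] (n : ℤ) (x : M) :
    sg k n • x = n.negOnePow • x := by
  rw [sg, Units.smul_def, Int.cast_smul_eq_zsmul]

theorem sg_smul_smul {M : Type*} [AddCommGroup M] [Module k M] (n : ℤ) (x : M) :
    sg k n • sg k n • x = x := by
  rw [smul_smul, sg_mul_self, one_smul]

end Sign

namespace OperadWithMultiplication

variable {k : Type*} [CommRing k] {O : ℕ → Type*} [∀ n, AddCommGroup (O n)]
  [∀ n, Module k (O n)] (P : OperadWithMultiplication k O)

/-- The signed insertion at the slot `i`, counted from `0`, on the direct sum of the operad. -/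
noncomputable def circ (i : ℤ) : (⨁ n, O n) →ₗ[k] (⨁ n, O n) →ₗ[k] ⨁ n, O n :=
  DirectSum.toModule k ℕ _ fun p => LinearMap.flip (DirectSum.toModule k ℕ _ fun q =>
    -- The default value covers negative slots and $p=q=0$, where the target would have arity $-1$.
    -- Slots from $p$ on give zero through `comp_eq_zero`.
    LinearMap.flip (if h : 0 ≤ i ∧ 1 ≤ p + q then sg k (((q : ℤ) - 1) * i) •
      (P.comp (show p + q = (p + q - 1) + 1 by omega) (i.toNat + 1)).compr₂
        (DirectSum.lof k ℕ O (p + q - 1)) else 0))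

/-- The elements of shifted degree `a`, that is, of arity `a + 1`. -/
def IsHom (a : ℤ) (x : ⨁ n, O n) : Prop :=
  x = 0 ∨ ∃ (p : ℕ) (φ : O p), (p : ℤ) = a + 1 ∧ x = DirectSum.of O p φ

theorem isHom_of (p : ℕ) (φ : O p) : IsHom ((p : ℤ) - 1) (DirectSum.of O p φ) :=
  Or.inr ⟨p, φ, by omega, rfl⟩

variable {P} {a b c : ℤ} {x y z : ⨁ n, O n}

theorem IsHom.zero : IsHom a (0 : ⨁ n, O n) := Or.inl rfl

theorem IsHom.add (hx : IsHom a x) (hy : IsHom a y) : IsHom a (x + y) := by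
  rcases hx with rfl | ⟨p, φ, hp, rfl⟩
  · rwa [zero_add]
  rcases hy with rfl | ⟨q, ψ, hq, rfl⟩
  · rw [add_zero]
    exact Or.inr ⟨p, φ, hp, rfl⟩
  · obtain rfl : p = q := by omega
    exact Or.inr ⟨p, φ + ψ, hp, (map_add _ _ _).symm⟩

theorem IsHom.smul (hx : IsHom a x) (r : k) : IsHom a (r • x) := by
  rcases hx with rfl | ⟨p, φ, hp, rfl⟩
  · rw [smul_zero]; exact IsHom.zero
  · exact Or.inr ⟨p, r • φ, hp, ((DirectSum.lof k ℕ O p).map_smul r φ).symm⟩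

theorem IsHom.neg (hx : IsHom a x) : IsHom a (-x) := by
  rcases hx with rfl | ⟨p, φ, hp, rfl⟩
  · rw [neg_zero]; exact IsHom.zero
  · exact Or.inr ⟨p, -φ, hp, (map_neg _ _).symm⟩

theorem IsHom.sub (hx : IsHom a x) (hy : IsHom a y) : IsHom a (x - y) := by
  rw [sub_eq_add_neg]
  exact hx.add hy.neg

theorem IsHom.sum {κ : Type*} {S : Finset κ} {f : κ → ⨁ n, O n} (h : ∀ i ∈ S, IsHom a (f i)) :
    IsHom a (∑ i ∈ S, f i) := by
  classical
  induction S using Finset.induction_on with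
  | empty => exact IsHom.zero
  | insert i S hi ih =>
    rw [Finset.sum_insert hi]
    exact (h i (by simp)).add (ih fun j hj => h j (by simp [hj]))

theorem circ_of {p q n : ℕ} (h : p + q = n + 1) {i : ℤ} (hi : 0 ≤ i) (φ : O p) (ψ : O q) :
    P.circ i (DirectSum.of O p φ) (DirectSum.of O q ψ) =
      sg k (((q : ℤ) - 1) * i) • DirectSum.of O n (P.comp h (i.toNat + 1) φ ψ) := by
  obtain rfl : n = p + q - 1 := by omega
  change P.circ i (DirectSum.lof k ℕ O p φ) (DirectSum.lof k ℕ O q ψ) = _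
  rw [circ, DirectSum.toModule_lof, LinearMap.flip_apply, DirectSum.toModule_lof,
    dif_pos (by omega)]
  rfl

theorem circ_of_zero (i : ℤ) (φ : O 0) (ψ : O 0) :
    P.circ i (DirectSum.of O 0 φ) (DirectSum.of O 0 ψ) = 0 := by
  change P.circ i (DirectSum.lof k ℕ O 0 φ) (DirectSum.lof k ℕ O 0 ψ) = _
  rw [circ, DirectSum.toModule_lof, LinearMap.flip_apply, DirectSum.toModule_lof,
    dif_neg (by omega)]
  rfl

theorem circ_eq_zero (hx : IsHom a x) {i : ℤ} (hi : i < 0 ∨ a < i) (y : ⨁ n, O n) :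
    P.circ i x y = 0 := by
  rcases hx with rfl | ⟨p, φ, hp, rfl⟩
  · simp
  induction y using DirectSum.induction_on with
  | zero => simp
  | add y z hy hz => rw [map_add, hy, hz, add_zero]
  | of q ψ =>
    rcases hi with hi | hi
    · change P.circ i (DirectSum.lof k ℕ O p φ) (DirectSum.lof k ℕ O q ψ) = _
      rw [circ, DirectSum.toModule_lof, LinearMap.flip_apply, DirectSum.toModule_lof,
        dif_neg (by omega)]
      rfl
    · rcases Nat.eq_zero_or_pos (p + q) with h | h
      · obtain rfl : p = 0 := by omega
        obtain rfl : q = 0 := by omega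
        exact circ_of_zero i φ ψ
      · rw [circ_of (show p + q = (p + q - 1) + 1 by omega) (by omega), P.comp_eq_zero _ _ _ _
          (by omega), map_zero, smul_zero]

theorem IsHom.circ (hx : IsHom a x) (hy : IsHom b y) (i : ℤ) : IsHom (a + b) (P.circ i x y) := by
  by_cases hi : i < 0 ∨ a < i
  · rw [circ_eq_zero hx hi]
    exact IsHom.zero
  rcases hx with rfl | ⟨p, φ, hp, rfl⟩
  · simpa using IsHom.zero
  rcases hy with rfl | ⟨q, ψ, hq, rfl⟩
  · simpa using IsHom.zero
  rw [circ_of (show p + q = (p + q - 1) + 1 by omega) (by omega)]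
  exact IsHom.smul (Or.inr ⟨_, _, by omega, rfl⟩) _

/-- Nested insertions. -/
theorem circ_circ_nested (x : ⨁ n, O n) (hy : IsHom b y) (z : ⨁ n, O n) {i j : ℤ} (hi : 0 ≤ i)
    (hij : i ≤ j) (hj : j ≤ i + b) :
    P.circ j (P.circ i x y) z = P.circ i x (P.circ (j - i) y z) := by
  rcases hy with rfl | ⟨q, ψ, hq, rfl⟩
  · simp
  induction x using DirectSum.induction_on with
  | zero => simp
  | add x x' hx hx' => simp only [map_add, LinearMap.add_apply, hx, hx']
  | of p φ =>
    induction z using DirectSum.induction_on with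
    | zero => simp
    | add z z' hz hz' => simp only [map_add, hz, hz']
    | of r χ =>
      have h₁ : p + q = (p + q - 1) + 1 := by omega
      have h₃ : q + r = (q + r - 1) + 1 := by omega
      rw [circ_of h₁ hi, circ_of h₃ (by omega), map_smul, map_smul, LinearMap.smul_apply]
      by_cases hip : i < p
      · have h₂ : (p + q - 1) + r = (p + q + r - 2) + 1 := by omega
        have h₄ : p + (q + r - 1) = (p + q + r - 2) + 1 := by omega
        rw [circ_of h₂ (by omega), circ_of h₄ hi, P.comp_comp_of_mem h₁ h₂ h₃ h₄ _ _ _ _ _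
          (by omega) (by omega) (by omega), show j.toNat + 1 - (i.toNat + 1) + 1 =
            (j - i).toNat + 1 by omega, smul_smul, smul_smul, ← sg_add, ← sg_add]
        congr 1
        -- The exponents are equal: $|q|i+|r|j=(|q|+|r|)i+|r|(j-i)$. The signs in `circ` are chosen
        -- so that nested insertions need none.
        refine sg_congr ⟨0, ?_⟩
        rw [show ((q + r - 1 : ℕ) : ℤ) = q + r - 1 by omega]
        ring
      · rw [P.comp_eq_zero h₁ _ _ _ (by omega), map_zero, map_zero, LinearMap.zero_apply, smul_zero,
          circ_eq_zero (isHom_of p φ) (by omega), smul_zero]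

/-- Parallel insertions. -/
theorem circ_circ_parallel (x : ⨁ n, O n) (hy : IsHom b y) (hz : IsHom c z) {i j : ℤ}
    (hji : j < i) :
    P.circ j (P.circ i x y) z = sg k (b * c) • P.circ (i + c) (P.circ j x z) y := by
  rcases hy with rfl | ⟨q, ψ, hq, rfl⟩
  · simp
  rcases hz with rfl | ⟨r, χ, hr, rfl⟩
  · simp
  induction x using DirectSum.induction_on with
  | zero => simp
  | add x x' hx hx' => simp only [map_add, LinearMap.add_apply, hx, hx', smul_add]
  | of p φ =>
    by_cases hj : 0 ≤ j
    swap
    · rw [circ_eq_zero (isHom_of p φ) (i := j) (by omega), map_zero, LinearMap.zero_apply, smul_zero,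
        circ_eq_zero ((isHom_of p φ).circ (isHom_of q ψ) i) (by omega)]
    by_cases hi : i < p
    swap
    · rw [circ_eq_zero (isHom_of p φ) (i := i) (by omega), map_zero, LinearMap.zero_apply,
        circ_eq_zero ((isHom_of p φ).circ (isHom_of r χ) j) (by omega), smul_zero]
    have h₁ : p + q = (p + q - 1) + 1 := by omega
    have h₃ : p + r = (p + r - 1) + 1 := by omega
    have h₂ : (p + q - 1) + r = (p + q + r - 2) + 1 := by omega
    have h₄ : (p + r - 1) + q = (p + q + r - 2) + 1 := by omega
    rw [circ_of h₁ (by omega), circ_of h₃ (by omega), map_smul, map_smul, LinearMap.smul_apply,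
      LinearMap.smul_apply, circ_of h₂ (by omega), circ_of h₄ (by omega),
      P.comp_comp_of_lt h₁ h₂ h₃ h₄ _ _ _ _ _ (by omega) (by omega),
      show i.toNat + 1 + r - 1 = (i + c).toNat + 1 by omega, smul_smul, smul_smul, smul_smul,
      ← sg_add, ← sg_add, ← sg_add]
    congr 1
    -- The shift of the slot of $\psi$ by $c$ contributes $bc$, and so does the sign in front; the
    -- exponents differ by the even number $2bc$.
    refine sg_congr ⟨-(b * c), ?_⟩
    rw [show (q : ℤ) - 1 = b by omega, show (r : ℤ) - 1 = c by omega]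
    ring

/-- The multiplication, in the direct sum. -/
noncomputable def muT (P : OperadWithMultiplication k O) : ⨁ n, O n := DirectSum.of O 2 P.mu

theorem isHom_muT : IsHom 1 P.muT := isHom_of 2 P.mu

/-- This is $\mu\circ_1\mu=\mu\circ_2\mu$; the signed insertion in the second slot carries $-1$
because $|\mu|=1$. -/
theorem circ_muT_muT : P.circ 1 P.muT P.muT = -P.circ 0 P.muT P.muT := by
  rw [muT, circ_of (show 2 + 2 = 3 + 1 by omega) le_rfl,
    circ_of (show 2 + 2 = 3 + 1 by omega) zero_le_one, Int.toNat_zero, zero_add, P.mu_comp_mu,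
    Int.toNat_one]
  norm_num [sg_zero, sg_one]

end OperadWithMultiplication

/-! ### The pre-Lie product and the second brace operation -/

section IntervalSums

variable {M : Type*} [AddCommMonoid M]

theorem Int.sum_Ico_consecutive {u v w : ℤ} (huv : u ≤ v) (hvw : v ≤ w) (f : ℤ → M) :
    ∑ j ∈ Finset.Ico u w, f j = ∑ j ∈ Finset.Ico u v, f j + ∑ j ∈ Finset.Ico v w, f j := by
  rw [← Finset.sum_union (Finset.disjoint_left.2 fun j h h' => by
    simp only [Finset.mem_Ico] at h h'; omega)]
  refine Finset.sum_congr ?_ fun _ _ => rfl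
  ext j
  simp only [Finset.mem_union, Finset.mem_Ico]
  omega

theorem Int.sum_Ico_add (u v c : ℤ) (f : ℤ → M) :
    ∑ j ∈ Finset.Ico (u + c) (v + c), f j = ∑ j ∈ Finset.Ico u v, f (j + c) := by
  refine (Finset.sum_nbij' (· + c) (· - c) ?_ ?_ ?_ ?_ ?_).symm <;> intro j <;>
    simp only [Finset.mem_Ico] <;> intros <;> first | omega | trivial

/-- After insertion of an element of arity $b+1$ in slot $i$, the slots are those before $i$, the
$b+1$ slots of the inserted element, and those after $i$ shifted by $b$. The value $b=-1$ is allowed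
and deletes the slot. -/
theorem Int.sum_Ico_insert {u v b i : ℤ} (hu : u ≤ i) (hv : i < v) (hb : -1 ≤ b) (f : ℤ → M) :
    ∑ j ∈ Finset.Ico u (v + b), f j = ∑ j ∈ Finset.Ico u i, f j +
      ∑ j ∈ Finset.Ico 0 (b + 1), f (i + j) + ∑ j ∈ Finset.Ico (i + 1) v, f (j + b) := by
  rw [Int.sum_Ico_consecutive hu (show i ≤ v + b by omega),
    Int.sum_Ico_consecutive (show i ≤ i + 1 + b by omega) (show i + 1 + b ≤ v + b by omega),
    Int.sum_Ico_add (i + 1) v b, show i + 1 + b = (b + 1) + i by ring,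
    add_assoc (∑ j ∈ Finset.Ico u i, f j)]
  nth_rewrite 2 [show i = 0 + i by ring]
  rw [Int.sum_Ico_add]
  simp only [add_comm i]

theorem Int.sum_sum_Ico_comm (g : ℤ) (f : ℤ → ℤ → M) :
    ∑ i ∈ Finset.Ico 0 g, ∑ j ∈ Finset.Ico (i + 1) g, f i j =
      ∑ j ∈ Finset.Ico 0 g, ∑ i ∈ Finset.Ico 0 j, f i j := by
  refine Finset.sum_comm' fun i j => ?_
  simp only [Finset.mem_Ico]
  omega

end IntervalSums

namespace OperadWithMultiplication

variable {k : Type*} [CommRing k] {O : ℕ → Type*} [∀ n, AddCommGroup (O n)]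
  [∀ n, Module k (O n)] (P : OperadWithMultiplication k O)

/-- The signed sum of all insertions. -/
noncomputable def pre : (⨁ n, O n) →ₗ[k] (⨁ n, O n) →ₗ[k] ⨁ n, O n :=
  DirectSum.toModule k ℕ _ fun p =>
    ∑ i ∈ Finset.Ico (0 : ℤ) p, (P.circ i).comp (DirectSum.lof k ℕ O p)

/-- The brace operation `x{y, z}`, for `x` of shifted degree `g`. -/
noncomputable def brace (g : ℤ) (x y z : ⨁ n, O n) : ⨁ n, O n :=
  ∑ i ∈ Finset.Ico 0 (g + 1), ∑ j ∈ Finset.Ico 0 i, P.circ j (P.circ i x z) y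

variable {P} {a b c g r : ℤ} {x y z α β γ ρ : ⨁ n, O n}

theorem IsHom.eq_zero (hx : IsHom a x) (ha : a < -1) : x = 0 := by
  rcases hx with rfl | ⟨p, φ, hp, rfl⟩
  · rfl
  · omega

theorem pre_eq (hx : IsHom a x) (y : ⨁ n, O n) :
    P.pre x y = ∑ i ∈ Finset.Ico 0 (a + 1), P.circ i x y := by
  rcases hx with rfl | ⟨p, φ, hp, rfl⟩
  · simp
  rw [← hp]
  change P.pre (DirectSum.lof k ℕ O p φ) y = _
  rw [pre, DirectSum.toModule_lof, LinearMap.sum_apply, LinearMap.sum_apply]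
  rfl

theorem IsHom.pre (hx : IsHom a x) (hy : IsHom b y) : IsHom (a + b) (P.pre x y) := by
  rw [pre_eq hx]
  exact IsHom.sum fun i _ => hx.circ hy i

theorem IsHom.brace (hx : IsHom a x) (hy : IsHom b y) (hz : IsHom c z) (g : ℤ) :
    IsHom (a + b + c) (P.brace g x y z) := by
  rw [show a + b + c = a + c + b by ring]
  exact IsHom.sum fun i _ => IsHom.sum fun j _ => (hx.circ hz i).circ hy j

theorem brace_sum_left {κ : Type*} (S : Finset κ) (f : κ → ⨁ n, O n) (y z : ⨁ n, O n) :
    P.brace g (∑ l ∈ S, f l) y z = ∑ l ∈ S, P.brace g (f l) y z := by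
  simp only [brace, map_sum, LinearMap.sum_apply]
  rw [Finset.sum_comm (s := S)]
  exact Finset.sum_congr rfl fun i _ => Finset.sum_comm

/-- The pre-Lie identity. -/
theorem pre_pre (hx : IsHom a x) (hy : IsHom b y) (hz : IsHom c z) :
    P.pre (P.pre x y) z = P.pre x (P.pre y z) + P.brace a x z y +
      sg k (b * c) • P.brace a x y z := by
  by_cases hb : b < -1
  · obtain rfl := hy.eq_zero hb
    simp [brace]
  -- With $y$ in slot $i$ of $x$, the element $z$ goes before $y$, into $y$, or after $y$. The first
  -- and third kinds add up to the two braces.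
  have e : ∀ i ∈ Finset.Ico 0 (a + 1), P.pre (P.circ i x y) z =
      ∑ j ∈ Finset.Ico 0 i, P.circ j (P.circ i x y) z + P.circ i x (P.pre y z) +
        ∑ j ∈ Finset.Ico (i + 1) (a + 1), sg k (b * c) • P.circ i (P.circ j x z) y := by
    intro i hi
    rw [Finset.mem_Ico] at hi
    rw [pre_eq (hx.circ hy i), show a + b + 1 = a + 1 + b by ring,
      Int.sum_Ico_insert hi.1 hi.2 (by omega), pre_eq hy, map_sum]
    refine congr_arg₂ _ (congr_arg₂ _ rfl (Finset.sum_congr rfl fun j hj => ?_))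
      (Finset.sum_congr rfl fun j hj => ?_)
    · rw [Finset.mem_Ico] at hj
      rw [circ_circ_nested x hy z hi.1 (by omega) (by omega), add_sub_cancel_left]
    · rw [Finset.mem_Ico] at hj
      rw [circ_circ_parallel x hz hy (show i < j by omega), mul_comm b, sg_smul_smul]
  rw [pre_eq hx, map_sum, LinearMap.sum_apply, Finset.sum_congr rfl e, Finset.sum_add_distrib,
    Finset.sum_add_distrib, ← pre_eq hx, Int.sum_sum_Ico_comm, brace, brace, Finset.smul_sum]
  simp only [Finset.smul_sum]
  abel

/-- The sum of the insertions of `α`, `β` (in this order) and `ρ` in different slots of `γ`. -/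
noncomputable def brace₃ (P : OperadWithMultiplication k O) (g a b : ℤ) (γ α β ρ : ⨁ n, O n) :
    ⨁ n, O n :=
  ∑ i ∈ Finset.Ico 0 (g + 1), ∑ j ∈ Finset.Ico 0 i,
    (∑ l ∈ Finset.Ico 0 j, P.circ l (P.circ j (P.circ i γ β) α) ρ +
      ∑ l ∈ Finset.Ico (j + 1) i, P.circ (l + a) (P.circ j (P.circ i γ β) α) ρ +
      ∑ l ∈ Finset.Ico (i + 1) (g + 1), P.circ (l + b + a) (P.circ j (P.circ i γ β) α) ρ)

/-- The element $\rho$ enters $\alpha$, enters $\beta$, or takes a further slot of $\gamma$. The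
last kind is recorded as `brace₃` without evaluating it: the same sum occurs in `brace_pre`, and the
two cancel in `brk_scup`. -/
theorem pre_brace (hγ : IsHom g γ) (hα : IsHom a α) (hβ : IsHom b β) (hρ : IsHom r ρ) :
    P.pre (P.brace g γ α β) ρ = P.brace g γ (P.pre α ρ) β +
      sg k (r * a) • P.brace g γ α (P.pre β ρ) + P.brace₃ g a b γ α β ρ := by
  by_cases ha : a < -1
  · obtain rfl := hα.eq_zero ha
    simp [brace, brace₃]
  by_cases hb : b < -1
  · obtain rfl := hβ.eq_zero hb
    simp [brace, brace₃]
  have e : ∀ i ∈ Finset.Ico 0 (g + 1), ∀ j ∈ Finset.Ico 0 i,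
      P.pre (P.circ j (P.circ i γ β) α) ρ = P.circ j (P.circ i γ β) (P.pre α ρ) +
        sg k (r * a) • P.circ j (P.circ i γ (P.pre β ρ)) α +
        (∑ l ∈ Finset.Ico 0 j, P.circ l (P.circ j (P.circ i γ β) α) ρ +
      ∑ l ∈ Finset.Ico (j + 1) i, P.circ (l + a) (P.circ j (P.circ i γ β) α) ρ +
      ∑ l ∈ Finset.Ico (i + 1) (g + 1), P.circ (l + b + a) (P.circ j (P.circ i γ β) α) ρ) := by
    intro i hi j hj
    rw [Finset.mem_Ico] at hi hj
    rw [pre_eq ((hγ.circ hβ i).circ hα j), show g + b + a + 1 = g + 1 + b + a by ring,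
      Int.sum_Ico_insert hj.1 (by omega) (by omega),
      Int.sum_Ico_insert (show j + 1 ≤ i by omega) hi.2 (by omega), pre_eq hα, pre_eq hβ]
    have e1 : ∑ l ∈ Finset.Ico 0 (a + 1), P.circ (j + l) (P.circ j (P.circ i γ β) α) ρ =
        ∑ l ∈ Finset.Ico 0 (a + 1), P.circ j (P.circ i γ β) (P.circ l α ρ) := by
      refine Finset.sum_congr rfl fun l hl => ?_
      rw [Finset.mem_Ico] at hl
      rw [circ_circ_nested _ hα ρ hj.1 (by omega) (by omega), add_sub_cancel_left]
    have e2 : ∑ l ∈ Finset.Ico 0 (b + 1), P.circ (i + l + a) (P.circ j (P.circ i γ β) α) ρ =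
        ∑ l ∈ Finset.Ico 0 (b + 1),
          sg k (r * a) • P.circ j (P.circ i γ (P.circ l β ρ)) α := by
      refine Finset.sum_congr rfl fun l hl => ?_
      rw [Finset.mem_Ico] at hl
      have h := circ_circ_nested (P := P) γ hβ ρ hi.1 (show i ≤ i + l by omega) (by omega)
      rw [add_sub_cancel_left] at h
      rw [← h, circ_circ_parallel _ hρ hα (show j < i + l by omega), sg_smul_smul]
    rw [e1, e2]
    simp only [map_sum, LinearMap.sum_apply, Finset.smul_sum]
    abel
  simp only [brace, brace₃, map_sum, LinearMap.sum_apply]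
  rw [Finset.sum_congr rfl fun i hi => Finset.sum_congr rfl (e i hi)]
  simp only [Finset.sum_add_distrib, Finset.smul_sum]

/-- The elements $\alpha$ and $\beta$ are inserted in this order into $\gamma\circ\rho$: both enter
$\rho$, or only $\beta$, or only $\alpha$, or neither. The last case consists of insertions in three
different slots of $\gamma$, hence is `brace₃` up to sign. -/
theorem brace_pre (hγ : IsHom g γ) (hα : IsHom a α) (hβ : IsHom b β) (hρ : IsHom r ρ) :
    P.brace (g + r) (P.pre γ ρ) α β = P.pre γ (P.brace r ρ α β) + P.brace g γ α (P.pre ρ β) +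
      sg k (r * b) • P.brace g γ (P.pre ρ α) β +
      sg k (r * (a + b)) • P.brace₃ g a b γ α β ρ := by
  by_cases hr : r < -1
  · obtain rfl := hρ.eq_zero hr
    simp [brace, brace₃]
  by_cases hb : b < -1
  · obtain rfl := hβ.eq_zero hb
    simp [brace, brace₃]
  set f : ℤ → ℤ → ℤ → ⨁ n, O n := fun l j i => P.circ l (P.circ j (P.circ i γ β) α) ρ with hf
  have e : ∀ l ∈ Finset.Ico 0 (g + 1), P.brace (g + r) (P.circ l γ ρ) α β =
      P.circ l γ (P.brace r ρ α β) + ∑ j ∈ Finset.Ico 0 l, P.circ j (P.circ l γ (P.pre ρ β)) α +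
      ∑ i ∈ Finset.Ico (l + 1) (g + 1), sg k (r * b) • P.circ l (P.circ i γ β) (P.pre ρ α) +
      (∑ i ∈ Finset.Ico 0 l, ∑ j ∈ Finset.Ico 0 i, sg k (r * (a + b)) • f (l + b + a) j i +
      ∑ i ∈ Finset.Ico (l + 1) (g + 1), (∑ j ∈ Finset.Ico 0 l, sg k (r * (a + b)) • f (l + a) j i +
        ∑ j ∈ Finset.Ico (l + 1) i, sg k (r * (a + b)) • f l j i)) := by
    intro l hl
    rw [Finset.mem_Ico] at hl
    have e1 : ∀ i ∈ Finset.Ico 0 l, ∑ j ∈ Finset.Ico 0 i,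
        P.circ j (P.circ i (P.circ l γ ρ) β) α =
          ∑ j ∈ Finset.Ico 0 i, sg k (r * (a + b)) • f (l + b + a) j i := by
      intro i hi
      refine Finset.sum_congr rfl fun j hj => ?_
      rw [Finset.mem_Ico] at hi hj
      rw [circ_circ_parallel γ hρ hβ hi.2, map_smul, LinearMap.smul_apply,
        circ_circ_parallel _ hρ hα (show j < l + b by omega), smul_smul, ← sg_add, mul_add,
        add_comm (r * a)]
    have e2 : ∀ s ∈ Finset.Ico 0 (r + 1), ∑ j ∈ Finset.Ico 0 (l + s),
        P.circ j (P.circ (l + s) (P.circ l γ ρ) β) α =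
          ∑ j ∈ Finset.Ico 0 l, P.circ j (P.circ l γ (P.circ s ρ β)) α +
            ∑ t ∈ Finset.Ico 0 s, P.circ l γ (P.circ t (P.circ s ρ β) α) := by
      intro s hs
      rw [Finset.mem_Ico] at hs
      rw [circ_circ_nested γ hρ β hl.1 (by omega) (by omega), add_sub_cancel_left,
        Int.sum_Ico_consecutive hl.1 (show l ≤ l + s by omega)]
      congr 1
      nth_rewrite 1 [show l = 0 + l by ring]
      rw [add_comm l s, Int.sum_Ico_add]
      refine Finset.sum_congr rfl fun t ht => ?_
      rw [Finset.mem_Ico] at ht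
      rw [circ_circ_nested γ (hρ.circ hβ s) α hl.1 (by omega) (by omega), add_sub_cancel_right]
    have e3 : ∀ i ∈ Finset.Ico (l + 1) (g + 1), ∑ j ∈ Finset.Ico 0 (i + r),
        P.circ j (P.circ (i + r) (P.circ l γ ρ) β) α =
          sg k (r * b) • P.circ l (P.circ i γ β) (P.pre ρ α) +
          (∑ j ∈ Finset.Ico 0 l, sg k (r * (a + b)) • f (l + a) j i +
          ∑ j ∈ Finset.Ico (l + 1) i, sg k (r * (a + b)) • f l j i) := by
      intro i hi
      rw [Finset.mem_Ico] at hi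
      have h := circ_circ_parallel (P := P) γ hβ hρ (show l < i by omega)
      have h' : P.circ (i + r) (P.circ l γ ρ) β = sg k (r * b) • P.circ l (P.circ i γ β) ρ := by
        rw [h, mul_comm r, sg_smul_smul]
      simp only [h', map_smul, LinearMap.smul_apply]
      rw [Int.sum_Ico_insert hl.1 (by omega) (by omega), pre_eq hρ]
      have f1 : ∑ j ∈ Finset.Ico 0 l, sg k (r * b) • P.circ j (P.circ l (P.circ i γ β) ρ) α =
          ∑ j ∈ Finset.Ico 0 l, sg k (r * (a + b)) • f (l + a) j i := by
        refine Finset.sum_congr rfl fun j hj => ?_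
        rw [Finset.mem_Ico] at hj
        rw [circ_circ_parallel _ hρ hα hj.2, smul_smul, ← sg_add, mul_add, add_comm (r * a)]
      have f2 : ∑ t ∈ Finset.Ico 0 (r + 1),
          sg k (r * b) • P.circ (l + t) (P.circ l (P.circ i γ β) ρ) α =
            ∑ t ∈ Finset.Ico 0 (r + 1), sg k (r * b) • P.circ l (P.circ i γ β) (P.circ t ρ α) := by
        refine Finset.sum_congr rfl fun t ht => ?_
        rw [Finset.mem_Ico] at ht
        rw [circ_circ_nested _ hρ α hl.1 (by omega) (by omega), add_sub_cancel_left]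
      have f3 : ∑ j ∈ Finset.Ico (l + 1) i,
          sg k (r * b) • P.circ (j + r) (P.circ l (P.circ i γ β) ρ) α =
            ∑ j ∈ Finset.Ico (l + 1) i, sg k (r * (a + b)) • f l j i := by
        refine Finset.sum_congr rfl fun j hj => ?_
        rw [Finset.mem_Ico] at hj
        simp only [hf]
        rw [circ_circ_parallel _ hα hρ (show l < j by omega), smul_smul, ← sg_add]
        congr 1
        exact sg_congr ⟨-(r * a), by ring⟩
      rw [f1, f2, f3]
      simp only [map_sum, Finset.smul_sum]
      abel
    rw [brace, show g + r + 1 = g + 1 + r by ring, Int.sum_Ico_insert hl.1 hl.2 (by omega),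
      Finset.sum_congr rfl e1, Finset.sum_congr rfl e2, Finset.sum_congr rfl e3,
      Finset.sum_add_distrib, Finset.sum_add_distrib, brace, pre_eq hρ β, Finset.sum_comm]
    simp only [map_sum, LinearMap.sum_apply]
    abel
  -- `t1`, `t2` and `t3` reorder the sums in which $\rho$ stands after $\beta$, between $\alpha$ and
  -- $\beta$, and before $\alpha$, so that the slot of $\rho$ is summed innermost as in `brace₃`.
  have t1 : ∑ l ∈ Finset.Ico 0 (g + 1), ∑ i ∈ Finset.Ico 0 l, ∑ j ∈ Finset.Ico 0 i,
      sg k (r * (a + b)) • f (l + b + a) j i = ∑ i ∈ Finset.Ico 0 (g + 1), ∑ j ∈ Finset.Ico 0 i,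
        ∑ l ∈ Finset.Ico (i + 1) (g + 1), sg k (r * (a + b)) • f (l + b + a) j i := by
    rw [← Int.sum_sum_Ico_comm]
    exact Finset.sum_congr rfl fun i _ => Finset.sum_comm
  have t2 : ∑ l ∈ Finset.Ico 0 (g + 1), ∑ i ∈ Finset.Ico (l + 1) (g + 1), ∑ j ∈ Finset.Ico 0 l,
      sg k (r * (a + b)) • f (l + a) j i = ∑ i ∈ Finset.Ico 0 (g + 1), ∑ j ∈ Finset.Ico 0 i,
        ∑ l ∈ Finset.Ico (j + 1) i, sg k (r * (a + b)) • f (l + a) j i := by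
    rw [Int.sum_sum_Ico_comm]
    exact Finset.sum_congr rfl fun i _ => (Int.sum_sum_Ico_comm _ _).symm
  have t3 : ∑ l ∈ Finset.Ico 0 (g + 1), ∑ i ∈ Finset.Ico (l + 1) (g + 1),
      ∑ j ∈ Finset.Ico (l + 1) i, sg k (r * (a + b)) • f l j i =
        ∑ i ∈ Finset.Ico 0 (g + 1), ∑ j ∈ Finset.Ico 0 i,
          ∑ l ∈ Finset.Ico 0 j, sg k (r * (a + b)) • f l j i := by
    rw [Int.sum_sum_Ico_comm]
    exact Finset.sum_congr rfl fun i _ => Int.sum_sum_Ico_comm _ _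
  have t4 : ∑ l ∈ Finset.Ico 0 (g + 1), ∑ i ∈ Finset.Ico (l + 1) (g + 1),
      sg k (r * b) • P.circ l (P.circ i γ β) (P.pre ρ α) =
        sg k (r * b) • P.brace g γ (P.pre ρ α) β := by
    rw [Int.sum_sum_Ico_comm, brace]
    simp only [Finset.smul_sum]
  have t5 : sg k (r * (a + b)) • P.brace₃ g a b γ α β ρ =
      (∑ i ∈ Finset.Ico 0 (g + 1), ∑ j ∈ Finset.Ico 0 i, ∑ l ∈ Finset.Ico 0 j,
        sg k (r * (a + b)) • f l j i) +
      (∑ i ∈ Finset.Ico 0 (g + 1), ∑ j ∈ Finset.Ico 0 i, ∑ l ∈ Finset.Ico (j + 1) i,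
        sg k (r * (a + b)) • f (l + a) j i) +
      ∑ i ∈ Finset.Ico 0 (g + 1), ∑ j ∈ Finset.Ico 0 i, ∑ l ∈ Finset.Ico (i + 1) (g + 1),
        sg k (r * (a + b)) • f (l + b + a) j i := by
    simp only [brace₃, Finset.smul_sum, Finset.sum_add_distrib, smul_add, hf]
  rw [pre_eq hγ, brace_sum_left, Finset.sum_congr rfl e, Finset.sum_add_distrib,
    Finset.sum_add_distrib, Finset.sum_add_distrib, Finset.sum_add_distrib, ← pre_eq hγ, t4, t1, t5]
  simp only [Finset.sum_add_distrib]
  rw [t2, t3]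
  change _ + P.brace g γ α (P.pre ρ β) + _ + _ = _
  abel

end OperadWithMultiplication

/-! ### The bracket, the cup product and the differential on the total space -/

theorem sg_cases (k : Type*) [CommRing k] (n : ℤ) : sg k n = 1 ∨ sg k n = -1 := by
  rcases Int.even_or_odd n with h | h
  · exact Or.inl (sg_even h)
  · right
    simp [sg, Int.negOnePow_odd n h]

namespace OperadWithMultiplication

variable {k : Type*} [CommRing k] {O : ℕ → Type*} [∀ n, AddCommGroup (O n)]
  [∀ n, Module k (O n)] (P : OperadWithMultiplication k O)

/-- The bracket on the direct sum. -/
noncomputable def brk : (⨁ n, O n) →ₗ[k] (⨁ n, O n) →ₗ[k] ⨁ n, O n :=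
  DirectSum.toModule k ℕ _ fun p => LinearMap.flip (DirectSum.toModule k ℕ _ fun q =>
    LinearMap.flip ((sg k (((p : ℤ) - 1) * ((q : ℤ) - 1)) • P.pre - P.pre.flip).compl₁₂
      (DirectSum.lof k ℕ O p) (DirectSum.lof k ℕ O q)))

/-- The cup product up to sign, `(x, y) ↦ (-1)^{|y|} x ⌣ y`. -/
noncomputable def scup : (⨁ n, O n) →ₗ[k] (⨁ n, O n) →ₗ[k] ⨁ n, O n :=
  LinearMap.flip ((P.circ 0).comp (P.circ 1 P.muT))

theorem scup_apply (x y : ⨁ n, O n) : P.scup x y = P.circ 0 (P.circ 1 P.muT y) x := rfl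

variable {P} {a b c g r : ℤ} {x y z α β γ ρ : ⨁ n, O n}

theorem brk_eq (hx : IsHom a x) (hy : IsHom b y) :
    P.brk x y = sg k (a * b) • P.pre x y - P.pre y x := by
  rcases hx with rfl | ⟨p, φ, hp, rfl⟩
  · simp
  rcases hy with rfl | ⟨q, ψ, hq, rfl⟩
  · simp
  change P.brk (DirectSum.lof k ℕ O p φ) (DirectSum.lof k ℕ O q ψ) = _
  rw [brk, DirectSum.toModule_lof, LinearMap.flip_apply, DirectSum.toModule_lof,
    show (p : ℤ) - 1 = a by omega, show (q : ℤ) - 1 = b by omega]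
  rfl

theorem IsHom.brk (hx : IsHom a x) (hy : IsHom b y) : IsHom (a + b) (P.brk x y) := by
  rw [brk_eq hx hy]
  refine ((hx.pre hy).smul _).sub ?_
  rw [add_comm]
  exact hy.pre hx

theorem IsHom.scup (hx : IsHom a x) (hy : IsHom b y) : IsHom (a + b + 1) (P.scup x y) := by
  rw [show a + b + 1 = 1 + b + a by ring]
  exact (isHom_muT.circ hy 1).circ hx 0

/-- By `pre_pre` the associator of the pre-Lie product is graded symmetric in its last two entries,
so all associators cancel. Once the signs of $ab$, $ac$ and $bc$ are fixed, what remains is a linear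
identity. -/
theorem brk_brk (hx : IsHom a x) (hy : IsHom b y) (hz : IsHom c z) :
    P.brk x (P.brk y z) = P.brk (P.brk x y) z + sg k (a * b) • P.brk y (P.brk x z) := by
  rw [brk_eq hx (hy.brk hz), brk_eq (hx.brk hy) hz, brk_eq hy (hx.brk hz), brk_eq hy hz,
    brk_eq hx hy, brk_eq hx hz]
  simp only [map_sub, map_smul, LinearMap.sub_apply, LinearMap.smul_apply, pre_pre hx hy hz,
    pre_pre hy hx hz, pre_pre hx hz hy, pre_pre hz hx hy, pre_pre hy hz hx, pre_pre hz hy hx,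
    mul_add, add_mul, sg_add, mul_comm b a, mul_comm c a, mul_comm c b]
  rcases sg_cases k (a * b) with h1 | h1 <;> rcases sg_cases k (a * c) with h2 | h2 <;>
  rcases sg_cases k (b * c) with h3 | h3 <;> simp only [h1, h2, h3] <;> module

theorem brk_antisymm (hx : IsHom a x) (hy : IsHom b y) :
    P.brk x y = -(sg k (a * b) • P.brk y x) := by
  rw [brk_eq hx hy, brk_eq hy hx, mul_comm b a, smul_sub, sg_smul_smul]
  abel

theorem brk_self (hx : IsHom a x) (ha : Even a) : P.brk x x = 0 := by
  rw [brk_eq hx hx, sg_even (ha.mul_right a), one_smul, sub_self]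

/-- In odd degree the two braces in `pre_pre` for $x,x,x$ cancel, so $(x\circ x)\circ
x=x\circ(x\circ x)$. No division by $3$ is involved. -/
theorem brk_brk_self (hx : IsHom a x) (ha : Odd a) : P.brk x (P.brk x x) = 0 := by
  have h1 : sg k (a * a) = -1 := by
    simp [sg, Int.negOnePow_odd (a * a) (ha.mul ha)]
  rw [brk_eq hx (hx.brk hx), brk_eq hx hx, mul_add, sg_add, h1]
  simp only [map_sub, map_smul, LinearMap.sub_apply, LinearMap.smul_apply, pre_pre hx hx hx, h1]
  module

theorem pre_muT (y : ⨁ n, O n) : P.pre P.muT y = P.circ 0 P.muT y + P.circ 1 P.muT y := by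
  rw [pre_eq isHom_muT, show Finset.Ico (0 : ℤ) (1 + 1) = {0, 1} from rfl,
    Finset.sum_pair (by decide)]

theorem pre_muT_muT : P.pre P.muT P.muT = 0 := by
  rw [pre_muT, circ_muT_muT, add_neg_cancel]

/-- As $\mu$ has two slots, only one pair of slots contributes. This makes the general brace
identities available for the cup product. -/
theorem brace_muT (x y : ⨁ n, O n) : P.brace 1 P.muT x y = P.scup x y := by
  rw [brace, show Finset.Ico (0 : ℤ) (1 + 1) = {0, 1} from rfl, Finset.sum_pair (by decide),
    show Finset.Ico (0 : ℤ) 0 = ∅ from rfl, show Finset.Ico (0 : ℤ) 1 = {0} from rfl,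
    Finset.sum_singleton, Finset.sum_empty, zero_add, scup_apply]

theorem brk_muT (hx : IsHom a x) :
    P.brk P.muT x = sg k a • P.pre P.muT x - P.pre x P.muT := by
  rw [brk_eq isHom_muT hx, one_mul]

/-- The pre-Lie identity and $\mu\circ\mu=0$ suffice; the usual deduction from the Jacobi identity
would divide by $2$. -/
theorem brk_muT_brk_muT (hx : IsHom a x) : P.brk P.muT (P.brk P.muT x) = 0 := by
  have hμ : IsHom 1 P.muT := isHom_muT
  have h1 := pre_pre (P := P) hμ hμ hx
  have h2 := pre_pre (P := P) hx hμ hμ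
  rw [pre_muT_muT, map_zero, LinearMap.zero_apply] at h1
  rw [pre_muT_muT, map_zero] at h2
  rw [brk_muT (hμ.brk hx), brk_muT hx, sg_add]
  simp only [map_sub, map_smul, LinearMap.sub_apply, LinearMap.smul_apply, pre_pre hμ hx hμ, h2,
    sg_one, one_mul, mul_one] at h1 ⊢
  have h3 : P.pre P.muT (P.pre P.muT x) =
      -(P.brace 1 P.muT x P.muT + sg k a • P.brace 1 P.muT P.muT x) := by
    rw [eq_neg_iff_add_eq_zero, h1, add_assoc]
  rw [h3]
  rcases sg_cases k a with h | h <;> simp only [h] <;> module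

/-- Both sides insert $x,y,z$ in the three slots of a composite of $\mu$ with itself, on the left
$\mu\circ_1\mu$ and on the right $\mu\circ_2\mu$. -/
theorem scup_assoc (x : ⨁ n, O n) (hy : IsHom b y) (hz : IsHom c z) :
    P.scup (P.scup x y) z = -(sg k c • P.scup x (P.scup y z)) := by
  have hμ : IsHom 1 P.muT := isHom_muT
  by_cases hb : b < -1
  · obtain rfl := hy.eq_zero hb
    simp
  by_cases hc : c < -1
  · obtain rfl := hz.eq_zero hc
    simp
  simp only [scup_apply]
  have h1 : P.circ 0 (P.circ 1 P.muT z) (P.circ 0 (P.circ 1 P.muT y) x) =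
      sg k c • P.circ 0 (P.circ 1 (P.circ 2 (P.circ 0 P.muT P.muT) z) y) x := by
    have e1 := circ_circ_nested (P := P) (P.circ 1 P.muT z) (hμ.circ (P := P) hy 1) x le_rfl le_rfl (by omega)
    have e2 := circ_circ_nested (P := P) (P.circ 1 P.muT z) hμ y (le_refl 0) zero_le_one (by omega)
    have e3 := circ_circ_parallel (P := P) P.muT hz hμ zero_lt_one
    rw [sub_zero] at e1 e2
    rw [← e1, ← e2, e3, mul_one]
    simp only [map_smul, LinearMap.smul_apply]
    rfl
  have h2 : P.circ 0 (P.circ 1 P.muT (P.circ 0 (P.circ 1 P.muT z) y)) x =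
      P.circ 0 (P.circ 1 (P.circ 2 (P.circ 1 P.muT P.muT) z) y) x := by
    have e1 := circ_circ_nested (P := P) P.muT (hμ.circ (P := P) hz 1) y zero_le_one le_rfl (by omega)
    have e2 := circ_circ_nested (P := P) P.muT hμ z zero_le_one (show (1 : ℤ) ≤ 2 by omega) (by omega)
    rw [sub_self] at e1
    rw [show (2 : ℤ) - 1 = 1 by norm_num] at e2
    rw [← e1, ← e2]
  rw [h1, h2, circ_muT_muT]
  simp

theorem pre_muT_scup (hx : IsHom a x) (hy : IsHom b y) :
    P.pre P.muT (P.scup x y) =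
      -(sg k b • P.scup (P.pre P.muT x) y) - P.scup x (P.pre P.muT y) := by
  have hμ : IsHom 1 P.muT := isHom_muT
  by_cases ha : a < -1
  · obtain rfl := hx.eq_zero ha
    simp
  by_cases hb : b < -1
  · obtain rfl := hy.eq_zero hb
    simp
  have e0 := circ_circ_nested (P := P) P.muT hμ y zero_le_one le_rfl (by omega)
  have e0' := circ_circ_nested (P := P) P.muT hμ y zero_le_one (show (1 : ℤ) ≤ 2 by omega) (by omega)
  have e1 := circ_circ_nested (P := P) P.muT hμ y (le_refl 0) zero_le_one (by omega)
  have e2 := circ_circ_nested (P := P) P.muT (hμ.circ (P := P) hy 1) x (le_refl 0) le_rfl (by omega)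
  have e3 := circ_circ_nested (P := P) P.muT (hμ.circ (P := P) hy 1) x zero_le_one le_rfl (by omega)
  have e4 := circ_circ_nested (P := P) (P.circ 1 P.muT y) hμ x (le_refl 0) le_rfl (by omega)
  have e5 := circ_circ_nested (P := P) (P.circ 1 P.muT y) hμ x (le_refl 0) zero_le_one (by omega)
  have e6 := circ_circ_parallel (P := P) P.muT hy hμ zero_lt_one
  simp only [sub_self, sub_zero, mul_one, show (2 : ℤ) - 1 = 1 by norm_num,
    show (1 : ℤ) + 1 = 2 by norm_num] at e0 e0' e1 e2 e3 e4 e5 e6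
  simp only [pre_muT, scup_apply, map_add, LinearMap.add_apply, ← e4, ← e5, e6, ← e3, ← e0, ← e0',
    ← e2, ← e1, circ_muT_muT, map_neg, LinearMap.neg_apply, map_smul, LinearMap.smul_apply]
  rcases sg_cases k b with h | h <;> simp only [h] <;> module

theorem brace₃_muT (a b : ℤ) (x y z : ⨁ n, O n) : P.brace₃ 1 a b P.muT x y z = 0 := by
  rw [brace₃, show Finset.Ico (0 : ℤ) (1 + 1) = {0, 1} from rfl, Finset.sum_pair (by decide),
    show Finset.Ico (0 : ℤ) 0 = ∅ from rfl, show Finset.Ico (0 : ℤ) 1 = {0} from rfl]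
  simp

/-- This is `pre_brace` for $\gamma=\mu$: two slots leave no room for a third insertion. -/
theorem pre_scup (hx : IsHom a x) (hy : IsHom b y) (hz : IsHom c z) :
    P.pre (P.scup x y) z = P.scup (P.pre x z) y + sg k (c * a) • P.scup x (P.pre y z) := by
  have h := pre_brace (P := P) (isHom_muT (P := P)) hx hy hz
  simpa only [brace_muT, brace₃_muT, add_zero] using h

/-- The differential is a derivation of the cup product. -/
theorem brk_muT_scup (hx : IsHom a x) (hy : IsHom b y) :
    P.brk P.muT (P.scup x y) =
      P.scup (P.brk P.muT x) y + sg k a • P.scup x (P.brk P.muT y) := by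
  rw [brk_muT (hx.scup hy), brk_muT hx, brk_muT hy, pre_muT_scup hx hy,
    pre_scup hx hy isHom_muT, sg_add, sg_add, sg_one, one_mul]
  simp only [map_sub, map_smul, LinearMap.sub_apply, LinearMap.smul_apply]
  rcases sg_cases k a with h | h <;> rcases sg_cases k b with h' | h' <;> simp only [h, h'] <;>
  module

/-- The cup product is graded commutative up to homotopy. -/
theorem brk_muT_pre (hx : IsHom a x) (hy : IsHom b y) :
    P.brk P.muT (P.pre x y) = sg k b • P.pre (P.brk P.muT x) y + P.pre x (P.brk P.muT y) -
      sg k (a + b) • (P.scup y x + sg k (a * b) • P.scup x y) := by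
  have hμ : IsHom 1 P.muT := isHom_muT
  rw [brk_muT (hx.pre hy), brk_muT hx, brk_muT hy, ← brace_muT, ← brace_muT, sg_add]
  simp only [map_sub, map_smul, LinearMap.sub_apply, LinearMap.smul_apply, pre_pre hμ hx hy,
    pre_pre hx hμ hy, pre_pre hx hy hμ, one_mul, mul_one]
  rcases sg_cases k a with h | h <;> rcases sg_cases k b with h' | h' <;> simp only [h, h'] <;>
  module

/-- The bracket is a derivation of the cup product up to homotopy. -/
theorem brk_scup (hγ : IsHom g γ) (hα : IsHom a α) (hβ : IsHom b β) (h1 : P.brk P.muT γ = 0)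
    (h2 : P.brk P.muT α = 0) (h3 : P.brk P.muT β = 0) :
    P.brk γ (P.scup α β) = P.scup (P.brk γ α) β + sg k (g * a) • P.scup α (P.brk γ β) +
      P.brk P.muT (sg k (g * (a + b + 1) + (a + b)) • P.brace g γ α β) := by
  have hμ : IsHom 1 P.muT := isHom_muT
  rw [brk_muT hγ, sub_eq_zero] at h1
  rw [brk_muT hα, sub_eq_zero] at h2
  rw [brk_muT hβ, sub_eq_zero] at h3
  -- These expand $(\mu\circ\gamma)\{\alpha,\beta\}$, $(\gamma\circ\mu)\{\alpha,\beta\}$ and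
  -- $\gamma\{\alpha,\beta\}\circ\mu$. The first two agree up to sign because $\gamma$ is a cocycle.
  -- In the last two, the terms with $\mu$ next to $\alpha$ or $\beta$ match because these are
  -- cocycles, and the `brace₃` terms cancel.
  have k1 := brace_pre (P := P) hμ hα hβ hγ
  have k2 := brace_pre (P := P) hγ hα hβ hμ
  have k4 := pre_brace (P := P) hγ hα hβ hμ
  have s1 : ∀ g (x y y' : ⨁ n, O n) (s : k), P.brace g x (s • y) y' = s • P.brace g x y y' := by
    intro g x y y' s
    simp only [brace, map_smul, Finset.smul_sum]
  have s2 : ∀ g (x y y' : ⨁ n, O n) (s : k), P.brace g x y (s • y') = s • P.brace g x y y' := by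
    intro g x y y' s
    simp only [brace, map_smul, LinearMap.smul_apply, Finset.smul_sum]
  have s3 : ∀ g (x y y' : ⨁ n, O n) (s : k), P.brace g (s • x) y y' = s • P.brace g x y y' := by
    intro g x y y' s
    simp only [brace, map_smul, LinearMap.smul_apply, Finset.smul_sum]
  rw [← h1, s3, add_comm g 1, k1, brace₃_muT] at k2
  rw [← h2, ← h3, s1, s2] at k4
  have hh := (hγ.brace (P := P) hα hβ g)
  rw [map_smul, brk_muT hh, brk_eq hγ (hα.scup hβ), brk_eq hγ hα, brk_eq hγ hβ,
    pre_scup hα hβ hγ, k4]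
  simp only [brace_muT, smul_add, smul_zero, add_zero, one_mul, mul_one, mul_add, sg_add, map_sub,
    LinearMap.sub_apply, map_smul, LinearMap.smul_apply] at k2 ⊢
  have k5 := congrArg (sg k g • ·) k2
  simp only [smul_add, sg_smul_smul] at k5
  rw [add_assoc, ← eq_sub_iff_add_eq] at k5
  rw [k5]
  rcases sg_cases k a with e1 | e1 <;> rcases sg_cases k b with e2 | e2 <;>
  rcases sg_cases k g with e3 | e3 <;> rcases sg_cases k (g * a) with e4 | e4 <;>
  rcases sg_cases k (g * b) with e5 | e5 <;> simp only [e1, e2, e3, e4, e5] <;> module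

/-! ### The unit -/

/-- The unit, in the direct sum. -/
noncomputable def eT (P : OperadWithMultiplication k O) : ⨁ n, O n := DirectSum.of O 0 P.e

theorem isHom_eT : IsHom (-1) P.eT := isHom_of 0 P.e

theorem circ_one_of (x : ⨁ n, O n) : P.circ 0 (DirectSum.of O 1 P.one) x = x := by
  induction x using DirectSum.induction_on with
  | zero => simp
  | add x y hx hy => rw [map_add, hx, hy]
  | of p φ =>
    rw [circ_of (show 1 + p = p + 1 by omega) le_rfl, Int.toNat_zero, zero_add, P.one_comp,
      mul_zero, sg_zero, one_smul]

theorem circ_zero_muT_eT : P.circ 0 P.muT P.eT = DirectSum.of O 1 P.one := by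
  rw [muT, eT, circ_of (show 2 + 0 = 1 + 1 by omega) le_rfl, Int.toNat_zero, zero_add,
    P.mu_comp_e_left, mul_zero, sg_zero, one_smul]

theorem circ_one_muT_eT : P.circ 1 P.muT P.eT = -DirectSum.of O 1 P.one := by
  rw [muT, eT, circ_of (show 2 + 0 = 1 + 1 by omega) zero_le_one, Int.toNat_one,
    P.mu_comp_e_right, Nat.cast_zero, zero_sub, mul_one, sg_neg, sg_one, neg_one_smul]

theorem scup_eT (x : ⨁ n, O n) : P.scup x P.eT = -x := by
  rw [scup_apply, circ_one_muT_eT, map_neg, LinearMap.neg_apply, circ_one_of]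

theorem eT_scup (hx : IsHom a x) : P.scup P.eT x = sg k a • x := by
  rw [scup_apply, circ_circ_parallel _ hx isHom_eT zero_lt_one, circ_zero_muT_eT,
    show (1 : ℤ) + -1 = 0 by norm_num, circ_one_of, mul_neg_one, sg_neg]

theorem brk_muT_eT : P.brk P.muT P.eT = 0 := by
  rw [brk_muT isHom_eT, pre_muT, circ_zero_muT_eT, circ_one_muT_eT, add_neg_cancel, smul_zero,
    pre_eq isHom_eT]
  simp

/-! ### Comparison with the operations in fixed degrees -/

theorem of_cup {p q : ℕ} (φ : O p) (ψ : O q) : DirectSum.of O (p + q) (P.cup φ ψ) =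
    sg k ((q : ℤ) - 1) • P.scup (DirectSum.of O p φ) (DirectSum.of O q ψ) := by
  rw [scup_apply, circ_circ_parallel _ (isHom_of q ψ) (isHom_of p φ) zero_lt_one, muT,
    circ_of (show 2 + p = (p + 1) + 1 by omega) le_rfl, map_smul, LinearMap.smul_apply,
    circ_of (show (p + 1) + q = (p + q) + 1 by omega) (by omega), smul_smul, smul_smul, smul_smul,
    ← sg_add, ← sg_add, ← sg_add, sg_even ⟨((q : ℤ) - 1) * p, by ring⟩, one_smul, cup,
    Int.toNat_zero, show (1 + ((p : ℤ) - 1)).toNat = p by omega]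

theorem of_compBar {p q n : ℕ} (h : p + q = n + 1) (φ : O p) (ψ : O q) :
    DirectSum.of O n (P.compBar h φ ψ) = sg k (((p : ℤ) - 1) * ((q : ℤ) - 1)) •
      P.pre (DirectSum.of O p φ) (DirectSum.of O q ψ) := by
  change DirectSum.lof k ℕ O n _ = _
  rw [compBar, ← sg_smul (k := k), map_smul, map_sum, pre_eq (isHom_of p φ)]
  congr 1
  refine Finset.sum_nbij' (fun i => (i : ℤ) - 1) (fun i => i.toNat + 1) ?_ ?_ ?_ ?_ ?_ <;>
    simp only [Finset.mem_Icc, Finset.mem_Ico] <;> intro i hi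
  · omega
  · omega
  · omega
  · omega
  · rw [circ_of h (by omega), ← sg_smul (k := k), map_smul, show ((i : ℤ) - 1).toNat + 1 = i by omega]
    rfl

theorem of_bracket {p q n : ℕ} (h : p + q = n + 1) (φ : O p) (ψ : O q) :
    DirectSum.of O n (P.bracket h φ ψ) =
      P.brk (DirectSum.of O p φ) (DirectSum.of O q ψ) := by
  rw [bracket, map_sub, of_compBar, ← sg_smul (k := k)]
  change _ - DirectSum.lof k ℕ O n _ = _
  rw [map_smul]
  change _ - _ • DirectSum.of O n _ = _
  rw [of_compBar, mul_comm ((q : ℤ) - 1), sg_smul_smul, brk_eq (isHom_of p φ) (isHom_of q ψ)]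

theorem brk_of_zero (φ ψ : O 0) : P.brk (DirectSum.of O 0 φ) (DirectSum.of O 0 ψ) = 0 := by
  rw [brk_eq (isHom_of 0 φ) (isHom_of 0 ψ), pre_eq (isHom_of 0 φ), pre_eq (isHom_of 0 ψ)]
  simp

end OperadWithMultiplication

/-! ### The induced operations on cohomology -/

theorem LinearMap.exists_lift₂ {k M N Q : Type*} [CommRing k] [AddCommGroup M] [Module k M]
    [AddCommGroup N] [Module k N] [AddCommGroup Q] [Module k Q] (π : M →ₗ[k] N)
    (hπ : Function.Surjective π) (f : M →ₗ[k] M →ₗ[k] Q) (h₁ : ∀ x y, π x = 0 → f x y = 0)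
    (h₂ : ∀ x y, π y = 0 → f x y = 0) :
    ∃ g : N →ₗ[k] N →ₗ[k] Q, ∀ x y, g (π x) (π y) = f x y := by
  have key : ∀ x x' y y', π x = π x' → π y = π y' → f x y = f x' y' := by
    intro x x' y y' hx hy
    have e₁ := h₁ (x - x') y (by rw [map_sub, hx, sub_self])
    have e₂ := h₂ x' (y - y') (by rw [map_sub, hy, sub_self])
    rw [map_sub, LinearMap.sub_apply, sub_eq_zero] at e₁
    rw [map_sub, sub_eq_zero] at e₂
    rw [e₁, e₂]
  have hs := Function.surjInv_eq hπ
  set s := Function.surjInv hπ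
  refine ⟨LinearMap.mk₂ k (fun u v => f (s u) (s v)) ?_ ?_ ?_ ?_, fun x y => ?_⟩
  · intro u u' v
    rw [← LinearMap.add_apply, ← map_add]
    exact key _ _ _ _ (by rw [map_add, hs, hs, hs]) rfl
  · intro c u v
    rw [← LinearMap.smul_apply, ← map_smul]
    exact key _ _ _ _ (by rw [map_smul, hs, hs]) rfl
  · intro u v v'
    rw [← map_add]
    exact key _ _ _ _ rfl (by rw [map_add, hs, hs, hs])
  · intro c u v
    rw [← map_smul]
    exact key _ _ _ _ rfl (by rw [map_smul, hs, hs])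
  · exact key _ _ _ _ (hs _) (hs _)

namespace OperadWithMultiplication

variable {k : Type*} [CommRing k] {O : ℕ → Type*} [∀ n, AddCommGroup (O n)]
  [∀ n, Module k (O n)] {P : OperadWithMultiplication k O} (d : ∀ n, O n →ₗ[k] O (n + 1))
  (Bd : ∀ n, Submodule k (O n))

/-- The cohomology of the complex `O`, for a given description of the coboundaries. -/
abbrev CohomologyOf (n : ℕ) : Type _ :=
  LinearMap.ker (d n) ⧸ (Bd n).submoduleOf (LinearMap.ker (d n))

/-- The class of a cocycle. -/
abbrev classOf {n : ℕ} (z : LinearMap.ker (d n)) : CohomologyOf d Bd n :=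
  ((Bd n).submoduleOf (LinearMap.ker (d n))).mkQ z

/-- The inclusion of the cocycles. -/
noncomputable def cocyclesIncl : (⨁ n, LinearMap.ker (d n)) →ₗ[k] ⨁ n, O n :=
  DirectSum.toModule k ℕ _ fun n => (DirectSum.lof k ℕ O n).comp (LinearMap.ker (d n)).subtype

/-- The projection from cocycles to cohomology. -/
noncomputable def cocyclesProj : (⨁ n, LinearMap.ker (d n)) →ₗ[k] ⨁ n, CohomologyOf d Bd n :=
  DirectSum.toModule k ℕ _ fun n => (DirectSum.lof k ℕ (CohomologyOf d Bd) n).comp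
    ((Bd n).submoduleOf (LinearMap.ker (d n))).mkQ

/-- The cocycle `x` represents the class `v`. -/
def Represents (x : ⨁ n, O n) (v : ⨁ n, CohomologyOf d Bd n) : Prop :=
  ∃ z, cocyclesIncl d z = x ∧ cocyclesProj d Bd z = v

variable {d Bd}

theorem cocyclesIncl_of {n : ℕ} (z : LinearMap.ker (d n)) :
    cocyclesIncl d (DirectSum.of (fun n => LinearMap.ker (d n)) n z) = DirectSum.of O n z.1 := by
  change cocyclesIncl d (DirectSum.lof k ℕ (fun n => LinearMap.ker (d n)) n z) = _
  rw [cocyclesIncl, DirectSum.toModule_lof]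
  rfl

theorem cocyclesProj_of {n : ℕ} (z : LinearMap.ker (d n)) :
    cocyclesProj d Bd (DirectSum.of (fun n => LinearMap.ker (d n)) n z) =
      DirectSum.of (CohomologyOf d Bd) n (classOf d Bd z) := by
  change cocyclesProj d Bd (DirectSum.lof k ℕ (fun n => LinearMap.ker (d n)) n z) = _
  rw [cocyclesProj, DirectSum.toModule_lof]
  rfl

theorem cocyclesIncl_apply (z : ⨁ n, LinearMap.ker (d n)) (n : ℕ) :
    cocyclesIncl d z n = (z n).1 := by
  induction z using DirectSum.induction_on with
  | zero => simp
  | add z z' hz hz' => rw [map_add, DirectSum.add_apply, hz, hz', DirectSum.add_apply]; rfl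
  | of m z =>
    rw [cocyclesIncl_of]
    by_cases h : m = n
    · subst h
      rw [DirectSum.of_eq_same, DirectSum.of_eq_same]
    · rw [DirectSum.of_eq_of_ne _ _ _ (Ne.symm h), DirectSum.of_eq_of_ne _ _ _ (Ne.symm h)]
      rfl

theorem cocyclesProj_apply (z : ⨁ n, LinearMap.ker (d n)) (n : ℕ) :
    cocyclesProj d Bd z n = classOf d Bd (z n) := by
  induction z using DirectSum.induction_on with
  | zero => simp
  | add z z' hz hz' => rw [map_add, DirectSum.add_apply, hz, hz', DirectSum.add_apply]; rfl
  | of m z =>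
    rw [cocyclesProj_of]
    by_cases h : m = n
    · subst h
      rw [DirectSum.of_eq_same, DirectSum.of_eq_same]
    · rw [DirectSum.of_eq_of_ne _ _ _ (Ne.symm h), DirectSum.of_eq_of_ne _ _ _ (Ne.symm h)]
      rfl

theorem cocyclesIncl_injective : Function.Injective (cocyclesIncl d) := by
  intro z z' h
  refine DFinsupp.ext fun n => Subtype.ext ?_
  have := congrArg (fun x : ⨁ n, O n => x n) h
  simpa only [cocyclesIncl_apply] using this

theorem cocyclesProj_surjective : Function.Surjective (cocyclesProj d Bd) := by
  intro v
  induction v using DirectSum.induction_on with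
  | zero => exact ⟨0, map_zero _⟩
  | add v v' h h' =>
    obtain ⟨z, rfl⟩ := h
    obtain ⟨z', rfl⟩ := h'
    exact ⟨z + z', map_add _ _ _⟩
  | of n v =>
    obtain ⟨z, rfl⟩ := Submodule.mkQ_surjective _ v
    exact ⟨_, cocyclesProj_of z⟩

namespace Represents

variable {x y : ⨁ n, O n} {v w : ⨁ n, CohomologyOf d Bd n}

theorem of {n : ℕ} (z : LinearMap.ker (d n)) :
    Represents d Bd (DirectSum.of O n z.1) (DirectSum.of (CohomologyOf d Bd) n (classOf d Bd z)) :=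
  ⟨_, cocyclesIncl_of z, cocyclesProj_of z⟩

theorem add (hx : Represents d Bd x v) (hy : Represents d Bd y w) :
    Represents d Bd (x + y) (v + w) := by
  obtain ⟨z, rfl, rfl⟩ := hx
  obtain ⟨z', rfl, rfl⟩ := hy
  exact ⟨z + z', map_add _ _ _, map_add _ _ _⟩

theorem smul (c : k) (hx : Represents d Bd x v) : Represents d Bd (c • x) (c • v) := by
  obtain ⟨z, rfl, rfl⟩ := hx
  exact ⟨c • z, map_smul _ _ _, map_smul _ _ _⟩

theorem neg (hx : Represents d Bd x v) : Represents d Bd (-x) (-v) := by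
  obtain ⟨z, rfl, rfl⟩ := hx
  exact ⟨-z, map_neg _ _, map_neg _ _⟩

theorem zero : Represents d Bd 0 0 := ⟨0, map_zero _, map_zero _⟩

theorem unique (hx : Represents d Bd x v) (hx' : Represents d Bd x w) : v = w := by
  obtain ⟨z, rfl, rfl⟩ := hx
  obtain ⟨z', h, rfl⟩ := hx'
  rw [cocyclesIncl_injective h]

end Represents

theorem exists_represents (v : ⨁ n, CohomologyOf d Bd n) : ∃ x, Represents d Bd x v := by
  obtain ⟨z, rfl⟩ := cocyclesProj_surjective v
  exact ⟨_, z, rfl, rfl⟩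

section

variable (hd : ∀ (p : ℕ) (φ : O p) (h : 2 + p = p + 1 + 1), d p φ = P.bracket h P.mu φ)
  (hB0 : Bd 0 = ⊥) (hBs : ∀ n, Bd (n + 1) = LinearMap.range (d n))

include hd

theorem brk_muT_of {p : ℕ} (φ : O p) :
    P.brk P.muT (DirectSum.of O p φ) = DirectSum.of O (p + 1) (d p φ) := by
  rw [hd p φ (by omega), of_bracket, muT]

theorem mem_ker_iff {p : ℕ} (φ : O p) :
    φ ∈ LinearMap.ker (d p) ↔ P.brk P.muT (DirectSum.of O p φ) = 0 := by
  rw [brk_muT_of hd, LinearMap.mem_ker]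
  refine ⟨fun h => by rw [h, map_zero], fun h => ?_⟩
  exact DirectSum.of_injective _ (h.trans (map_zero _).symm)

theorem brk_muT_apply (x : ⨁ n, O n) (n : ℕ) : P.brk P.muT x (n + 1) = d n (x n) := by
  induction x using DirectSum.induction_on with
  | zero => simp
  | add x y hx hy => rw [map_add, DirectSum.add_apply, hx, hy, DirectSum.add_apply, map_add]
  | of m φ =>
    rw [brk_muT_of hd]
    by_cases h : m = n
    · subst h
      rw [DirectSum.of_eq_same, DirectSum.of_eq_same]
    · rw [DirectSum.of_eq_of_ne _ _ _ (by omega), DirectSum.of_eq_of_ne _ _ _ (Ne.symm h), map_zero]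

theorem brk_muT_apply_zero (x : ⨁ n, O n) : P.brk P.muT x 0 = 0 := by
  induction x using DirectSum.induction_on with
  | zero => simp
  | add x y hx hy => rw [map_add, DirectSum.add_apply, hx, hy, add_zero]
  | of m φ => rw [brk_muT_of hd, DirectSum.of_eq_of_ne _ _ _ (by omega)]

include hB0 hBs

theorem exists_cobounding {z : ⨁ n, LinearMap.ker (d n)} (hz : cocyclesProj d Bd z = 0) :
    ∃ y, cocyclesIncl d z = P.brk P.muT y := by
  classical
  have h : ∀ n, ∃ y, DirectSum.of O n (z n).1 = P.brk P.muT y := by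
    intro n
    have h1 := congrArg (fun v : ⨁ n, CohomologyOf d Bd n => v n) hz
    simp only [cocyclesProj_apply, DirectSum.zero_apply] at h1
    have h2 : z n ∈ (Bd n).submoduleOf (LinearMap.ker (d n)) :=
      (Submodule.Quotient.mk_eq_zero _).1 h1
    replace h2 : (z n).1 ∈ Bd n := h2
    cases n with
    | zero =>
      rw [hB0, Submodule.mem_bot] at h2
      exact ⟨0, by rw [h2, map_zero, map_zero]⟩
    | succ n =>
      rw [hBs] at h2
      obtain ⟨φ, hφ⟩ := h2
      exact ⟨DirectSum.of O n φ, by rw [brk_muT_of hd, hφ]⟩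
  choose y hy using h
  refine ⟨∑ n ∈ DFinsupp.support z, y n, ?_⟩
  rw [map_sum, ← Finset.sum_congr rfl fun n _ => hy n]
  conv_lhs => rw [← DirectSum.sum_support_of z, map_sum]
  simp only [cocyclesIncl_of]

theorem cocyclesProj_eq_zero {z : ⨁ n, LinearMap.ker (d n)} {y : ⨁ n, O n}
    (h : cocyclesIncl d z = P.brk P.muT y) : cocyclesProj d Bd z = 0 := by
  refine DFinsupp.ext fun n => ?_
  rw [cocyclesProj_apply]
  refine (Submodule.Quotient.mk_eq_zero _).2 ?_
  have h1 := congrArg (fun x : ⨁ n, O n => x n) h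
  simp only [cocyclesIncl_apply] at h1
  change (z n).1 ∈ Bd n
  rw [h1]
  cases n with
  | zero => rw [brk_muT_apply_zero hd]; exact zero_mem _
  | succ n => rw [brk_muT_apply hd, hBs]; exact ⟨_, rfl⟩

theorem Represents.eq_of_sub {x y t : ⨁ n, O n} {v w : ⨁ n, CohomologyOf d Bd n}
    (hx : Represents d Bd x v) (hy : Represents d Bd y w) (h : x = y + P.brk P.muT t) : v = w := by
  obtain ⟨z, rfl, rfl⟩ := hx
  obtain ⟨z', rfl, rfl⟩ := hy
  rw [← sub_eq_iff_eq_add', ← map_sub] at h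
  exact sub_eq_zero.1 ((map_sub (cocyclesProj d Bd) z z').symm.trans
    (cocyclesProj_eq_zero hd hB0 hBs h))

/-- The hypotheses are needed only on homogeneous elements and spread bilinearly over the direct
sum. Phrasing the conclusion through `Represents` lets identities between cochains pass to classes
without comparing degrees. -/
theorem exists_induced (F : (⨁ n, O n) →ₗ[k] (⨁ n, O n) →ₗ[k] ⨁ n, O n)
    (hF : ∀ (p q : ℕ) (φ : LinearMap.ker (d p)) (ψ : LinearMap.ker (d q)),
      ∃ z, cocyclesIncl d z = F (DirectSum.of O p φ.1) (DirectSum.of O q ψ.1))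
    (hl : ∀ {a b : ℤ} {x y : ⨁ n, O n}, IsHom a x → IsHom b y → P.brk P.muT y = 0 →
      ∃ w, F (P.brk P.muT x) y = P.brk P.muT w)
    (hr : ∀ {a b : ℤ} {x y : ⨁ n, O n}, IsHom a x → IsHom b y → P.brk P.muT x = 0 →
      ∃ w, F x (P.brk P.muT y) = P.brk P.muT w) :
    ∃ G : (⨁ n, CohomologyOf d Bd n) →ₗ[k] (⨁ n, CohomologyOf d Bd n) →ₗ[k]
        ⨁ n, CohomologyOf d Bd n,
      ∀ {x y v w}, Represents d Bd x v → Represents d Bd y w →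
        Represents d Bd (F x y) (G v w) := by
  have hF' : ∀ z z', F (cocyclesIncl d z) (cocyclesIncl d z') ∈
      LinearMap.range (cocyclesIncl d) := by
    intro z z'
    induction z using DirectSum.induction_on with
    | zero => simp
    | add x y hx hy => rw [map_add, map_add, LinearMap.add_apply]; exact add_mem hx hy
    | of p φ =>
      induction z' using DirectSum.induction_on with
      | zero => simp
      | add x y hx hy => rw [map_add, map_add]; exact add_mem hx hy
      | of q ψ => rw [cocyclesIncl_of, cocyclesIncl_of]; exact hF p q φ ψ
  have hl' : ∀ y z, ∃ w, F (P.brk P.muT y) (cocyclesIncl d z) = P.brk P.muT w := by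
    intro y z
    induction y using DirectSum.induction_on with
    | zero => exact ⟨0, by simp⟩
    | add x y hx hy =>
      obtain ⟨w, hw⟩ := hx
      obtain ⟨w', hw'⟩ := hy
      exact ⟨w + w', by rw [map_add, map_add, LinearMap.add_apply, hw, hw', map_add]⟩
    | of p φ =>
      induction z using DirectSum.induction_on with
      | zero => exact ⟨0, by simp⟩
      | add x y hx hy =>
        obtain ⟨w, hw⟩ := hx
        obtain ⟨w', hw'⟩ := hy
        exact ⟨w + w', by rw [map_add, map_add, hw, hw', map_add]⟩
      | of q ψ =>
        rw [cocyclesIncl_of]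
        exact hl (isHom_of p φ) (isHom_of q ψ.1) ((mem_ker_iff hd _).1 ψ.2)
  have hr' : ∀ z y, ∃ w, F (cocyclesIncl d z) (P.brk P.muT y) = P.brk P.muT w := by
    intro z y
    induction z using DirectSum.induction_on with
    | zero => exact ⟨0, by simp⟩
    | add x y hx hy =>
      obtain ⟨w, hw⟩ := hx
      obtain ⟨w', hw'⟩ := hy
      exact ⟨w + w', by rw [map_add, map_add, LinearMap.add_apply, hw, hw', map_add]⟩
    | of p φ =>
      rw [cocyclesIncl_of]
      induction y using DirectSum.induction_on with
      | zero => exact ⟨0, by simp⟩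
      | add x y hx hy =>
        obtain ⟨w, hw⟩ := hx
        obtain ⟨w', hw'⟩ := hy
        exact ⟨w + w', by rw [map_add, map_add, hw, hw', map_add]⟩
      | of q ψ => exact hr (isHom_of p φ.1) (isHom_of q ψ) ((mem_ker_iff hd _).1 φ.2)
  let ie := LinearEquiv.ofInjective (cocyclesIncl d) cocyclesIncl_injective
  let L : LinearMap.range (cocyclesIncl d) →ₗ[k] ⨁ n, CohomologyOf d Bd n :=
    (cocyclesProj d Bd).comp ie.symm.toLinearMap
  have hL : ∀ z x, cocyclesIncl d z = x.1 → L x = cocyclesProj d Bd z := by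
    intro z x h
    have : x = ie z := Subtype.ext h.symm
    rw [this]
    change cocyclesProj d Bd (ie.symm (ie z)) = _
    rw [LinearEquiv.symm_apply_apply]
  have hL0 : ∀ x y, x.1 = P.brk P.muT y → L x = 0 := by
    intro x y h
    obtain ⟨z, hz⟩ := x.2
    rw [hL z x hz]
    exact cocyclesProj_eq_zero hd hB0 hBs (hz.trans h)
  let f : (⨁ n, LinearMap.ker (d n)) →ₗ[k] (⨁ n, LinearMap.ker (d n)) →ₗ[k]
      ⨁ n, CohomologyOf d Bd n :=
    LinearMap.mk₂ k (fun z z' => L ⟨_, hF' z z'⟩)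
      (fun z₁ z₂ z' => by
        rw [← map_add]
        exact congrArg L (Subtype.ext (by simp)))
      (fun c z z' => by
        rw [← map_smul]
        exact congrArg L (Subtype.ext (by simp)))
      (fun z z₁ z₂ => by
        rw [← map_add]
        exact congrArg L (Subtype.ext (by simp)))
      (fun c z z' => by
        rw [← map_smul]
        exact congrArg L (Subtype.ext (by simp)))
  have hf : ∀ z z', f z z' = L ⟨_, hF' z z'⟩ := fun z z' => rfl
  have h₁ : ∀ z z', cocyclesProj d Bd z = 0 → f z z' = 0 := by
    intro z z' hz
    obtain ⟨y, hy⟩ := exists_cobounding hd hB0 hBs hz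
    obtain ⟨w, hw⟩ := hl' y z'
    rw [hf]
    exact hL0 _ w (by rw [← hw, ← hy])
  have h₂ : ∀ z z', cocyclesProj d Bd z' = 0 → f z z' = 0 := by
    intro z z' hz
    obtain ⟨y, hy⟩ := exists_cobounding hd hB0 hBs hz
    obtain ⟨w, hw⟩ := hr' z y
    rw [hf]
    exact hL0 _ w (by rw [← hw, ← hy])
  clear_value f
  obtain ⟨G, hG⟩ := LinearMap.exists_lift₂ (M := ⨁ n, LinearMap.ker (d n))
    (N := ⨁ n, CohomologyOf d Bd n) (Q := ⨁ n, CohomologyOf d Bd n) (cocyclesProj d Bd)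
    cocyclesProj_surjective f h₁ h₂
  refine ⟨G, ?_⟩
  rintro _ _ _ _ ⟨z, rfl, rfl⟩ ⟨z', rfl, rfl⟩
  obtain ⟨z'', h⟩ := hF' z z'
  exact ⟨z'', h, (((hG z z').trans (hf z z')).trans (hL _ _ h)).symm⟩

end

end OperadWithMultiplication

/-! ### The Gerstenhaber algebra of an operad with multiplication -/

namespace OperadWithMultiplication

variable {k : Type*} [CommRing k] {O : ℕ → Type*} [∀ n, AddCommGroup (O n)]
  [∀ n, Module k (O n)] (P : OperadWithMultiplication k O)

/-- The sign automorphism, given by `(-1)^{|q|}` on the elements of arity `q`. -/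
noncomputable def signT : (⨁ n, O n) →ₗ[k] ⨁ n, O n :=
  DirectSum.toModule k ℕ _ fun q => sg k ((q : ℤ) - 1) • DirectSum.lof k ℕ O q

/-- The cup product on the direct sum. -/
noncomputable def cupT : (⨁ n, O n) →ₗ[k] (⨁ n, O n) →ₗ[k] ⨁ n, O n :=
  P.scup.compl₂ signT

variable {P} {a b c g : ℤ} {x y z α β γ : ⨁ n, O n}

theorem signT_eq (hx : IsHom a x) : signT (k := k) x = sg k a • x := by
  rcases hx with rfl | ⟨p, φ, hp, rfl⟩
  · rw [map_zero, smul_zero]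
  change signT (k := k) (DirectSum.lof k ℕ O p φ) = _
  rw [signT, DirectSum.toModule_lof, show a = (p : ℤ) - 1 by omega]
  rfl

theorem cupT_eq (x : ⨁ n, O n) (hy : IsHom b y) : P.cupT x y = sg k b • P.scup x y := by
  rw [cupT, LinearMap.compl₂_apply, signT_eq hy, map_smul]

theorem of_cupT {p q : ℕ} (φ : O p) (ψ : O q) :
    P.cupT (DirectSum.of O p φ) (DirectSum.of O q ψ) = DirectSum.of O (p + q) (P.cup φ ψ) := by
  rw [of_cup, cupT_eq _ (isHom_of q ψ)]

theorem IsHom.cupT (hx : IsHom a x) (hy : IsHom b y) : IsHom (a + b + 1) (P.cupT x y) := by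
  rw [cupT_eq x hy]
  exact (hx.scup hy).smul _

theorem brk_muT_cupT (hx : IsHom a x) (hy : IsHom b y) :
    P.brk P.muT (P.cupT x y) =
      P.cupT (P.brk P.muT x) y + sg k (a + 1) • P.cupT x (P.brk P.muT y) := by
  rw [cupT_eq x hy, cupT_eq _ hy, cupT_eq _ (isHom_muT.brk hy), map_smul, brk_muT_scup hx hy,
    smul_add, smul_smul, smul_smul, ← sg_add, ← sg_add]
  congr 2
  exact sg_congr ⟨-1, by ring⟩

theorem cupT_assoc (x : ⨁ n, O n) (hy : IsHom b y) (hz : IsHom c z) :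
    P.cupT (P.cupT x y) z = P.cupT x (P.cupT y z) := by
  rw [cupT_eq _ hz, cupT_eq x hy, cupT_eq x (hy.cupT hz), cupT_eq y hz, map_smul, map_smul,
    LinearMap.smul_apply, scup_assoc x hy hz, smul_neg, smul_neg, smul_smul, smul_smul, smul_smul,
    ← neg_smul, sg_add _ 1, sg_one, sg_add]
  congr 1
  ring

theorem cupT_eT (x : ⨁ n, O n) : P.cupT x P.eT = x := by
  rw [cupT_eq x isHom_eT, scup_eT, sg_neg, sg_one, neg_smul, one_smul, neg_neg]

theorem eT_cupT (hx : IsHom a x) : P.cupT P.eT x = x := by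
  rw [cupT_eq _ hx, eT_scup hx, sg_smul_smul]

theorem cupT_comm (hx : IsHom a x) (hy : IsHom b y) (h1 : P.brk P.muT x = 0)
    (h2 : P.brk P.muT y = 0) :
    ∃ t, P.cupT x y = sg k ((a + 1) * (b + 1)) • P.cupT y x + P.brk P.muT t := by
  -- The pre-Lie product is the homotopy; its sign cancels the one in front of the cup products in
  -- `brk_muT_pre` and the signs between `scup` and `cupT`.
  refine ⟨-(sg k (a + b + a * b + b) • P.pre x y), ?_⟩
  rw [map_neg, map_smul, brk_muT_pre hx hy, h1, h2, cupT_eq _ hy, cupT_eq _ hx,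
    show (a + 1) * (b + 1) = a + b + a * b + 1 by ring]
  simp only [map_zero, LinearMap.zero_apply, smul_zero, add_zero, zero_sub, sg_add, sg_one]
  rcases sg_cases k a with h | h <;> rcases sg_cases k b with h' | h' <;>
    rcases sg_cases k (a * b) with h'' | h'' <;> simp only [h, h', h''] <;> module

theorem brk_cupT (hγ : IsHom g γ) (hα : IsHom a α) (hβ : IsHom b β) (h1 : P.brk P.muT γ = 0)
    (h2 : P.brk P.muT α = 0) (h3 : P.brk P.muT β = 0) :
    ∃ t, P.brk γ (P.cupT α β) =
      P.cupT (P.brk γ α) β + sg k (g * (a + 1)) • P.cupT α (P.brk γ β) + P.brk P.muT t := by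
  refine ⟨sg k b • (sg k (g * (a + b + 1) + (a + b)) • P.brace g γ α β), ?_⟩
  rw [cupT_eq α hβ, map_smul, brk_scup hγ hα hβ h1 h2 h3, cupT_eq _ hβ, cupT_eq _ (hγ.brk hβ),
    smul_add, smul_add, smul_smul, smul_smul, ← sg_add, ← sg_add, map_smul _ (sg k b)]
  congr 3
  exact sg_congr ⟨-g, by ring⟩

section

variable {d : ∀ n, O n →ₗ[k] O (n + 1)} {Bd : ∀ n, Submodule k (O n)}
  (hd : ∀ (p : ℕ) (φ : O p) (h : 2 + p = p + 1 + 1), d p φ = P.bracket h P.mu φ)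

include hd

theorem cup_mem_ker {p q : ℕ} (φ : LinearMap.ker (d p)) (ψ : LinearMap.ker (d q)) :
    P.cup φ.1 ψ.1 ∈ LinearMap.ker (d (p + q)) := by
  rw [mem_ker_iff hd, ← of_cupT, brk_muT_cupT (isHom_of p _) (isHom_of q _),
    (mem_ker_iff hd _).1 φ.2, (mem_ker_iff hd _).1 ψ.2]
  simp

theorem bracket_mem_ker {p q n : ℕ} (h : p + q = n + 1) (φ : LinearMap.ker (d p))
    (ψ : LinearMap.ker (d q)) : P.bracket h φ.1 ψ.1 ∈ LinearMap.ker (d n) := by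
  rw [mem_ker_iff hd, of_bracket, brk_brk isHom_muT (isHom_of p _) (isHom_of q _),
    (mem_ker_iff hd _).1 φ.2, (mem_ker_iff hd _).1 ψ.2]
  simp

theorem e_mem_ker : P.e ∈ LinearMap.ker (d 0) := (mem_ker_iff hd _).2 brk_muT_eT

theorem differential_differential {p : ℕ} (φ : O p) : d (p + 1) (d p φ) = 0 := by
  refine DirectSum.of_injective (β := O) _ ?_
  rw [← brk_muT_of hd, ← brk_muT_of hd, brk_muT_brk_muT (isHom_of p φ), map_zero]

variable (hB0 : Bd 0 = ⊥) (hBs : ∀ n, Bd (n + 1) = LinearMap.range (d n))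

include hB0 hBs

theorem exists_cup_cohomology :
    ∃ G : (⨁ n, CohomologyOf d Bd n) →ₗ[k] (⨁ n, CohomologyOf d Bd n) →ₗ[k]
        ⨁ n, CohomologyOf d Bd n,
      ∀ {x y v w}, Represents d Bd x v → Represents d Bd y w →
        Represents d Bd (P.cupT x y) (G v w) := by
  refine exists_induced hd hB0 hBs P.cupT ?_ ?_ ?_
  · intro p q φ ψ
    exact ⟨DirectSum.of _ _ ⟨_, cup_mem_ker hd φ ψ⟩, by rw [cocyclesIncl_of, of_cupT]⟩
  · intro a b x y hx hy h
    exact ⟨P.cupT x y, by rw [brk_muT_cupT hx hy, h, map_zero, smul_zero, add_zero]⟩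
  · intro a b x y hx hy h
    exact ⟨sg k (a + 1) • P.cupT x y, by
      rw [map_smul, brk_muT_cupT hx hy, h, map_zero, LinearMap.zero_apply, zero_add,
        sg_smul_smul]⟩

theorem exists_bracket_cohomology :
    ∃ G : (⨁ n, CohomologyOf d Bd n) →ₗ[k] (⨁ n, CohomologyOf d Bd n) →ₗ[k]
        ⨁ n, CohomologyOf d Bd n,
      ∀ {x y v w}, Represents d Bd x v → Represents d Bd y w →
        Represents d Bd (P.brk x y) (G v w) := by
  refine exists_induced hd hB0 hBs P.brk ?_ ?_ ?_
  · intro p q φ ψ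
    by_cases h : p + q = 0
    · obtain ⟨rfl, rfl⟩ : p = 0 ∧ q = 0 := by omega
      exact ⟨0, by rw [map_zero, brk_of_zero]⟩
    · have h' : p + q = (p + q - 1) + 1 := by omega
      exact ⟨DirectSum.of _ _ ⟨_, bracket_mem_ker hd h' φ ψ⟩, by rw [cocyclesIncl_of, of_bracket]⟩
  · intro a b x y hx hy h
    exact ⟨P.brk x y, by rw [brk_brk isHom_muT hx hy, h, map_zero, smul_zero, add_zero]⟩
  · intro a b x y hx hy h
    exact ⟨sg k (1 * a) • P.brk x y, by
      rw [map_smul, brk_brk isHom_muT hx hy, h, map_zero, LinearMap.zero_apply, zero_add,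
        sg_smul_smul]⟩

/-- Every axiom is an identity of cochains read on representatives. Only graded commutativity and
the Leibniz rule hold merely up to a coboundary. -/
theorem exists_gerstenhaberAlgebra : ∃ G : GerstenhaberAlgebra k (CohomologyOf d Bd),
    (∃ he : P.e ∈ LinearMap.ker (d 0), G.one = classOf d Bd ⟨P.e, he⟩) ∧
    (∀ (p q : ℕ) (φ : LinearMap.ker (d p)) (ψ : LinearMap.ker (d q)),
      ∃ hc : P.cup φ.1 ψ.1 ∈ LinearMap.ker (d (p + q)),
        G.mul (DirectSum.of (CohomologyOf d Bd) p (classOf d Bd φ))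
          (DirectSum.of (CohomologyOf d Bd) q (classOf d Bd ψ)) =
        DirectSum.of (CohomologyOf d Bd) (p + q) (classOf d Bd ⟨P.cup φ.1 ψ.1, hc⟩)) ∧
    (∀ (p q n : ℕ) (h : p + q = n + 1) (φ : LinearMap.ker (d p)) (ψ : LinearMap.ker (d q)),
      ∃ hb : P.bracket h φ.1 ψ.1 ∈ LinearMap.ker (d n),
        G.bracket (DirectSum.of (CohomologyOf d Bd) p (classOf d Bd φ))
          (DirectSum.of (CohomologyOf d Bd) q (classOf d Bd ψ)) =
        DirectSum.of (CohomologyOf d Bd) n (classOf d Bd ⟨P.bracket h φ.1 ψ.1, hb⟩)) := by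
  obtain ⟨M, hM⟩ := exists_cup_cohomology hd hB0 hBs
  obtain ⟨L, hL⟩ := exists_bracket_cohomology hd hB0 hBs
  have hrep : ∀ (n : ℕ) (v : CohomologyOf d Bd n), ∃ φ : LinearMap.ker (d n),
      classOf d Bd φ = v := fun n v => Submodule.mkQ_surjective _ v
  have hMof : ∀ (p q : ℕ) (φ : LinearMap.ker (d p)) (ψ : LinearMap.ker (d q)),
      M (DirectSum.of (CohomologyOf d Bd) p (classOf d Bd φ))
          (DirectSum.of (CohomologyOf d Bd) q (classOf d Bd ψ)) =
        DirectSum.of (CohomologyOf d Bd) (p + q)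
          (classOf d Bd ⟨P.cup φ.1 ψ.1, cup_mem_ker hd φ ψ⟩) := by
    intro p q φ ψ
    have h := hM (Represents.of φ) (Represents.of ψ)
    rw [of_cupT] at h
    exact h.unique (Represents.of ⟨_, cup_mem_ker hd φ ψ⟩)
  have hLof : ∀ (p q n : ℕ) (h : p + q = n + 1) (φ : LinearMap.ker (d p))
      (ψ : LinearMap.ker (d q)),
      L (DirectSum.of (CohomologyOf d Bd) p (classOf d Bd φ))
          (DirectSum.of (CohomologyOf d Bd) q (classOf d Bd ψ)) =
        DirectSum.of (CohomologyOf d Bd) n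
          (classOf d Bd ⟨P.bracket h φ.1 ψ.1, bracket_mem_ker hd h φ ψ⟩) := by
    intro p q n hn φ ψ
    have h := hL (Represents.of φ) (Represents.of ψ)
    rw [← of_bracket hn] at h
    exact h.unique (Represents.of ⟨_, bracket_mem_ker hd hn φ ψ⟩)
  have he := e_mem_ker hd
  have hone : Represents d Bd P.eT (DirectSum.of (CohomologyOf d Bd) 0 (classOf d Bd ⟨P.e, he⟩)) :=
    Represents.of ⟨P.e, he⟩
  have e1 : ∀ p : ℕ, (p : ℤ) - 1 + 1 = p := fun p => by ring
  have hD : ∀ {n : ℕ} (φ : LinearMap.ker (d n)), P.brk P.muT (DirectSum.of O n φ.1) = 0 :=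
    fun φ => (mem_ker_iff hd _).1 φ.2
  refine ⟨{
    mul := M
    one := classOf d Bd ⟨P.e, he⟩
    bracket := L
    mul_mem := ?_
    mul_assoc := ?_
    one_mul := ?_
    mul_one := ?_
    mul_comm := ?_
    bracket_mem := ?_
    bracket_zero_zero := ?_
    bracket_antisymm := ?_
    jacobi := ?_
    bracket_self := ?_
    bracket_bracket_self := ?_
    leibniz := ?_ }, ⟨he, rfl⟩, fun p q φ ψ => ⟨cup_mem_ker hd φ ψ, hMof p q φ ψ⟩,
    fun p q n h φ ψ => ⟨bracket_mem_ker hd h φ ψ, hLof p q n h φ ψ⟩⟩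
  · intro p q v w
    obtain ⟨φ, rfl⟩ := hrep p v
    obtain ⟨ψ, rfl⟩ := hrep q w
    exact ⟨_, hMof p q φ ψ⟩
  · intro u v w
    induction v using DirectSum.induction_on with
    | zero => simp
    | add v v' h h' => simp only [map_add, LinearMap.add_apply, h, h']
    | of q v =>
      induction w using DirectSum.induction_on with
      | zero => simp
      | add w w' h h' => simp only [map_add, h, h']
      | of r w =>
        obtain ⟨x, hx⟩ := exists_represents u
        obtain ⟨ψ, rfl⟩ := hrep q v
        obtain ⟨χ, rfl⟩ := hrep r w
        have h1 := hM (hM hx (Represents.of ψ)) (Represents.of χ)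
        rw [cupT_assoc _ (isHom_of q ψ.1) (isHom_of r χ.1)] at h1
        exact h1.unique (hM hx (hM (Represents.of ψ) (Represents.of χ)))
  · intro v
    induction v using DirectSum.induction_on with
    | zero => simp
    | add v v' h h' => rw [map_add, h, h']
    | of q v =>
      obtain ⟨ψ, rfl⟩ := hrep q v
      have h1 := hM hone (Represents.of ψ)
      rw [eT_cupT (isHom_of q ψ.1)] at h1
      exact h1.unique (Represents.of ψ)
  · intro v
    obtain ⟨x, hx⟩ := exists_represents v
    have h1 := hM hx hone
    rw [cupT_eT] at h1
    exact h1.unique hx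
  · intro p q v w
    obtain ⟨φ, rfl⟩ := hrep p v
    obtain ⟨ψ, rfl⟩ := hrep q w
    obtain ⟨t, ht⟩ := cupT_comm (isHom_of p φ.1) (isHom_of q ψ.1) (hD φ) (hD ψ)
    rw [e1, e1] at ht
    rw [← sg_smul (k := k)]
    exact (hM (Represents.of φ) (Represents.of ψ)).eq_of_sub hd hB0 hBs
      ((hM (Represents.of ψ) (Represents.of φ)).smul _) ht
  · intro p q n h v w
    obtain ⟨φ, rfl⟩ := hrep p v
    obtain ⟨ψ, rfl⟩ := hrep q w
    exact ⟨_, hLof p q n h φ ψ⟩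
  · intro v w
    obtain ⟨φ, rfl⟩ := hrep 0 v
    obtain ⟨ψ, rfl⟩ := hrep 0 w
    have h := hL (Represents.of φ) (Represents.of ψ)
    rw [brk_of_zero] at h
    exact h.unique .zero
  · intro p q v w
    obtain ⟨φ, rfl⟩ := hrep p v
    obtain ⟨ψ, rfl⟩ := hrep q w
    have h := hL (Represents.of φ) (Represents.of ψ)
    rw [brk_antisymm (isHom_of p φ.1) (isHom_of q ψ.1)] at h
    rw [← sg_smul (k := k)]
    exact h.unique ((hL (Represents.of ψ) (Represents.of φ)).smul _).neg
  · intro p q v w z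
    obtain ⟨φ, rfl⟩ := hrep p v
    obtain ⟨ψ, rfl⟩ := hrep q w
    induction z using DirectSum.induction_on with
    | zero => simp
    | add z z' h h' => simp only [map_add, h, h', smul_add]; abel
    | of r z =>
      obtain ⟨χ, rfl⟩ := hrep r z
      have h := hL (Represents.of φ) (hL (Represents.of ψ) (Represents.of χ))
      rw [brk_brk (isHom_of p φ.1) (isHom_of q ψ.1) (isHom_of r χ.1)] at h
      rw [← sg_smul (k := k)]
      exact h.unique ((hL (hL (Represents.of φ) (Represents.of ψ)) (Represents.of χ)).add
        ((hL (Represents.of ψ) (hL (Represents.of φ) (Represents.of χ))).smul _))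
  · intro p hp v
    obtain ⟨φ, rfl⟩ := hrep p v
    have h := hL (Represents.of φ) (Represents.of φ)
    rw [brk_self (isHom_of p φ.1) (by
      obtain ⟨m, rfl⟩ := hp
      exact ⟨m, by push_cast; ring⟩)] at h
    exact h.unique .zero
  · intro p hp v
    obtain ⟨φ, rfl⟩ := hrep p v
    have h := hL (Represents.of φ) (hL (Represents.of φ) (Represents.of φ))
    rw [brk_brk_self (isHom_of p φ.1) (by
      obtain ⟨m, rfl⟩ := hp
      exact ⟨m - 1, by push_cast; ring⟩)] at h
    exact h.unique .zero
  · intro p q c v w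
    obtain ⟨γ, rfl⟩ := hrep p c
    obtain ⟨φ, rfl⟩ := hrep q v
    induction w using DirectSum.induction_on with
    | zero => simp
    | add z z' h h' => simp only [map_add, h, h', smul_add]; abel
    | of r w =>
      obtain ⟨χ, rfl⟩ := hrep r w
      obtain ⟨t, ht⟩ := brk_cupT (isHom_of p γ.1) (isHom_of q φ.1) (isHom_of r χ.1) (hD γ) (hD φ)
        (hD χ)
      rw [e1] at ht
      rw [← sg_smul (k := k)]
      exact (hL (Represents.of γ) (hM (Represents.of φ) (Represents.of χ))).eq_of_sub hd hB0 hBs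
        ((hM (hL (Represents.of γ) (Represents.of φ)) (Represents.of χ)).add
          ((hM (Represents.of φ) (hL (Represents.of γ) (Represents.of χ))).smul _)) ht

end

end OperadWithMultiplication

/-! ### Cochains with coefficients in coextended modules -/

namespace LeftBialgebroid

section

variable {k A U : Type*} [CommRing k] [Ring A] [Algebra k A] [Ring U] [Algebra k U]
  (B : LeftBialgebroid k A U)

variable (X : Type*) [AddCommGroup X] [Module U X]

/-- The additive maps `f : U → X` such that `f(u ◃ a) = f(u) ◃ a`. -/
def coextSubgroup : AddSubgroup (U →+ X) where
  carrier := {f | ∀ a u, f (B.tgt a * u) = B.tgt a • f u}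
  add_mem' hf hg a u := by
    rw [AddMonoidHom.add_apply, AddMonoidHom.add_apply, hf, hg, smul_add]
  zero_mem' a u := (smul_zero _).symm
  neg_mem' hf a u := by rw [AddMonoidHom.neg_apply, AddMonoidHom.neg_apply, hf, smul_neg]

/-- The `U`-module `Hom_{Aᵒᵖ}(U_◃, X)`, with `(v f)(u) = f(uv)`. -/
def Coext : Type _ := B.coextSubgroup X

instance : AddCommGroup (B.Coext X) := inferInstanceAs (AddCommGroup (B.coextSubgroup X))

instance : FunLike (B.Coext X) U X where
  coe f := f.1
  coe_injective _ _ h := Subtype.ext (DFunLike.coe_injective h)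

variable {B X}

namespace Coext

@[ext]
theorem ext {f g : B.Coext X} (h : ∀ u, f u = g u) : f = g := DFunLike.ext _ _ h

theorem map_add (f : B.Coext X) (u v : U) : f (u + v) = f u + f v := f.1.map_add u v

theorem map_tgt_mul (f : B.Coext X) (a : A) (u : U) : f (B.tgt a * u) = B.tgt a • f u := f.2 a u

instance : Module U (B.Coext X) where
  smul v f := ⟨f.1.comp (AddMonoidHom.mulRight v), fun a u => by
    change f (B.tgt a * u * v) = B.tgt a • f (u * v)
    rw [mul_assoc, f.map_tgt_mul]⟩
  one_smul f := ext fun u => congrArg f (mul_one u)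
  mul_smul v w f := ext fun u => congrArg f (mul_assoc u v w).symm
  smul_zero v := rfl
  smul_add v f g := rfl
  add_smul v w f := ext fun u => (congrArg f (mul_add u v w)).trans (f.map_add _ _)
  zero_smul f := ext fun u => (congrArg f (mul_zero u)).trans f.1.map_zero

theorem smul_apply (v : U) (f : B.Coext X) (u : U) : (v • f) u = f (u * v) := rfl

theorem add_apply (f g : B.Coext X) (u : U) : (f + g) u = f u + g u := rfl

theorem zero_apply (u : U) : (0 : B.Coext X) u = 0 := rfl

/-- Evaluation at `u`. -/
def eval (u : U) : B.Coext X →+ X where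
  toFun f := f u
  map_zero' := rfl
  map_add' _ _ := rfl

theorem eval_apply (u : U) (f : B.Coext X) : eval u f = f u := rfl

/-- Functoriality of `Hom_{Aᵒᵖ}(U_◃, X)` in `X`. -/
def map {Y : Type*} [AddCommGroup Y] [Module U Y] (g : X →ₗ[U] Y) :
    B.Coext X →ₗ[U] B.Coext Y where
  toFun f := ⟨g.toAddMonoidHom.comp f.1, fun a u =>
    (congrArg g (f.map_tgt_mul a u)).trans (map_smul g _ _)⟩
  map_add' _ _ := ext fun _ => _root_.map_add g _ _
  map_smul' _ _ := rfl

/-- Projectivity of $U_\lhd$ enters here: coextension is $\mathrm{Hom}_{A^{op}}(U_\lhd,-)$, applied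
after restriction of scalars along $t$. -/
theorem map_surjective (hB : B.IsProjective) {Y : Type*} [AddCommGroup Y] [Module U Y]
    {g : X →ₗ[U] Y} (hg : Function.Surjective g) :
    Function.Surjective (map g : B.Coext X →ₗ[U] B.Coext Y) := by
  intro f
  let _ : Module Aᵐᵒᵖ U := Module.compHom U (B.t : Aᵐᵒᵖ →+* U)
  let _ : Module Aᵐᵒᵖ X := Module.compHom X (B.t : Aᵐᵒᵖ →+* U)
  let _ : Module Aᵐᵒᵖ Y := Module.compHom Y (B.t : Aᵐᵒᵖ →+* U)
  have : Module.Projective Aᵐᵒᵖ U := hB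
  let g' : X →ₗ[Aᵐᵒᵖ] Y := { g.toAddMonoidHom with map_smul' := fun a x => map_smul g (B.t a) x }
  let f' : U →ₗ[Aᵐᵒᵖ] Y := { f.1 with map_smul' := fun a u => f.2 (unop a) u }
  obtain ⟨h, hh⟩ := Module.projective_lifting_property g' f' hg
  refine ⟨⟨h.toAddMonoidHom, fun a u => map_smul h (op a) u⟩, ext fun u => ?_⟩
  exact LinearMap.congr_fun hh u

end Coext

section Curry

variable {n : ℕ} {φ : (Fin (n + 1) → U) → X}

/-- A cochain of degree `n + 1` as a function of its last `n` arguments. -/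
def IsCochain.curry (hφ : B.IsCochain φ) (u : Fin n → U) : B.Coext X :=
  ⟨AddMonoidHom.mk' (fun v => φ (Fin.cons v u)) fun v w => by
    have := hφ.map_add (Fin.cons v u) 0 v w
    simpa only [Fin.update_cons_zero] using this, fun a v => by
    have := hφ.linear (Fin.cons v u) 0 rfl a
    simp only [Fin.update_cons_zero, Fin.cons_zero] at this
    exact this⟩

theorem IsCochain.curry_apply (hφ : B.IsCochain φ) (u : Fin n → U) (v : U) :
    hφ.curry u v = φ (Fin.cons v u) := rfl

theorem IsCochain.isCochain_curry (hφ : B.IsCochain φ) : B.IsCochain hφ.curry where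
  map_add u i x y := Coext.ext fun v => by
    simp only [Coext.add_apply, curry_apply, Fin.cons_update, hφ.map_add]
  balanced u i j h a := Coext.ext fun v => by
    have := hφ.balanced (Fin.cons v u) i.succ j.succ (by simp [← h]) a
    simpa only [curry_apply, Fin.cons_update, Fin.cons_succ] using this
  linear u i h a := Coext.ext fun v => by
    have := hφ.balanced (Fin.cons v u) 0 i.succ (by simp [h]) a
    simp only [Fin.update_cons_zero, Fin.cons_zero, Fin.cons_succ] at this
    rw [Coext.smul_apply, curry_apply, curry_apply, this, Fin.cons_update]

theorem isCochain_uncurry {ψ : (Fin n → U) → B.Coext X} (hψ : B.IsCochain ψ) :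
    B.IsCochain fun u : Fin (n + 1) → U => ψ (Fin.tail u) (u 0) where
  map_add u i x y := by
    cases i using Fin.cases with
    | zero => simp [Coext.map_add]
    | succ i =>
      simp only [Fin.tail_update_succ, hψ.map_add, Coext.add_apply,
        Function.update_of_ne (Fin.succ_ne_zero i).symm]
  balanced u i j h a := by
    cases j using Fin.cases with
    | zero => simp at h
    | succ j =>
      cases i using Fin.cases with
      | zero =>
        have := hψ.linear (Fin.tail u) j (by simpa using h.symm) a
        simp only [Fin.tail_update_zero, Function.update_self, Fin.tail_update_succ,
          Function.update_of_ne (Fin.succ_ne_zero j).symm]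
        exact (congrArg (fun f : B.Coext X => f (u 0)) this).symm
      | succ i =>
        simp only [Fin.tail_update_succ, Function.update_of_ne (Fin.succ_ne_zero _).symm]
        exact congrArg (fun f : B.Coext X => f (u 0))
          (hψ.balanced (Fin.tail u) i j (by simpa using h) a)
  linear u i h a := by
    obtain rfl : i = 0 := Fin.ext h
    simp [Coext.map_tgt_mul]

/-- The first face gives $v\,\varphi(u)$. The other faces are those of the curried cochain with
opposite sign: since $U$ acts on the coextended module by right multiplication of the argument, its
first face is $\varphi(vu^1,u^2,\dots)$. -/
theorem IsCochain.coboundary_cons {φ : (Fin (n + 1) → U) → X} (hφ : B.IsCochain φ) (v : U)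
    (u : Fin (n + 1) → U) :
    B.coboundary φ (Fin.cons v u) = v • φ u - B.coboundary hφ.curry u v := by
  have h0 : Fin.contractNth (0 : Fin (n + 1)).castSucc (· * ·) (Fin.cons v u : Fin (n + 2) → U) =
      Fin.cons (v * u 0) (Fin.tail u) := by
    funext j
    cases j using Fin.cases with
    | zero => simp [Fin.contractNth]
    | succ j => simp [Fin.contractNth, Fin.tail]
  have h1 : ∀ i : Fin n, Fin.contractNth i.succ.castSucc (· * ·)
      (Fin.cons v u : Fin (n + 2) → U) =
      Fin.cons v (Fin.contractNth i.castSucc (· * ·) u) := by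
    intro i
    funext j
    cases j using Fin.cases with
    | zero => simp [Fin.contractNth]
    | succ j =>
      rw [Fin.cons_succ]
      simp only [Fin.contractNth, Fin.val_succ, Fin.val_castSucc, add_lt_add_iff_right,
        add_left_inj, ← Fin.succ_castSucc, Fin.cons_succ]
  have h2 : B.lastFace φ (Fin.cons v u) = B.lastFace hφ.curry u v := by
    cases n with
    | zero =>
      rw [LeftBialgebroid.lastFace, LeftBialgebroid.lastFace, Coext.smul_apply, IsCochain.curry_apply]
      congr 1
      funext j
      obtain rfl : j = 0 := Fin.eq_zero j
      simp
    | succ n =>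
      rw [LeftBialgebroid.lastFace, LeftBialgebroid.lastFace, IsCochain.curry_apply, Fin.cons_update]
      have h : Fin.init (Fin.cons v u : Fin (n + 3) → U) = Fin.cons v (Fin.init u) := by
        funext j
        cases j using Fin.cases <;> rfl
      rw [h]
      rfl
  have h3 : ∀ (S : Finset (Fin n)) (c : Fin n → ℤ) (f : Fin n → B.Coext X),
      (∑ i ∈ S, c i • f i) v = ∑ i ∈ S, c i • f i v := by
    intro S c f
    rw [← Coext.eval_apply, map_sum]
    simp only [map_zsmul, Coext.eval_apply]
  have h4 : ∀ (c : ℤ) (f : B.Coext X), (c • f) v = c • f v := fun c f =>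
    map_zsmul (Coext.eval v) c f
  rw [LeftBialgebroid.coboundary, LeftBialgebroid.coboundary, Fin.sum_univ_succ, h0, h2, Coext.add_apply, Coext.add_apply, h3, h4,
    Coext.smul_apply, IsCochain.curry_apply]
  simp only [h1, IsCochain.curry_apply, Fin.cons_zero, Fin.tail_cons, Fin.val_zero, Fin.val_succ,
    pow_succ, zero_add, pow_zero, mul_neg, mul_one, neg_smul, one_smul, neg_neg,
    Finset.sum_neg_distrib]
  abel

end Curry

/-- Currying lowers the degree and replaces the surjection by its coextension, which is still
surjective; in degree $0$ a cochain is just an element. -/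
theorem IsProjective.exists_lift {A U : Type v} [Ring A] [Algebra k A] [Ring U] [Algebra k U]
    {B : LeftBialgebroid k A U} (hB : B.IsProjective) {n : ℕ} {X Y : Type v} [AddCommGroup X]
    [Module U X] [AddCommGroup Y] [Module U Y] (g : X →ₗ[U] Y) (hg : Function.Surjective g)
    {φ : (Fin n → U) → Y} (hφ : B.IsCochain φ) :
    ∃ ψ : (Fin n → U) → X, B.IsCochain ψ ∧ ∀ u, g (ψ u) = φ u := by
  induction n generalizing X Y with
  | zero =>
    obtain ⟨x, hx⟩ := hg (φ Fin.elim0)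
    exact ⟨fun _ => x, ⟨fun _ i => i.elim0, fun _ i => i.elim0, fun _ i => i.elim0⟩,
      fun u => hx.trans (congrArg φ (Subsingleton.elim _ _))⟩
  | succ n ih =>
    obtain ⟨ψ, hψ, h⟩ := ih (Coext.map g) (Coext.map_surjective hB hg) hφ.isCochain_curry
    refine ⟨_, isCochain_uncurry hψ, fun u => ?_⟩
    have := congrArg (fun f : B.Coext Y => f (u 0)) (h (Fin.tail u))
    refine this.trans ?_
    rw [IsCochain.curry_apply, Fin.cons_self_tail]

end

end LeftBialgebroid

/-! ### The bar resolution -/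

namespace LeftBialgebroid

section

variable {k A U : Type*} [CommRing k] [Ring A] [Algebra k A] [Ring U] [Algebra k U]
  (B : LeftBialgebroid k A U)

/-- The relations of `U ⊗_{Aᵒᵖ} U^{⊗_{Aᵒᵖ} n}` in the free `U`-module on `Uⁿ`. -/
noncomputable def barRelations (n : ℕ) : Submodule U ((Fin n → U) →₀ U) :=
  Submodule.span U
    ({z | ∃ (u : Fin n → U) (i : Fin n) (x y : U),
        z = Finsupp.single (Function.update u i (x + y)) 1 -
          (Finsupp.single (Function.update u i x) 1 +
            Finsupp.single (Function.update u i y) 1)} ∪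
      {z | ∃ (u : Fin n → U) (i j : Fin n) (_ : (i : ℕ) + 1 = j) (a : A),
        z = Finsupp.single (Function.update u i (u i * B.tgt a)) 1 -
          Finsupp.single (Function.update u j (B.tgt a * u j)) 1} ∪
      {z | ∃ (u : Fin n → U) (i : Fin n) (_ : (i : ℕ) = 0) (a : A),
        z = Finsupp.single (Function.update u i (B.tgt a * u i)) 1 -
          B.tgt a • Finsupp.single u 1})

/-- The module `U ⊗_{Aᵒᵖ} U^{⊗_{Aᵒᵖ} n}` of the bar resolution. -/
abbrev Bar (n : ℕ) : Type _ := ((Fin n → U) →₀ U) ⧸ B.barRelations n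

/-- The generator `1 ⊗ u¹ ⊗ ⋯ ⊗ uⁿ`. -/
noncomputable def barMk {n : ℕ} (u : Fin n → U) : B.Bar n :=
  (B.barRelations n).mkQ (Finsupp.single u 1)

theorem isCochain_barMk (n : ℕ) : B.IsCochain (B.barMk : (Fin n → U) → B.Bar n) where
  map_add u i x y := by
    rw [barMk, barMk, barMk, ← map_add, ← sub_eq_zero, ← map_sub]
    exact (Submodule.Quotient.mk_eq_zero _).2
      (Submodule.subset_span (Or.inl (Or.inl ⟨u, i, x, y, rfl⟩)))
  balanced u i j h a := by
    rw [barMk, barMk, ← sub_eq_zero, ← map_sub]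
    exact (Submodule.Quotient.mk_eq_zero _).2
      (Submodule.subset_span (Or.inl (Or.inr ⟨u, i, j, h, a, rfl⟩)))
  linear u i h a := by
    rw [barMk, barMk, ← map_smul, ← sub_eq_zero, ← map_sub]
    exact (Submodule.Quotient.mk_eq_zero _).2
      (Submodule.subset_span (Or.inr ⟨u, i, h, a, rfl⟩))

variable {B} {X Y : Type*} [AddCommGroup X] [Module U X] [AddCommGroup Y] [Module U Y] {n : ℕ}

theorem bar_induction {P : B.Bar n → Prop} (x : B.Bar n) (h0 : P 0)
    (hadd : ∀ x y, P x → P y → P (x + y)) (hmk : ∀ (r : U) (u : Fin n → U), P (r • B.barMk u)) :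
    P x := by
  obtain ⟨x, rfl⟩ := Submodule.mkQ_surjective _ x
  induction x using Finsupp.induction_linear with
  | zero => rwa [map_zero]
  | add x y hx hy => rw [map_add]; exact hadd _ _ hx hy
  | single u r =>
    have := hmk r u
    rwa [barMk, ← map_smul, Finsupp.smul_single, smul_eq_mul, mul_one] at this

theorem bar_hom_ext {f g : B.Bar n →ₗ[U] X} (h : ∀ u, f (B.barMk u) = g (B.barMk u)) : f = g := by
  refine LinearMap.ext fun x => ?_
  induction x using bar_induction with
  | h0 => rw [map_zero, map_zero]
  | hadd x y hx hy => rw [map_add, map_add, hx, hy]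
  | hmk r u => rw [map_smul, map_smul, h]

/-- The `U`-linear map on the bar module determined by a cochain. -/
noncomputable def IsCochain.barLift {φ : (Fin n → U) → X} (hφ : B.IsCochain φ) :
    B.Bar n →ₗ[U] X :=
  (B.barRelations n).liftQ (Finsupp.linearCombination U φ) (by
    refine Submodule.span_le.2 ?_
    rintro _ ((⟨u, i, x, y, rfl⟩ | ⟨u, i, j, h, a, rfl⟩) | ⟨u, i, h, a, rfl⟩)
    · simp [hφ.map_add]
    · simp [hφ.balanced u i j h]
    · simp [hφ.linear u i h])

theorem IsCochain.barLift_barMk {φ : (Fin n → U) → X} (hφ : B.IsCochain φ) (u : Fin n → U) :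
    hφ.barLift (B.barMk u) = φ u := by
  change Finsupp.linearCombination U φ (Finsupp.single u 1) = _
  rw [Finsupp.linearCombination_single, one_smul]

theorem IsCochain.comp {φ : (Fin n → U) → X} (hφ : B.IsCochain φ) (g : X →ₗ[U] Y) :
    B.IsCochain fun u => g (φ u) where
  map_add u i x y := (congrArg g (hφ.map_add u i x y)).trans (_root_.map_add g _ _)
  balanced u i j h a := by rw [hφ.balanced u i j h]
  linear u i h a := by rw [hφ.linear u i h, map_smul]

theorem map_coboundary (g : X →ₗ[U] Y) (φ : (Fin n → U) → X) (u : Fin (n + 1) → U) :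
    g (B.coboundary φ u) = B.coboundary (fun u => g (φ u)) u := by
  have h : g (B.lastFace φ u) = B.lastFace (fun u => g (φ u)) u := by
    cases n with
    | zero => exact map_smul g _ _
    | succ n => rfl
  simp only [coboundary, map_add, map_sum, map_zsmul, map_smul, h]

variable (B)

/-- The differential of the bar resolution. -/
noncomputable def barD (n : ℕ) : B.Bar (n + 1) →ₗ[U] B.Bar n :=
  (B.isCochain_barMk n).coboundary.barLift

theorem barD_barMk (u : Fin (n + 1) → U) : B.barD n (B.barMk u) = B.coboundary B.barMk u :=
  IsCochain.barLift_barMk _ u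

/-- The unit of `A`, as an element of the `U`-module `A`. -/
def baseOne : B.Base := (1 : A)

theorem smul_baseOne (u : U) : u • B.baseOne = (B.counit u : A) := by
  change B.counit (u * B.s (1 : A)) = _
  rw [map_one, mul_one]

theorem tgt_base_add (a b : B.Base) : B.tgt (a + b : B.Base) = B.tgt a + B.tgt b :=
  map_add B.t (op (a : A)) (op (b : A))

theorem tgt_base_zero : B.tgt (0 : B.Base) = 0 := map_zero B.t

theorem isCochain_baseOne : B.IsCochain (fun _ : Fin 0 → U => B.baseOne) :=
  ⟨fun _ i => i.elim0, fun _ i => i.elim0, fun _ i => i.elim0⟩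

/-- The augmentation of the bar resolution. -/
noncomputable def barAug : B.Bar 0 →ₗ[U] B.Base := B.isCochain_baseOne.barLift

theorem barAug_barMk (u : Fin 0 → U) : B.barAug (B.barMk u) = B.baseOne :=
  IsCochain.barLift_barMk _ u

/-- The contracting homotopy `x ↦ (v ↦ [v, x])` of the bar resolution. -/
noncomputable def barH (n : ℕ) : B.Bar n →ₗ[U] B.Coext (B.Bar (n + 1)) :=
  (B.isCochain_barMk (n + 1)).isCochain_curry.barLift

theorem barH_barMk (u : Fin n → U) (v : U) :
    B.barH n (B.barMk u) v = B.barMk (Fin.cons v u : Fin (n + 1) → U) := by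
  rw [barH, IsCochain.barLift_barMk]
  rfl

/-- At $v=1$ this is $dh+hd=\mathrm{id}$. The homotopy is not $U$-linear as a map between bar
modules, only with values in the coextended module; keeping $v$ free lets the proof reduce to
generators, where it is `coboundary_cons`. -/
theorem barD_barH_succ (x : B.Bar (n + 1)) (v : U) :
    B.barD (n + 1) (B.barH (n + 1) x v) = v • x - B.barH n (B.barD n x) v := by
  induction x using bar_induction generalizing v with
  | h0 => simp only [map_zero, Coext.zero_apply, smul_zero, sub_zero]
  | hadd x y hx hy =>
    simp only [map_add, Coext.add_apply, smul_add, hx, hy]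
    abel
  | hmk r u =>
    rw [map_smul, map_smul, map_smul, Coext.smul_apply, Coext.smul_apply, barH_barMk, barD_barMk,
      IsCochain.coboundary_cons (B.isCochain_barMk (n + 1)), barD_barMk, map_coboundary, smul_smul]
    congr 3
    funext u
    rw [barH, IsCochain.barLift_barMk]

theorem barD_barH_zero (x : B.Bar 0) (v : U) (u : Fin 0 → U) :
    B.barD 0 (B.barH 0 x v) = v • x - B.tgt (B.barAug (v • x)) • B.barMk u := by
  induction x using bar_induction generalizing v with
  | h0 =>
    rw [smul_zero, map_zero, map_zero, Coext.zero_apply, map_zero, tgt_base_zero, zero_smul,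
      sub_zero]
  | hadd x y hx hy =>
    rw [map_add, Coext.add_apply, map_add, hx, hy, smul_add, map_add, tgt_base_add, add_smul]
    abel
  | hmk r w =>
    obtain rfl : w = u := Subsingleton.elim _ _
    rw [map_smul, Coext.smul_apply, barH_barMk, barD_barMk, smul_smul, map_smul, barAug_barMk,
      smul_baseOne, coboundary, lastFace, Fin.tail_cons, Fin.cons_zero,
      Subsingleton.elim (Fin.init _) w]
    simp [sub_eq_add_neg]

theorem barAug_barD (x : B.Bar 1) : B.barAug (B.barD 0 x) = 0 := by
  have h : B.barAug.comp (B.barD 0) = 0 := bar_hom_ext fun u => by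
    rw [LinearMap.comp_apply, barD_barMk, coboundary, lastFace, map_add, map_add, map_zsmul,
      map_smul, map_smul, barAug_barMk, barAug_barMk, smul_baseOne, smul_baseOne, counit_tgt]
    simp
    change (B.counit (u 0) : A) + 0 + (-1 : ℤ) • (B.counit (u 0) : A) = 0
    simp
  exact LinearMap.congr_fun h x

theorem bar_hom_succ_ext {f g : B.Bar (n + 1) →ₗ[U] X}
    (h : ∀ x v, f (B.barH n x v) = g (B.barH n x v)) : f = g :=
  bar_hom_ext fun u => by
    have := h (B.barMk (Fin.tail u)) (u 0)
    rwa [barH_barMk, Fin.cons_self_tail] at this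

/-- The values of the homotopy generate the bar module of positive degree, and on them $d^2$ is
computed from the homotopy formula and the vanishing of $d^2$, or of the augmentation composed with
$d$, one degree lower. -/
theorem barD_comp_barD (n : ℕ) : (B.barD n).comp (B.barD (n + 1)) = 0 := by
  induction n with
  | zero =>
    refine B.bar_hom_succ_ext fun x v => ?_
    rw [LinearMap.comp_apply, barD_barH_succ, map_sub, map_smul,
      barD_barH_zero B _ _ Fin.elim0, ← map_smul, barAug_barD, tgt_base_zero, zero_smul, sub_zero,
      sub_self, LinearMap.zero_apply]
  | succ n ih =>
    refine B.bar_hom_succ_ext fun x v => ?_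
    have ih' : B.barD n (B.barD (n + 1) x) = 0 := LinearMap.congr_fun ih x
    rw [LinearMap.comp_apply, barD_barH_succ, map_sub, map_smul, barD_barH_succ, ih', map_zero,
      Coext.zero_apply, sub_zero, sub_self, LinearMap.zero_apply]

theorem exists_barD_eq {x : B.Bar (n + 1)} (hx : B.barD n x = 0) :
    ∃ y, B.barD (n + 1) y = x := by
  refine ⟨B.barH (n + 1) x 1, ?_⟩
  rw [barD_barH_succ, hx, map_zero, Coext.zero_apply, sub_zero, one_smul]

theorem exists_barD_zero_eq {x : B.Bar 0} (hx : B.barAug x = 0) : ∃ y, B.barD 0 y = x := by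
  refine ⟨B.barH 0 x 1, ?_⟩
  rw [barD_barH_zero B _ _ Fin.elim0, one_smul, hx, tgt_base_zero, zero_smul, sub_zero]

theorem barAug_surjective : Function.Surjective B.barAug := by
  intro a
  refine ⟨B.s (a : A) • B.barMk Fin.elim0, ?_⟩
  rw [map_smul, barAug_barMk, smul_baseOne]
  exact B.counit_s a

end

end LeftBialgebroid

namespace LeftBialgebroid

open CategoryTheory

variable {k : Type w} {A U : Type v} [CommRing k] [Ring A] [Algebra k A] [Ring U] [Algebra k U]
  (B : LeftBialgebroid k A U)

/-- The bar complex of the left `U`-module `A`. -/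
noncomputable def barComplex : ChainComplex (ModuleCat.{v} U) ℕ :=
  ChainComplex.of (fun n => ModuleCat.of U (B.Bar n)) (fun n => ModuleCat.ofHom (B.barD n))
    fun n => by rw [← ModuleCat.ofHom_comp, B.barD_comp_barD]; rfl

theorem barComplex_d (n : ℕ) : B.barComplex.d (n + 1) n = ModuleCat.ofHom (B.barD n) :=
  ChainComplex.of_d (fun n => ModuleCat.of U (B.Bar n)) (fun n => ModuleCat.ofHom (B.barD n)) n

/-- Maps out of this module are cochains, so the lifting property is `exists_lift`. -/
theorem projective_bar (hB : B.IsProjective) (n : ℕ) : Projective (ModuleCat.of U (B.Bar n)) where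
  factors {E X} f e he := by
    have hs := (ModuleCat.epi_iff_surjective e).1 he
    obtain ⟨ψ, hψ, h⟩ := hB.exists_lift e.hom hs ((B.isCochain_barMk n).comp f.hom)
    refine ⟨ModuleCat.ofHom hψ.barLift, ModuleCat.hom_ext (bar_hom_ext fun u => ?_)⟩
    change e.hom (hψ.barLift (B.barMk u)) = f.hom (B.barMk u)
    rw [IsCochain.barLift_barMk, h]

theorem barComplex_d_comp_aug :
    B.barComplex.d 1 0 ≫ (ModuleCat.ofHom B.barAug : B.barComplex.X 0 ⟶ ModuleCat.of U B.Base) =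
      0 := by
  rw [barComplex_d]
  exact ModuleCat.hom_ext (LinearMap.ext B.barAug_barD)

theorem barComplex_exactAt_succ (n : ℕ) : B.barComplex.ExactAt (n + 1) := by
  rw [HomologicalComplex.exactAt_iff' _ (n + 1 + 1) (n + 1) n (by simp) (by simp),
    ShortComplex.moduleCat_exact_iff]
  intro x hx
  change B.barComplex.d (n + 1) n x = 0 at hx
  change ∃ y, B.barComplex.d (n + 1 + 1) (n + 1) y = x
  rw [barComplex_d] at hx ⊢
  exact B.exists_barD_eq hx

theorem shortComplex_aug_exact : (ShortComplex.mk (B.barComplex.d 1 0)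
    (ModuleCat.ofHom B.barAug : B.barComplex.X 0 ⟶ ModuleCat.of U B.Base)
    B.barComplex_d_comp_aug).Exact := by
  rw [ShortComplex.moduleCat_exact_iff]
  intro x hx
  change ∃ y, B.barComplex.d (0 + 1) 0 y = x
  rw [barComplex_d]
  exact B.exists_barD_zero_eq hx

theorem epi_barAug : Epi (ModuleCat.ofHom B.barAug : B.barComplex.X 0 ⟶ ModuleCat.of U B.Base) :=
  (ModuleCat.epi_iff_surjective _).2 B.barAug_surjective

/-- The augmentation, as a map of complexes. -/
noncomputable def barπ :
    B.barComplex ⟶ (ChainComplex.single₀ (ModuleCat.{v} U)).obj (ModuleCat.of U B.Base) :=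
  (ChainComplex.toSingle₀Equiv _ _).symm ⟨ModuleCat.ofHom B.barAug, B.barComplex_d_comp_aug⟩

theorem barπ_f_zero : B.barπ.f 0 = ModuleCat.ofHom B.barAug :=
  ChainComplex.toSingle₀Equiv_symm_apply_f_zero _ _

/-- The bar resolution of the left `U`-module `A`. -/
noncomputable def barResolution (hB : B.IsProjective) :
    ProjectiveResolution (ModuleCat.of U B.Base) where
  complex := B.barComplex
  projective := B.projective_bar hB
  π := B.barπ
  quasiIso := ⟨fun n => by
    cases n
    · rw [ChainComplex.quasiIsoAt₀_iff, ShortComplex.quasiIso_iff_of_zeros']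
      · refine (ShortComplex.exact_and_epi_g_iff_of_iso ?_).2
          ⟨B.shortComplex_aug_exact, B.epi_barAug⟩
        exact ShortComplex.isoMk (Iso.refl _) (Iso.refl _) (Iso.refl _)
          ((Category.id_comp _).trans (Category.comp_id _).symm)
          ((Category.id_comp _).trans (B.barπ_f_zero.symm.trans (Category.comp_id _).symm))
      all_goals rfl
    · rw [quasiIsoAt_iff_exactAt']
      · apply barComplex_exactAt_succ
      · apply ChainComplex.exactAt_succ_single_obj⟩

theorem isBarComparison_barMk (hB : B.IsProjective) :
    B.IsBarComparison (B.barResolution hB) fun n => (B.barMk : (Fin n → U) → B.Bar n) where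
  isCochain := B.isCochain_barMk
  augmentation u := B.barAug_barMk u
  d_comp n u := by
    change (B.barComplex.d (n + 1) n).hom (B.barMk u) = _
    rw [barComplex_d]
    exact B.barD_barMk u

end LeftBialgebroid

/-! ### Classes in `Ext` of cocycles on a projective resolution. -/

namespace CategoryTheory.ProjectiveResolution

open Abelian CochainComplex HomComplex

universe w' u' v'

variable {C : Type u'} [Category.{v'} C] [Abelian C] [HasExt.{w'} C] {X Y : C}
  (R : ProjectiveResolution X)

/-- A cobounding map in degree $0$ would start from the term of cohomological degree $1$ of the
resolution, which is zero. -/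
theorem eq_zero_of_extMk_eq_zero (f : R.complex.X 0 ⟶ Y) (m : ℕ) (hm : 0 + 1 = m)
    (hf : R.complex.d m 0 ≫ f = 0) (h : R.extMk f m hm hf = 0) : f = 0 := by
  rw [← R.extEquivCohomologyClass.apply_eq_iff_eq, extEquivCohomologyClass_extMk,
    extEquivCohomologyClass_zero, CohomologyClass.mk_eq_zero_iff,
    Cocycle.toSingleMk_mem_coboundaries_iff _ _ _ _ _ 1 (by lia)] at h
  obtain ⟨g, hg⟩ := h
  have hz : Limits.IsZero (R.cochainComplex.X 1) := R.cochainComplex.isZero_of_isStrictlyLE 0 1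
  rw [hz.eq_of_src g 0, Limits.comp_zero] at hg
  rw [← cancel_epi (R.cochainComplexXIso (-(0 : ℕ)) 0 rfl).hom, ← hg, Limits.comp_zero]

theorem smul_extMk {S : Type*} [Ring S] [Linear S C] (c : S) {n : ℕ} (f : R.complex.X n ⟶ Y)
    (m : ℕ) (hm : n + 1 = m) (hf : R.complex.d m n ≫ f = 0) :
    c • R.extMk f m hm hf = R.extMk (c • f) m hm (by simp [hf]) := by
  rw [Ext.smul_eq_comp_mk₀, extMk_comp_mk₀]
  congr 1
  simp

end CategoryTheory.ProjectiveResolution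

/-! ### Comparison with `Ext` -/

namespace LeftBialgebroid

open CategoryTheory

section

variable {k : Type w} {A U : Type v} [CommRing k] [Ring A] [Algebra k A] [Ring U] [Algebra k U]
  {B : LeftBialgebroid k A U} {N : Type v} [AddCommGroup N] [Module k N] [Module U N]
  [IsScalarTower k U N]

theorem coboundary_comp_eq {n : ℕ} (f : B.barComplex.X n ⟶ ModuleCat.of U N)
    (u : Fin (n + 1) → U) : B.coboundary (fun u => f.hom (B.barMk u)) u =
      (B.barComplex.d (n + 1) n ≫ f).hom (B.barMk u) := by
  rw [barComplex_d]
  change _ = f.hom (B.barD n (B.barMk u))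
  rw [barD_barMk]
  exact (map_coboundary (X := B.Bar n) (Y := N) f.hom B.barMk u).symm

theorem bar_hom_ext' {n : ℕ} {f g : B.barComplex.X n ⟶ ModuleCat.of U N}
    (h : ∀ u, f.hom (B.barMk u) = g.hom (B.barMk u)) : f = g :=
  ModuleCat.hom_ext (bar_hom_ext h)

/-- The map on the bar resolution given by a cochain. -/
noncomputable def cochainHom {n : ℕ} (φ : B.Cochain N n) : B.barComplex.X n ⟶ ModuleCat.of U N :=
  ModuleCat.ofHom (IsCochain.barLift φ.2)

theorem cochainHom_apply {n : ℕ} (φ : B.Cochain N n) (u : Fin n → U) :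
    (cochainHom φ).hom (B.barMk u) = φ.1 u :=
  IsCochain.barLift_barMk φ.2 u

/-- The cochain given by a map on the bar resolution. -/
noncomputable def homCochain {n : ℕ} (f : B.barComplex.X n ⟶ ModuleCat.of U N) : B.Cochain N n :=
  ⟨fun u => f.hom (B.barMk u), (B.isCochain_barMk n).comp f.hom⟩

theorem cochainHom_homCochain {n : ℕ} (f : B.barComplex.X n ⟶ ModuleCat.of U N) :
    cochainHom (homCochain f) = f :=
  bar_hom_ext' (cochainHom_apply _)

theorem homCochain_cochainHom {n : ℕ} (φ : B.Cochain N n) : homCochain (cochainHom φ) = φ :=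
  Subtype.ext (funext (cochainHom_apply φ))

theorem differential_homCochain {n : ℕ} (f : B.barComplex.X n ⟶ ModuleCat.of U N) :
    B.differential N n (homCochain f) = homCochain (B.barComplex.d (n + 1) n ≫ f) :=
  Subtype.ext (funext (coboundary_comp_eq f))

theorem barComplex_d_comp_cochainHom {n : ℕ} (φ : B.Cochain N n) :
    B.barComplex.d (n + 1) n ≫ cochainHom φ = cochainHom (B.differential N n φ) := by
  rw [← cochainHom_homCochain (_ ≫ _), ← differential_homCochain, homCochain_cochainHom]

theorem cochainHom_zero {n : ℕ} : cochainHom (0 : B.Cochain N n) = 0 :=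
  bar_hom_ext' (cochainHom_apply _)

theorem cochainHom_add {n : ℕ} (φ ψ : B.Cochain N n) :
    cochainHom (φ + ψ) = cochainHom φ + cochainHom ψ :=
  bar_hom_ext' fun u => (cochainHom_apply _ u).trans
    (congrArg₂ (· + ·) (cochainHom_apply φ u) (cochainHom_apply ψ u)).symm

theorem d_comp_cochainHom_cocycle {n : ℕ} (z : B.cocycles N n) :
    B.barComplex.d (n + 1) n ≫ cochainHom z.1 = 0 := by
  have h : B.differential N n z.1 = 0 := z.2
  rw [barComplex_d_comp_cochainHom, h, cochainHom_zero]

variable (N) in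
/-- The class in `Ext` of a cocycle. -/
noncomputable def cocycleToExt (hB : B.IsProjective) (n : ℕ) :
    B.cocycles N n →ₗ[k] B.ExtBase N n where
  toFun z := (B.barResolution hB).extMk (cochainHom z.1) (n + 1) rfl (d_comp_cochainHom_cocycle z)
  map_add' z z' := by
    refine Eq.trans ?_ (ProjectiveResolution.add_extMk _ _ _ _ _ _ _).symm
    congr 1
    exact cochainHom_add z.1 z'.1
  map_smul' c z := by
    let _ : Linear k (ModuleCat.{v} U) := ModuleCat.Algebra.instLinear
    refine Eq.trans ?_ (ProjectiveResolution.smul_extMk _ c _ _ _ _).symm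
    congr 1
    -- On morphisms $c$ acts through its image in $U$, on cochains directly; the scalar tower
    -- identifies the two.
    refine bar_hom_ext' fun u => (cochainHom_apply _ u).trans ?_
    refine Eq.trans ?_ (congrArg (algebraMap k U c • ·) (cochainHom_apply z.1 u)).symm
    exact (algebraMap_smul U c (z.1.1 u)).symm

theorem cocycleToExt_apply (hB : B.IsProjective) {n : ℕ} (z : B.cocycles N n) :
    cocycleToExt N hB n z = (B.barResolution hB).extMk (cochainHom z.1) (n + 1) rfl
      (d_comp_cochainHom_cocycle z) := rfl

theorem exists_cocycleToExt_eq (hB : B.IsProjective) (n : ℕ)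
    (f : (B.barResolution hB).complex.X n ⟶ ModuleCat.of U N)
    (hf : (B.barResolution hB).complex.d (n + 1) n ≫ f = 0) :
    ∃ z : B.cocycles N n, (∀ u, z.1.1 u = f.hom (B.barMk u)) ∧
      cocycleToExt N hB n z = (B.barResolution hB).extMk f (n + 1) rfl hf := by
  refine ⟨⟨homCochain f, LinearMap.mem_ker.2 ?_⟩, fun u => rfl, ?_⟩
  · refine (differential_homCochain (B := B) f).trans ?_
    rw [← homCochain_cochainHom 0, cochainHom_zero]
    exact congrArg homCochain hf
  · rw [cocycleToExt_apply]
    congr 1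
    exact cochainHom_homCochain f

theorem cocycleToExt_surjective (hB : B.IsProjective) (n : ℕ) :
    Function.Surjective (cocycleToExt N hB n) := by
  intro α
  obtain ⟨f, hf, rfl⟩ := (B.barResolution hB).extMk_surjective α (n + 1) rfl
  obtain ⟨z, -, hz⟩ := exists_cocycleToExt_eq hB n f hf
  exact ⟨z, hz⟩

/-- In positive degree the class vanishes when the map factors through the differential of the
resolution, and the factor is a cochain with the given coboundary. Degree $0$ is separate: there are
no coboundaries. -/
theorem ker_cocycleToExt (hB : B.IsProjective) (n : ℕ) :
    (B.coboundaries N n).submoduleOf (B.cocycles N n) = LinearMap.ker (cocycleToExt N hB n) := by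
  ext z
  rw [LinearMap.mem_ker, cocycleToExt_apply]
  change z.1 ∈ B.coboundaries N n ↔ _
  cases n with
  | zero =>
    refine ⟨fun h => ?_, fun h => ?_⟩
    · obtain rfl : z = 0 := Subtype.ext h
      exact map_zero (cocycleToExt N hB 0)
    · have h' : cochainHom z.1 = 0 := ProjectiveResolution.eq_zero_of_extMk_eq_zero _ _ _ _ _ h
      change z.1 = 0
      rw [← homCochain_cochainHom z.1, h', ← cochainHom_zero, homCochain_cochainHom]
  | succ n =>
    refine Iff.trans ?_ (ProjectiveResolution.extMk_eq_zero_iff _ _ _ _ _ n rfl).symm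
    refine ⟨?_, ?_⟩
    · rintro ⟨φ, hφ⟩
      refine ⟨cochainHom φ, (barComplex_d_comp_cochainHom φ).trans ?_⟩
      rw [hφ]
    · rintro ⟨g, hg⟩
      refine ⟨homCochain g, (differential_homCochain g).trans ?_⟩
      exact (congrArg homCochain hg).trans (homCochain_cochainHom z.1)

variable (N) in
/-- The comparison isomorphism between `Ext_U(A, N)` and the cohomology of the cochain complex. -/
noncomputable def extEquiv (hB : B.IsProjective) (n : ℕ) :
    B.ExtBase N n ≃ₗ[k] B.Cohomology N n :=
  ((Submodule.quotEquivOfEq _ _ (ker_cocycleToExt hB n)).trans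
    ((cocycleToExt N hB n).quotKerEquivOfSurjective (cocycleToExt_surjective hB n))).symm

theorem extEquiv_cocycleToExt (hB : B.IsProjective) (n : ℕ) (z : B.cocycles N n) :
    extEquiv N hB n (cocycleToExt N hB n z) = B.toCohomology z :=
  (LinearEquiv.symm_apply_eq _).2 rfl

end

end LeftBialgebroid

/-! ### Transport of structure -/

section Transport

variable {k : Type*} [CommRing k] {V W : ℕ → Type*} [∀ n, AddCommGroup (V n)]
  [∀ n, Module k (V n)] [∀ n, AddCommGroup (W n)] [∀ n, Module k (W n)]

theorem mapRange_linearEquiv_of (e : ∀ n, V n ≃ₗ[k] W n) (n : ℕ) (x : V n) :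
    DFinsupp.mapRange.linearEquiv e (DirectSum.of V n x) = DirectSum.of W n (e n x) :=
  DFinsupp.mapRange_single (hf := fun n => map_zero (e n))

theorem GerstenhaberAlgebra.exists_isIso (H : GerstenhaberAlgebra k W)
    (e : ∀ n, V n ≃ₗ[k] W n) : ∃ G : GerstenhaberAlgebra k V, G.IsIso H e := by
  let E : (⨁ n, V n) ≃ₗ[k] ⨁ n, W n := DFinsupp.mapRange.linearEquiv e
  have hE : ∀ n x, E (DirectSum.of V n x) = DirectSum.of W n (e n x) :=
    mapRange_linearEquiv_of e
  let M : (⨁ n, V n) →ₗ[k] (⨁ n, V n) →ₗ[k] ⨁ n, V n :=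
    (H.mul.compl₁₂ E.toLinearMap E.toLinearMap).compr₂ E.symm.toLinearMap
  let L : (⨁ n, V n) →ₗ[k] (⨁ n, V n) →ₗ[k] ⨁ n, V n :=
    (H.bracket.compl₁₂ E.toLinearMap E.toLinearMap).compr₂ E.symm.toLinearMap
  have hM : ∀ x y, E (M x y) = H.mul (E x) (E y) := fun x y => E.apply_symm_apply _
  have hL : ∀ x y, E (L x y) = H.bracket (E x) (E y) := fun x y => E.apply_symm_apply _
  have hs : ∀ (c : ℤ) x, E (c.negOnePow • x) = c.negOnePow • E x := fun c x => by
    rw [← sg_smul (k := k), ← sg_smul (k := k), map_smul]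
  refine ⟨{
    mul := M
    one := (e 0).symm H.one
    bracket := L
    mul_mem := fun p q x y => ?_
    mul_assoc := fun x y z => E.injective ?_
    one_mul := fun x => E.injective ?_
    mul_one := fun x => E.injective ?_
    mul_comm := fun p q x y => E.injective ?_
    bracket_mem := fun p q n h x y => ?_
    bracket_zero_zero := fun x y => E.injective ?_
    bracket_antisymm := fun p q x y => E.injective ?_
    jacobi := fun p q x y z => E.injective ?_
    bracket_self := fun p hp x => E.injective ?_
    bracket_bracket_self := fun p hp x => E.injective ?_
    leibniz := fun p q c x y => E.injective ?_ }, (e 0).apply_symm_apply _,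
      fun x y => ⟨hM x y, hL x y⟩⟩
  · obtain ⟨z, hz⟩ := H.mul_mem p q (e p x) (e q y)
    refine ⟨(e _).symm z, E.injective ?_⟩
    rw [hM, hE, hE, hE, hz, LinearEquiv.apply_symm_apply]
  · simp only [hM, H.mul_assoc]
  · rw [hM, hE, LinearEquiv.apply_symm_apply, H.one_mul]
  · rw [hM, hE, LinearEquiv.apply_symm_apply, H.mul_one]
  · rw [hs, hM, hM, hE, hE, H.mul_comm]
  · obtain ⟨z, hz⟩ := H.bracket_mem p q n h (e p x) (e q y)
    refine ⟨(e _).symm z, E.injective ?_⟩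
    rw [hL, hE, hE, hE, hz, LinearEquiv.apply_symm_apply]
  · rw [hL, hE, hE, H.bracket_zero_zero, map_zero]
  · rw [map_neg, hs, hL, hL, hE, hE, H.bracket_antisymm]
  · simp only [map_add, hs, hL, hE]
    exact H.jacobi _ _ _ _ _
  · rw [hL, hE, H.bracket_self p hp, map_zero]
  · rw [hL, hL, hE, H.bracket_bracket_self p hp, map_zero]
  · simp only [map_add, hs, hL, hM, hE]
    exact H.leibniz _ _ _ _ _

end Transport

/-! ### The main theorem. -/

theorem mainTheorem2 {k : Type w} {A U N : Type v} [CommRing k] [Ring A] [Algebra k A]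
    [Ring U] [Algebra k U] (B : LeftBialgebroid k A U)
    [Ring N] [Algebra k N] [Module U N] [IsScalarTower k U N]
    (Y : YetterDrinfeldAlgebra B N) (hY : Y.IsBraidedCommutative) :
    -- the cochains form an operad with multiplication
    ∃ O : OperadWithMultiplication k (fun p => B.Cochain N p),
      (∀ (p q n i : ℕ) (h : p + q = n + 1) (hi : 1 ≤ i) (hip : i ≤ p)
        (φ : B.Cochain N p) (ψ : B.Cochain N q),
        Y.IsInsertion h hi hip φ.1 ψ.1 (O.comp h i φ ψ).1) ∧
      (∀ u : Fin 2 → U, O.mu.1 u = B.s (B.counit (u 0 * u 1)) • (1 : N)) ∧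
      (∀ u : Fin 1 → U, O.one.1 u = B.s (B.counit (u 0)) • (1 : N)) ∧
      (∀ u : Fin 0 → U, O.e.1 u = 1) ∧
      -- the differential is that of the operad
      (∀ (p : ℕ) (φ : B.Cochain N p), B.differential N (p + 1) (B.differential N p φ) = 0) ∧
      (∀ (p : ℕ) (φ : B.Cochain N p),
        B.differential N p φ = O.bracket (show 2 + p = (p + 1) + 1 by omega) O.mu φ) ∧
      -- the induced operations make the cohomology a Gerstenhaber algebra
      ∃ G : GerstenhaberAlgebra k (fun n => B.Cohomology N n),
        (∃ he : O.e ∈ B.cocycles N 0, G.one = B.toCohomology ⟨O.e, he⟩) ∧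
        (∀ (p q : ℕ) (φ : B.cocycles N p) (ψ : B.cocycles N q),
          ∃ hc : O.cup φ.1 ψ.1 ∈ B.cocycles N (p + q),
            G.mul (DirectSum.of (fun n => B.Cohomology N n) p (B.toCohomology φ))
                (DirectSum.of (fun n => B.Cohomology N n) q (B.toCohomology ψ)) =
              DirectSum.of (fun n => B.Cohomology N n) (p + q)
                (B.toCohomology ⟨O.cup φ.1 ψ.1, hc⟩)) ∧
        (∀ (p q n : ℕ) (h : p + q = n + 1) (φ : B.cocycles N p) (ψ : B.cocycles N q),
          ∃ hb : O.bracket h φ.1 ψ.1 ∈ B.cocycles N n,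
            G.bracket (DirectSum.of (fun n => B.Cohomology N n) p (B.toCohomology φ))
                (DirectSum.of (fun n => B.Cohomology N n) q (B.toCohomology ψ)) =
              DirectSum.of (fun n => B.Cohomology N n) n
                (B.toCohomology ⟨O.bracket h φ.1 ψ.1, hb⟩)) ∧
        -- if `U` is projective over `Aᵒᵖ`, the canonical isomorphism transports this to `Ext`
        (B.IsProjective →
          ∃ (R : CategoryTheory.ProjectiveResolution (ModuleCat.of U B.Base))
            (β : ∀ n, (Fin n → U) → R.complex.X n)
            (e : ∀ n, B.ExtBase N n ≃ₗ[k] B.Cohomology N n),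
            B.IsBarComparison R β ∧
            (∀ (n : ℕ) (f : R.complex.X n ⟶ ModuleCat.of U N)
              (hf : CategoryTheory.CategoryStruct.comp (R.complex.d (n + 1) n) f = 0),
              ∃ z : B.cocycles N n, (∀ u, z.1.1 u = f.hom (β n u)) ∧
                e n (R.extMk f (n + 1) rfl hf) = B.toCohomology z) ∧
            ∃ G' : GerstenhaberAlgebra k (fun n => B.ExtBase N n), G'.IsIso G e) := by
  have : Fact Y.IsBraidedCommutative := ⟨hY⟩
  have hd : ∀ (p : ℕ) (φ : B.Cochain N p) (h : 2 + p = p + 1 + 1),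
      B.differential N p φ = Y.operad.bracket h Y.operad.mu φ :=
    fun p φ h => Y.differential_eq_bracket φ h
  obtain ⟨G, hone, hmul, hbr⟩ := OperadWithMultiplication.exists_gerstenhaberAlgebra
    (P := Y.operad) (d := B.differential N) (Bd := B.coboundaries N) hd rfl fun _ => rfl
  refine ⟨Y.operad, fun p q n i h hi hip φ ψ => Y.isInsertion_operad h hi hip φ ψ,
    Y.operad_mu_apply, Y.operad_one_apply, Y.operad_e_apply,
    fun p φ => OperadWithMultiplication.differential_differential hd φ, fun p φ => hd p φ _,
    G, hone, hmul, hbr, fun hB => ?_⟩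
  obtain ⟨G', hG'⟩ := GerstenhaberAlgebra.exists_isIso G fun n =>
    LeftBialgebroid.extEquiv N hB n
  -- The bar resolution itself serves as the projective resolution, and its generators,
  -- corresponding to the identity map, form the comparison.
  refine ⟨B.barResolution hB, fun n u => B.barMk u, fun n => LeftBialgebroid.extEquiv N hB n,
    B.isBarComparison_barMk hB, fun n f hf => ?_, G', hG'⟩
  obtain ⟨z, hz, he⟩ := LeftBialgebroid.exists_cocycleToExt_eq hB n f hf
  exact ⟨z, hz, by rw [← he, LeftBialgebroid.extEquiv_cocycleToExt]⟩
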